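/- Let $a>0$ and $\alpha\in\mathbb R$ with $a\alpha\neq-1$. Let $H_\alpha$ be the operator in $L^2(\mathbb R)$ associated with the closed quadratic form $$Q[\psi]=\|\psi'\|_2^2+\alpha\left(|\psi(a)|^2+|\psi(-a)|^2\right),\qquad D(Q)=H^1(\mathbb R),$$ that is, the one-dimensional Schrödinger operator with two delta interactions of strength $\alpha$ at the points $\pm a$. Let $e^{-itH_\alpha}$, $t\in\mathbb R$, be the strongly continuous unitary group in $L^2(\mathbb R)$ with generator $-iH_\alpha$ (this group exists), and let $P_c$ be the spectral projector of $H_\alpha$ on its absolutely continuous spectrum, i.e. the orthogonal projection onto the absolutely continuous subspace of $H_\alpha$. Then there is a constant $C$, depending only on $a$ and $\alpha$, such that for every $t>0$ the operator $e^{-itH_\alpha}P_c$, defined on $L^1(\mathbb R)\cap L^2(\mathbb R)$, extends to a bounded linear operator from $L^1(\mathbb R)$ to $L^\infty(\mathbb R)$, and this extension (denoted by the same symbol) satisfies $$\|e^{-itH_\alpha}P_c\,u\|_\infty\le C\,t^{-1/2}\,\|u\|_1\qquad\text{for all }u\in L^1(\mathbb R).$$ -/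

import Mathlib

open MeasureTheory ComplexConjugate

noncomputable section

/-! ### Abstract notions for an operator `A` in a complex Hilbert space -/

section Abstract

variable {E : Type*} [NormedAddCommGroup E] [InnerProductSpace ℂ E] [CompleteSpace E]

/-- `U t = e^{-itA}`: the strongly continuous one-parameter unitary group with generator `-iA`.
The last field says that `D(A)` is exactly the set of vectors whose orbit is differentiable at
`0`, and that the derivative is `-iAf`. For a given `A` there is at most one such `U`, and for
self-adjoint `A` there is exactly one. -/
structure IsSchrodingerGroup (A : E →ₗ.[ℂ] E) (U : ℝ → E →L[ℂ] E) : Prop where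
  zero : U 0 = 1
  add : ∀ s t, U (s + t) = U s * U t
  isometry : ∀ t f, ‖U t f‖ = ‖f‖
  continuous : ∀ f, Continuous fun t => U t f
  generator : ∀ f g, (f, g) ∈ A.graph ↔ HasDerivAt (fun t => U t f) (-Complex.I • g) 0

/-- The group `t ↦ e^{-itA}` (an arbitrary value if there is none). -/
def schrodingerGroup (A : E →ₗ.[ℂ] E) : ℝ → E →L[ℂ] E :=
  Classical.epsilon (IsSchrodingerGroup A)

/-- `μ` is the spectral measure of the vector `f` with respect to `A`: the finite Borel measure on
`ℝ` with `⟪f, (A - z)⁻¹ f⟫ = ∫ (s - z)⁻¹ dμ(s)` for every non-real `z`; here `g = (A - z)⁻¹ f`. -/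
def IsSpectralMeasure (A : E →ₗ.[ℂ] E) (f : E) (μ : Measure ℝ) : Prop :=
  IsFiniteMeasure μ ∧ ∀ z : ℂ, z.im ≠ 0 →
    ∃ g : A.domain, A g - z • (g : E) = f ∧ inner ℂ f (g : E) = ∫ s : ℝ, ((s : ℂ) - z)⁻¹ ∂μ

/-- The absolutely continuous subspace of `A`: the vectors whose spectral measure is absolutely
continuous with respect to Lebesgue measure. For self-adjoint `A` these vectors already form a
closed subspace, so that taking the closed span adds nothing. -/
def acSubspace (A : E →ₗ.[ℂ] E) : Submodule ℂ E :=
  (Submodule.span ℂ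
    {f : E | ∃ μ : Measure ℝ, IsSpectralMeasure A f μ ∧ μ ≪ volume}).topologicalClosure

instance (A : E →ₗ.[ℂ] E) : CompleteSpace (acSubspace A) :=
  Submodule.topologicalClosure.completeSpace _

/-- The spectral projector `P_c` of `A` on its absolutely continuous spectrum. -/
def acProjection (A : E →ₗ.[ℂ] E) : E →L[ℂ] E :=
  (acSubspace A).starProjection

end Abstract

/-! ### The Schrödinger operator with two delta interactions -/

/-- `f` is (the continuous representative of) an element of `H¹(ℝ)` and `f'` is its weak
derivative: `f` is the primitive of `f'`, and both are square integrable. -/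
structure IsH1 (f f' : ℝ → ℂ) : Prop where
  memLp : MemLp f 2
  memLp_deriv : MemLp f' 2
  sub_eq_integral : ∀ x y : ℝ, f y - f x = ∫ s in x..y, f' s

/-- The sesquilinear form of
`Q[ψ] = ‖ψ'‖² + α (|ψ(a)|² + |ψ(-a)|²)`, `ψ ∈ H¹(ℝ)`, conjugate-linear in the first function. -/
def deltaForm (a α : ℝ) (g g' f f' : ℝ → ℂ) : ℂ :=
  (∫ x, conj (g' x) * f' x) + α * (conj (g a) * f a + conj (g (-a)) * f (-a))

namespace IsH1

theorem zero : IsH1 (fun _ => 0) (fun _ => 0) := ⟨MemLp.zero', MemLp.zero', by simp⟩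

variable {f f' g g' : ℝ → ℂ}

theorem intervalIntegrable (hf : IsH1 f f') (x y : ℝ) :
    IntervalIntegrable f' volume x y :=
  intervalIntegrable_iff.mpr
    ((LocallyIntegrable.integrableOn_isCompact (hf.memLp_deriv.locallyIntegrable (by norm_num))
      isCompact_uIcc).mono_set Set.uIoc_subset_uIcc)

theorem add (hf : IsH1 f f') (hg : IsH1 g g') :
    IsH1 (fun x => f x + g x) (fun x => f' x + g' x) where
  memLp := hf.memLp.add hg.memLp
  memLp_deriv := hf.memLp_deriv.add hg.memLp_deriv
  sub_eq_integral x y := by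
    rw [intervalIntegral.integral_add (hf.intervalIntegrable x y) (hg.intervalIntegrable x y),
      ← hf.sub_eq_integral, ← hg.sub_eq_integral]
    ring

theorem smul (c : ℂ) (hf : IsH1 f f') :
    IsH1 (fun x => c * f x) (fun x => c * f' x) where
  memLp := hf.memLp.const_mul c
  memLp_deriv := hf.memLp_deriv.const_mul c
  sub_eq_integral x y := by
    rw [intervalIntegral.integral_const_mul, ← hf.sub_eq_integral]
    ring

theorem continuous (hf : IsH1 f f') : Continuous f := by
  have h : f = fun y => f 0 + ∫ s in (0 : ℝ)..y, f' s := by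
    funext y
    rw [← hf.sub_eq_integral]
    ring
  rw [h]
  exact continuous_const.add
    (intervalIntegral.continuous_primitive (fun x y => hf.intervalIntegrable x y) 0)

/-- If the function vanishes almost everywhere then so does its derivative. -/
theorem deriv_ae_eq_zero (hf : IsH1 f f') (h : f =ᵐ[volume] 0) : f' =ᵐ[volume] 0 := by
  have h0 : f = 0 := (hf.continuous.ae_eq_iff_eq volume continuous_const).1 h
  have hloc : LocallyIntegrable f' volume := hf.memLp_deriv.locallyIntegrable (by norm_num)
  filter_upwards [LocallyIntegrable.ae_hasDerivAt_integral hloc] with x hx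
  have h1 : (fun y => ∫ s in (0 : ℝ)..y, f' s) = fun _ => 0 := by
    funext y
    rw [← hf.sub_eq_integral, h0]
    simp
  have h2 := hx 0
  rw [h1] at h2
  exact h2.unique (hasDerivAt_const x 0)

/-- Smooth compactly supported functions belong to `H¹(ℝ)`. -/
theorem of_contDiff {φ : ℝ → ℝ} (hφ : ContDiff ℝ 1 φ) (hs : HasCompactSupport φ) :
    IsH1 (fun x => (φ x : ℂ)) (fun x => ((deriv φ x : ℝ) : ℂ)) where
  memLp := (hφ.continuous.memLp_of_hasCompactSupport hs).ofReal
  memLp_deriv :=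
    ((hφ.continuous_deriv le_rfl).memLp_of_hasCompactSupport hs.deriv).ofReal
  sub_eq_integral x y := by
    rw [intervalIntegral.integral_ofReal, intervalIntegral.integral_deriv_eq_sub]
    · push_cast; rfl
    · exact fun z _ => (hφ.differentiable one_ne_zero) z
    · exact (hφ.continuous_deriv le_rfl).intervalIntegrable _ _

end IsH1

theorem integrable_conj_mul {f g : ℝ → ℂ} (hf : MemLp f 2) (hg : MemLp g 2) :
    Integrable fun x => conj (f x) * g x :=
  hf.star.integrable_mul hg

theorem deltaForm_add (a α : ℝ) {g g' f₁ f₁' f₂ f₂' : ℝ → ℂ} (hg : IsH1 g g')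
    (h₁ : IsH1 f₁ f₁') (h₂ : IsH1 f₂ f₂') :
    deltaForm a α g g' (fun x => f₁ x + f₂ x) (fun x => f₁' x + f₂' x) =
      deltaForm a α g g' f₁ f₁' + deltaForm a α g g' f₂ f₂' := by
  simp only [deltaForm, mul_add]
  rw [integral_add (integrable_conj_mul hg.memLp_deriv h₁.memLp_deriv)
    (integrable_conj_mul hg.memLp_deriv h₂.memLp_deriv)]
  ring

theorem deltaForm_smul (a α : ℝ) (c : ℂ) (g g' f f' : ℝ → ℂ) :
    deltaForm a α g g' (fun x => c * f x) (fun x => c * f' x) =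
      c * deltaForm a α g g' f f' := by
  simp only [deltaForm, mul_left_comm _ c]
  rw [integral_const_mul]
  ring

/-- The graph of the operator associated with the form `Q`: the pairs `(ψ, η)` of elements of
`L²(ℝ)` with `ψ ∈ H¹(ℝ)` and `Q(g, ψ) = ⟪g, η⟫` for all `g ∈ H¹(ℝ)`. -/
def deltaGraph (a α : ℝ) :
    Submodule ℂ (Lp ℂ 2 (volume : Measure ℝ) × Lp ℂ 2 (volume : Measure ℝ)) where
  carrier := {p | ∃ f f' : ℝ → ℂ, IsH1 f f' ∧ p.1 =ᵐ[volume] f ∧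
    ∀ g g' : ℝ → ℂ, IsH1 g g' → deltaForm a α g g' f f' = ∫ x, conj (g x) * p.2 x}
  zero_mem' := by
    refine ⟨_, _, IsH1.zero, Lp.coeFn_zero _ _ _, fun g g' _ => ?_⟩
    simp [deltaForm]
  add_mem' := by
    rintro ⟨ψ₁, η₁⟩ ⟨ψ₂, η₂⟩ ⟨f₁, f₁', h₁, e₁, w₁⟩ ⟨f₂, f₂', h₂, e₂, w₂⟩
    refine ⟨_, _, h₁.add h₂, ?_, fun g g' hg => ?_⟩
    · filter_upwards [Lp.coeFn_add ψ₁ ψ₂, e₁, e₂] with x hx hx₁ hx₂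
      simp only [Prod.mk_add_mk] at *
      rw [hx, Pi.add_apply, hx₁, hx₂]
    · rw [deltaForm_add a α hg h₁ h₂, w₁ g g' hg, w₂ g g' hg,
        ← integral_add (integrable_conj_mul hg.memLp (Lp.memLp η₁))
          (integrable_conj_mul hg.memLp (Lp.memLp η₂))]
      refine integral_congr_ae ?_
      filter_upwards [Lp.coeFn_add η₁ η₂] with x hx
      simp only [Prod.mk_add_mk, hx, Pi.add_apply, mul_add]
  smul_mem' := by
    rintro c ⟨ψ, η⟩ ⟨f, f', h, e, w⟩
    refine ⟨_, _, h.smul c, ?_, fun g g' hg => ?_⟩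
    · filter_upwards [Lp.coeFn_smul c ψ, e] with x hx hx'
      simp only [Prod.smul_mk] at *
      rw [hx, Pi.smul_apply, hx', smul_eq_mul]
    · rw [deltaForm_smul, w g g' hg, ← integral_const_mul]
      refine integral_congr_ae ?_
      filter_upwards [Lp.coeFn_smul c η] with x hx
      simp only [Prod.smul_mk, hx, Pi.smul_apply, smul_eq_mul]
      ring

/-- The operator is single valued. -/
theorem deltaGraph_snd_eq_zero (a α : ℝ)
    (p : Lp ℂ 2 (volume : Measure ℝ) × Lp ℂ 2 (volume : Measure ℝ))
    (hp : p ∈ deltaGraph a α) (hp0 : p.1 = 0) : p.2 = 0 := by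
  obtain ⟨f, f', hf, e, w⟩ := hp
  have hf0 : f =ᵐ[volume] 0 := by
    rw [hp0] at e
    exact e.symm.trans (Lp.coeFn_zero _ _ _)
  have h0 : f = 0 := (hf.continuous.ae_eq_iff_eq volume continuous_const).1 hf0
  have hf0' := hf.deriv_ae_eq_zero hf0
  have key : ∀ᵐ x : ℝ, p.2 x = 0 := by
    refine ae_eq_zero_of_integral_contDiff_smul_eq_zero
      ((Lp.memLp p.2).locallyIntegrable (by norm_num)) fun φ hφ hs => ?_
    have h1 := w _ _ (IsH1.of_contDiff (hφ.of_le (by exact_mod_cast le_top)) hs)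
    have h2 : ∀ᵐ x : ℝ, conj ((deriv φ x : ℝ) : ℂ) * f' x = 0 := by
      filter_upwards [hf0'] with x hx
      rw [hx]; simp
    rw [deltaForm, integral_congr_ae h2] at h1
    simpa [h0] using h1.symm
  exact (Lp.eq_zero_iff_ae_eq_zero).2 key

/-- The operator `H_α` in `L²(ℝ)` associated with the closed form
`Q[ψ] = ‖ψ'‖² + α (|ψ(a)|² + |ψ(-a)|²)`, `D(Q) = H¹(ℝ)`. -/
def deltaHamiltonian (a α : ℝ) :
    Lp ℂ 2 (volume : Measure ℝ) →ₗ.[ℂ] Lp ℂ 2 (volume : Measure ℝ) :=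
  (deltaGraph a α).toLinearPMap

theorem deltaHamiltonian_graph (a α : ℝ) : (deltaHamiltonian a α).graph = deltaGraph a α :=
  Submodule.toLinearPMap_graph_eq _ (deltaGraph_snd_eq_zero a α)

end

/-! The interaction sits at two points, so the resolvent is explicit. For Im κ > 0 the kernel of
(H_α - κ²)⁻¹ is the free kernel i e^{iκ|x-y|}/(2κ) plus, for each parity σ = ±1, a rank-one term
w_σ(x) w_σ(y) with coefficient α/(4κ D_σ(κ)), where w_σ(x) = e^{iκ|x-a|} + σ e^{iκ|x+a|} and D_σ(κ)
= 2κ + iα(1 + σ e^{2iκa}) (`exists_isH1_resolventFun`). Everything is decided by the zeros of D_σ.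

In the open upper half-plane D_σ has at most one zero, simple and purely imaginary
(`parityDenom_zeros`), and such zeros are the bound states. On the real line only k = 0 can be a
zero. There D₊(0) = 2iα vanishes only if α = 0, when the term is absent. D₋(0) is always 0, but
D₋'(0) = 2(1 + aα), so aα ≠ -1 makes this zero simple, and the odd wave w₋, which also vanishes at κ
= 0, compensates for it.

Let f be integrable and orthogonal to the bound states. Then 2κ⟨f, (H_α - κ²)⁻¹f⟩ extends to a
bounded holomorphic function on the upper half-plane, and Cauchy's formula recovers it from its
boundary values on the real line. Hence the spectral measure of f is the image under k ↦ k² of an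
integrable density ρ(k) dk (`integral_spectralDensity`, `integrable_spectralDensity`). This
identifies the absolutely continuous subspace with the orthogonal complement of the bound states
(`acSubspace_eq`), and uniqueness of Laplace transforms gives ⟨f, e^{-itH}f⟩ = ∫ ρ(k) e^{-itk²} dk.

The density is a quadratic form in f whose kernel combines terms m(k) e^{ikr}, with m constant or a
multiple of 1/D_σ. A van der Corput estimate bounds ∫ m(k) e^{i(rk - tk²)} dk by C t^{-1/2}
uniformly in r, after the cancellation at k = 0 for the odd part. So |⟨f, e^{-itH}f⟩| ≤ C t^{-1/2}
‖f‖₁². Polarization, the boundedness of P_c on L¹ and the duality of L¹ and L^∞ turn this into the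
dispersive estimate, and density of L¹ ∩ L² in L¹ gives the extension.

The group itself comes from the continuous functional calculus of the bounded self-adjoint operator
(H_α + lam)⁻¹, obtained from coercivity of the form and the explicit resolvent. -/

noncomputable section

/-! ### The unitary group of an operator with a bounded self-adjoint resolvent -/

section UnitaryGroup

open Filter Topology

variable {E : Type*} [NormedAddCommGroup E] [InnerProductSpace ℂ E] [CompleteSpace E]

/-- `R = (A + lam)⁻¹` is an everywhere defined bounded self-adjoint operator. -/
structure IsRealResolvent (A : E →ₗ.[ℂ] E) (lam : ℝ) (R : E →L[ℂ] E) : Prop where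
  selfAdjoint : IsSelfAdjoint R
  graph_iff : ∀ f g, (f, g) ∈ A.graph ↔ R (g + (lam : ℂ) • f) = f

theorem LinearPMap.eq_of_mem_graph {E : Type*} [NormedAddCommGroup E] [InnerProductSpace ℂ E]
    {A : E →ₗ.[ℂ] E} {f g g' : E} (h : (f, g) ∈ A.graph)
    (h' : (f, g') ∈ A.graph) : g = g' := by
  rw [LinearPMap.mem_graph_iff] at h h'
  obtain ⟨y, hy, hy'⟩ := h
  obtain ⟨w, hw, hw'⟩ := h'
  have : y = w := Subtype.ext (hy.trans hw.symm)
  simp only at hy' hw'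
  rw [← hy', ← hw', this]

/-- The function of the resolvent variable `r = (s + lam)⁻¹` equal to `r * e^{-its}` for
real `r`. -/
def evolutionSymbol (lam t : ℝ) (w : ℂ) : ℂ :=
  w * Complex.exp (Complex.I * ((-t * (w.re⁻¹ - lam) : ℝ) : ℂ))

theorem norm_evolutionSymbol (lam t : ℝ) (w : ℂ) : ‖evolutionSymbol lam t w‖ = ‖w‖ := by
  rw [evolutionSymbol, norm_mul, Complex.norm_exp_I_mul_ofReal, mul_one]

/-- Taylor's formula covers |y| ≤ 1; for |y| > 1 the trivial bound 2 + |y| is at most 3y², which is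
where the 3 comes from. -/
theorem norm_exp_I_mul_sub_one_sub_le (y : ℝ) :
    ‖Complex.exp (Complex.I * y) - 1 - Complex.I * y‖ ≤ 3 * y ^ 2 := by
  by_cases hy : |y| ≤ 1
  · have := Complex.norm_exp_sub_one_sub_id_le (x := Complex.I * y) (by simpa using hy)
    have h2 : ‖Complex.I * (y : ℂ)‖ ^ 2 = y ^ 2 := by simp
    nlinarith [sq_nonneg y]
  · push Not at hy
    calc ‖Complex.exp (Complex.I * y) - 1 - Complex.I * y‖
        ≤ ‖Complex.exp (Complex.I * y)‖ + ‖(1 : ℂ)‖ + ‖Complex.I * (y : ℂ)‖ :=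
          (norm_sub_le _ _).trans (by gcongr; exact norm_sub_le _ _)
      _ = 2 + |y| := by
          rw [Complex.norm_exp_I_mul_ofReal]; simp; norm_num
      _ ≤ 3 * y ^ 2 := by rw [← sq_abs]; nlinarith

/-- The phase oscillates wildly as w → 0, but the modulus is ‖w‖. This is why the symbol carries the
factor w: it makes the symbol continuous on the whole spectrum of R, which may contain 0. -/
theorem continuousOn_evolutionSymbol (lam t : ℝ) {s : Set ℂ} (hs : ∀ w ∈ s, w = (w.re : ℂ)) :
    ContinuousOn (evolutionSymbol lam t) s := by
  intro w hw
  by_cases h0 : w = 0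
  · subst h0
    have h : Tendsto (evolutionSymbol lam t) (𝓝[s] 0) (𝓝 0) := by
      rw [tendsto_zero_iff_norm_tendsto_zero]
      simp only [norm_evolutionSymbol]
      exact (continuous_norm.tendsto' 0 0 (by simp)).mono_left nhdsWithin_le_nhds
    simpa [ContinuousWithinAt, evolutionSymbol] using h
  · have hre : w.re ≠ 0 := fun h => h0 (by rw [hs w hw, h]; simp)
    refine ContinuousAt.continuousWithinAt ?_
    unfold evolutionSymbol
    have h1 : ContinuousAt (fun w : ℂ => w.re⁻¹) w :=
      ContinuousAt.inv₀ Complex.continuous_re.continuousAt hre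
    fun_prop

namespace IsRealResolvent

variable {A : E →ₗ.[ℂ] E} {lam : ℝ} {R : E →L[ℂ] E}

/-- A vector killed by R is the image under A of the zero vector, and A is single valued. -/
theorem injective (h : IsRealResolvent A lam R) {x : E} (hx : R x = 0) : x = 0 := by
  have h1 : ((0 : E), x) ∈ A.graph := (h.graph_iff 0 x).2 (by simpa using hx)
  exact LinearPMap.eq_of_mem_graph h1 A.graph.zero_mem

/-- The orthogonal complement of the range of a self-adjoint operator is its kernel, which is
trivial here. -/
theorem denseRange (h : IsRealResolvent A lam R) : DenseRange R := by
  have h1 : (LinearMap.range R.toLinearMap)ᗮ = ⊥ := by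
    rw [Submodule.eq_bot_iff]
    intro x hx
    apply h.injective
    have : inner ℂ (R (R x)) x = 0 := hx (R (R x)) ⟨_, rfl⟩
    have h2 := (ContinuousLinearMap.isSelfAdjoint_iff_isSymmetric.1 h.selfAdjoint) (R x) x
    simp only [ContinuousLinearMap.coe_coe] at h2
    rw [this] at h2
    exact inner_self_eq_zero.1 h2.symm
  have h2 := Submodule.topologicalClosure_eq_top_iff.2 h1
  intro x
  have : x ∈ (LinearMap.range R.toLinearMap).topologicalClosure := by rw [h2]; trivial
  exact this

theorem isStarNormal (h : IsRealResolvent A lam R) : IsStarNormal R := h.selfAdjoint.isStarNormal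

theorem spectrum_real (h : IsRealResolvent A lam R) :
    ∀ w ∈ spectrum ℂ R, w = (w.re : ℂ) :=
  fun _ hw => h.selfAdjoint.mem_spectrum_eq_re hw

theorem norm_spectrum_le {w : ℂ} (hw : w ∈ spectrum ℂ R) :
    ‖w‖ ≤ ‖R‖ := by
  have := spectrum.norm_le_norm_mul_of_mem hw
  refine this.trans ?_
  have h1 : ‖(1 : E →L[ℂ] E)‖ ≤ 1 := ContinuousLinearMap.norm_id_le
  nlinarith [norm_nonneg R]

/-- `e^{-itA} R`. -/
def evolved (R : E →L[ℂ] E) (lam t : ℝ) : E →L[ℂ] E := cfc (evolutionSymbol lam t) R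

theorem evolved_zero (h : IsRealResolvent A lam R) : evolved R lam 0 = R := by
  have := h.isStarNormal
  unfold evolved
  conv_rhs => rw [← cfc_id' ℂ R]
  congr 1
  funext w
  simp [evolutionSymbol]

/-- Each factor on the left carries one power of the resolvent variable, so one of them survives as
the extra R. -/
theorem evolved_mul_evolved (h : IsRealResolvent A lam R) (s t : ℝ) :
    evolved R lam s * evolved R lam t = R * evolved R lam (s + t) := by
  have := h.isStarNormal
  have hc := fun t => continuousOn_evolutionSymbol lam t h.spectrum_real
  unfold evolved
  conv_rhs => enter [1]; rw [← cfc_id' ℂ R]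
  rw [← cfc_mul _ _ _ (hc s) (hc t), ← cfc_mul _ _ _ (by fun_prop) (hc _)]
  congr 1
  funext w
  have : ((-(s + t) * (w.re⁻¹ - lam) : ℝ) : ℂ) =
    ((-s * (w.re⁻¹ - lam) : ℝ) : ℂ) + ((-t * (w.re⁻¹ - lam) : ℝ) : ℂ) := by
    push_cast; ring
  simp only [evolutionSymbol]
  rw [this, mul_add, Complex.exp_add]
  ring

theorem commute_evolved (h : IsRealResolvent A lam R) (t : ℝ) :
    R * evolved R lam t = evolved R lam t * R := by
  have h1 := h.evolved_mul_evolved 0 t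
  have h2 := h.evolved_mul_evolved t 0
  rw [h.evolved_zero] at h1 h2
  rw [h2]; simp

/-- The symbol has the modulus of w, so T*T = R*R for T = `evolved R lam t`. This isometry relative
to R is what allows T R⁻¹ to be extended to the whole space. -/
theorem norm_evolved_apply (h : IsRealResolvent A lam R) (t : ℝ) (f : E) :
    ‖evolved R lam t f‖ = ‖R f‖ := by
  have := h.isStarNormal
  have hc := fun t => continuousOn_evolutionSymbol lam t h.spectrum_real
  have key : star (evolved R lam t) * evolved R lam t = star R * R := by
    have h1 : star R * R = cfc (fun w : ℂ => star w * w) R := by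
      rw [cfc_mul _ _ _ (by fun_prop) (by fun_prop), cfc_star, cfc_id' ℂ R]
    rw [h1]
    unfold evolved
    rw [← cfc_star, ← cfc_mul _ _ _ (hc t).star (hc t)]
    congr 1
    funext w
    have h2 : ∀ w : ℂ, star w * w = ((‖w‖ ^ 2 : ℝ) : ℂ) := fun w => by
      push_cast
      exact Complex.conj_mul' w
    rw [h2, h2, norm_evolutionSymbol]
  have h3 : ∀ T : E →L[ℂ] E, inner ℂ f ((star T * T) f) = ((‖T f‖ ^ 2 : ℝ) : ℂ) := fun T => by
    rw [ContinuousLinearMap.star_eq_adjoint, mul_apply_eq_comp,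
      ContinuousLinearMap.adjoint_inner_right, inner_self_eq_norm_sq_to_K]
    push_cast; rfl
  have h4 := h3 (evolved R lam t)
  rw [key, h3] at h4
  have h5 : ‖R f‖ ^ 2 = ‖evolved R lam t f‖ ^ 2 := by exact_mod_cast h4
  exact ((sq_eq_sq₀ (norm_nonneg _) (norm_nonneg _)).1 h5).symm

/-- On the spectrum the difference of symbols is at most |w| |s - t| |1/w - lam|. The factor w
cancels the pole and leaves |1 - lam w|, bounded by 1 + |lam| ‖R‖. -/
theorem norm_evolved_sub_le (h : IsRealResolvent A lam R) (s t : ℝ) :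
    ‖evolved R lam s - evolved R lam t‖ ≤ (1 + |lam| * ‖R‖) * |s - t| := by
  have := h.isStarNormal
  have hc := fun t => continuousOn_evolutionSymbol lam t h.spectrum_real
  unfold evolved
  rw [← cfc_sub _ _ _ (hc s) (hc t)]
  refine norm_cfc_le (by positivity) fun w hw => ?_
  by_cases h0 : w = 0
  · simp [h0, evolutionSymbol]; positivity
  have hwr := h.spectrum_real w hw
  have hre : w.re ≠ 0 := fun h => h0 (by rw [hwr, h]; simp)
  have h1 : evolutionSymbol lam s w - evolutionSymbol lam t w =
      evolutionSymbol lam t w *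
        (Complex.exp (Complex.I * ((-(s - t) * (w.re⁻¹ - lam) : ℝ) : ℂ)) - 1) := by
    have : ((-s * (w.re⁻¹ - lam) : ℝ) : ℂ) =
      ((-t * (w.re⁻¹ - lam) : ℝ) : ℂ) + ((-(s - t) * (w.re⁻¹ - lam) : ℝ) : ℂ) := by
      push_cast; ring
    simp only [evolutionSymbol]
    rw [this, mul_add, Complex.exp_add]
    ring
  rw [h1, norm_mul, norm_evolutionSymbol]
  have hn : ‖w‖ = |w.re| := by conv_lhs => rw [hwr]; simp
  calc ‖w‖ * _ ≤ ‖w‖ * ‖-(s - t) * (w.re⁻¹ - lam)‖ := by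
        gcongr; exact Real.norm_exp_I_mul_ofReal_sub_one_le
    _ = |1 - lam * w.re| * |s - t| := by
        rw [hn, norm_mul, norm_neg, Real.norm_eq_abs, Real.norm_eq_abs, mul_left_comm, mul_comm,
          ← abs_mul]
        congr 2; field_simp
    _ ≤ (1 + |lam| * ‖R‖) * |s - t| := by
        gcongr
        refine (abs_sub _ _).trans ?_
        rw [abs_one, abs_mul]
        gcongr
        rw [← hn]; exact norm_spectrum_le hw

/-- A second power of the resolvent absorbs the square of the unbounded variable 1/w - lam, so the
Taylor remainder of the exponential is quadratic in t in operator norm. -/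
theorem norm_evolved_mul_sub_le (h : IsRealResolvent A lam R) (t : ℝ) :
    ‖evolved R lam t * R - R * R + (Complex.I * t) • (R - (lam : ℂ) • (R * R))‖ ≤
      3 * (1 + |lam| * ‖R‖) ^ 2 * t ^ 2 := by
  have := h.isStarNormal
  have hc := fun t => continuousOn_evolutionSymbol lam t h.spectrum_real
  have e1 : evolved R lam t * R - R * R + (Complex.I * t) • (R - (lam : ℂ) • (R * R)) =
      cfc (fun w => evolutionSymbol lam t w * w - w * w + (Complex.I * t) *
        (w - (lam : ℂ) * (w * w))) R := by
    rw [cfc_add .., cfc_sub (fun w => evolutionSymbol lam t w * w) _ _ ((hc t).mul continuousOn_id)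
        (by fun_prop),
      cfc_mul _ _ _ (hc t) (by fun_prop), cfc_mul _ _ _ (by fun_prop) (by fun_prop),
      cfc_const_mul _ _ _ (by fun_prop), cfc_sub _ _ _ (by fun_prop) (by fun_prop),
      cfc_const_mul _ _ _ (by fun_prop),
      cfc_mul _ _ _ (by fun_prop) (by fun_prop), cfc_id' ℂ R]
    · rfl
  rw [e1]
  refine norm_cfc_le (by positivity) fun w hw => ?_
  by_cases h0 : w = 0
  · simp [h0]; positivity
  have hwr := h.spectrum_real w hw
  have hre : w.re ≠ 0 := fun h => h0 (by rw [hwr, h]; simp)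
  have hn : ‖w‖ = |w.re| := by conv_lhs => rw [hwr]; simp
  have hre' : (w.re : ℂ) ≠ 0 := by exact_mod_cast hre
  have h1 : evolutionSymbol lam t w * w - w * w + (Complex.I * t) * (w - (lam : ℂ) * (w * w)) =
      w * w * (Complex.exp (Complex.I * ((-t * (w.re⁻¹ - lam) : ℝ) : ℂ)) - 1 -
        Complex.I * ((-t * (w.re⁻¹ - lam) : ℝ) : ℂ)) := by
    simp only [evolutionSymbol]
    have h3 : w * (w.re : ℂ)⁻¹ = 1 := by
      conv_lhs => enter [1]; rw [hwr]
      exact mul_inv_cancel₀ hre'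
    push_cast
    linear_combination (-(Complex.I * t * w)) * h3
  rw [h1, norm_mul, norm_mul]
  calc ‖w‖ * ‖w‖ * _ ≤ ‖w‖ * ‖w‖ * (3 * (-t * (w.re⁻¹ - lam)) ^ 2) := by
        gcongr; exact norm_exp_I_mul_sub_one_sub_le _
    _ = 3 * |1 - lam * w.re| ^ 2 * t ^ 2 := by
        rw [hn, abs_mul_abs_self, sq_abs]
        field_simp
    _ ≤ _ := by
        gcongr
        refine (abs_sub _ _).trans ?_
        rw [abs_one, abs_mul]
        gcongr
        rw [← hn]; exact norm_spectrum_le hw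

/-- `t ↦ e^{-itA} R k` is differentiable at `0`. -/
theorem hasDerivAt_evolved (h : IsRealResolvent A lam R) (k : E) :
    HasDerivAt (fun t => evolved R lam t k) (-Complex.I • (k - (lam : ℂ) • R k)) 0 := by
  rw [hasDerivAt_iff_isLittleO, Asymptotics.isLittleO_iff]
  intro ε hε
  set B := 1 + |lam| * ‖R‖ with hB
  have hB1 : 1 ≤ B := by rw [hB]; nlinarith [mul_nonneg (abs_nonneg lam) (norm_nonneg R)]
  -- On R k₁ the error is quadratic in t; the remaining small vector k - R k₁ is controlled by the
  -- Lipschitz bound, with total contribution ε|t|/2.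
  obtain ⟨k₁, hk₁⟩ := h.denseRange.exists_dist_lt k (ε := ε / (4 * B)) (by positivity)
  rw [dist_eq_norm] at hk₁
  have hev : ∀ᶠ t : ℝ in 𝓝 0, |t| * (3 * B ^ 2 * ‖k₁‖) ≤ ε / 2 := by
    have : Tendsto (fun t : ℝ => |t| * (3 * B ^ 2 * ‖k₁‖)) (𝓝 0) (𝓝 0) := by
      have : Continuous (fun t : ℝ => |t| * (3 * B ^ 2 * ‖k₁‖)) := by fun_prop
      exact this.tendsto' 0 0 (by simp)
    exact this.eventually (ge_mem_nhds (by positivity))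
  filter_upwards [hev] with t ht
  rw [h.evolved_zero, sub_zero]
  have e : evolved R lam t k - R k - t • (-Complex.I • (k - (lam : ℂ) • R k)) =
      (evolved R lam t - evolved R lam 0) (k - R k₁) +
        (Complex.I * t) • ((k - R k₁) - (lam : ℂ) • R (k - R k₁)) +
      (evolved R lam t * R - R * R + (Complex.I * t) • (R - (lam : ℂ) • (R * R))) k₁ := by
    rw [h.evolved_zero]
    simp only [map_sub, sub_apply, add_apply,
      mul_apply_eq_comp, smul_apply, smul_sub, mul_smul, neg_smul,
      smul_neg, RCLike.real_smul_eq_coe_smul (K := ℂ) t, smul_comm (Complex.I) (t : ℂ)]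
    simp only [Complex.coe_algebraMap]
    abel
  rw [e]
  have n1 : ‖(evolved R lam t - evolved R lam 0) (k - R k₁)‖ ≤ B * |t| * (ε / (4 * B)) := by
    refine (ContinuousLinearMap.le_opNorm _ _).trans ?_
    have := h.norm_evolved_sub_le t 0
    rw [sub_zero] at this
    gcongr
  have n2 : ‖(Complex.I * t) • ((k - R k₁) - (lam : ℂ) • R (k - R k₁))‖ ≤
      |t| * (B * (ε / (4 * B))) := by
    rw [norm_smul, norm_mul, Complex.norm_I, one_mul, Complex.norm_real, Real.norm_eq_abs]
    gcongr
    calc _ ≤ ‖k - R k₁‖ + |lam| * (‖R‖ * ‖k - R k₁‖) := by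
          refine (norm_sub_le _ _).trans ?_
          rw [norm_smul, Complex.norm_real, Real.norm_eq_abs]
          gcongr
          exact R.le_opNorm _
      _ = B * ‖k - R k₁‖ := by rw [hB]; ring
      _ ≤ _ := by gcongr
  have n3 : ‖(evolved R lam t * R - R * R + (Complex.I * t) • (R - (lam : ℂ) • (R * R))) k₁‖ ≤
      3 * B ^ 2 * t ^ 2 * ‖k₁‖ :=
    (ContinuousLinearMap.le_opNorm _ _).trans (by gcongr; exact h.norm_evolved_mul_sub_le t)
  have n4 : 3 * B ^ 2 * t ^ 2 * ‖k₁‖ ≤ |t| * (ε / 2) := by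
    calc _ = |t| * (|t| * (3 * B ^ 2 * ‖k₁‖)) := by rw [← sq_abs t]; ring
      _ ≤ _ := by gcongr
  have n5 : B * |t| * (ε / (4 * B)) = |t| * (ε / 4) := by field_simp
  have n6 : |t| * (B * (ε / (4 * B))) = |t| * (ε / 4) := by field_simp
  refine (norm_add_le _ _).trans ((add_le_add (norm_add_le _ _) le_rfl).trans ?_)
  rw [Real.norm_eq_abs]
  linarith

/-- `e^{-itA}`, extended by continuity from the range of the resolvent. -/
def group (R : E →L[ℂ] E) (lam t : ℝ) : E →L[ℂ] E :=
  (evolved R lam t).toLinearMap.extendOfNorm R.toLinearMap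

theorem group_apply (h : IsRealResolvent A lam R) (t : ℝ) (k : E) :
    group R lam t (R k) = evolved R lam t k :=
  LinearMap.extendOfNorm_eq (f := (evolved R lam t).toLinearMap) (e := R.toLinearMap)
    h.denseRange ⟨1, fun x => by simp [h.norm_evolved_apply]⟩ k

theorem group_commute (h : IsRealResolvent A lam R) (t : ℝ) (f : E) :
    R (group R lam t f) = evolved R lam t f := by
  refine h.denseRange.induction_on (p := fun f => R (group R lam t f) = evolved R lam t f) f
    (isClosed_eq (by fun_prop) (by fun_prop)) fun k => ?_
  rw [h.group_apply]
  exact DFunLike.congr_fun (h.commute_evolved t) k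

theorem isSchrodingerGroup (h : IsRealResolvent A lam R) :
    IsSchrodingerGroup A (group R lam) where
  zero := by
    ext f
    refine h.denseRange.induction_on f (p := fun f => group R lam 0 f = (1 : E →L[ℂ] E) f)
      (isClosed_eq (by fun_prop) (by fun_prop)) fun k => ?_
    rw [h.group_apply, h.evolved_zero, one_apply_eq_self]
  add s t := by
    ext f
    -- Since R is injective, the group law may be checked after applying R twice, where both sides
    -- are expressed through `evolved`.
    rw [← sub_eq_zero]
    apply h.injective
    apply h.injective
    rw [map_sub, mul_apply_eq_comp, h.group_commute, h.group_commute, map_sub, sub_eq_zero]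
    have h1 := DFunLike.congr_fun (h.evolved_mul_evolved s t) f
    have h2 := DFunLike.congr_fun (h.commute_evolved s) (group R lam t f)
    simp only [mul_apply_eq_comp] at h1 h2
    rw [h2, h.group_commute, ← h1]
  isometry t f := by
    refine h.denseRange.induction_on f (p := fun f => ‖group R lam t f‖ = ‖f‖)
      (isClosed_eq (by fun_prop) (by fun_prop)) fun k => ?_
    rw [h.group_apply, h.norm_evolved_apply]
  continuous f := by
    have hiso : ∀ t f, ‖group R lam t f‖ = ‖f‖ := fun t f => by
      refine h.denseRange.induction_on f (p := fun f => ‖group R lam t f‖ = ‖f‖)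
        (isClosed_eq (by fun_prop) (by fun_prop)) fun k => ?_
      rw [h.group_apply, h.norm_evolved_apply]
    refine continuous_of_uniform_approx_of_continuous fun u hu => ?_
    obtain ⟨ε, hε, hu⟩ := Metric.mem_uniformity_dist.1 hu
    obtain ⟨k, hk⟩ := h.denseRange.exists_dist_lt f hε
    refine ⟨fun t => evolved R lam t k, ?_, fun t => hu ?_⟩
    · have hl : LipschitzWith (Real.toNNReal ((1 + |lam| * ‖R‖) * ‖k‖))
          (fun t => evolved R lam t k) := by
        refine LipschitzWith.of_dist_le' fun s t => ?_
        rw [dist_eq_norm, ← sub_apply, Real.dist_eq]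
        refine (ContinuousLinearMap.le_opNorm _ _).trans ?_
        calc _ ≤ ((1 + |lam| * ‖R‖) * |s - t|) * ‖k‖ := by
              gcongr; exact h.norm_evolved_sub_le s t
          _ = _ := by ring
      exact hl.continuous
    · beta_reduce
      rw [← h.group_apply, dist_eq_norm, ← map_sub, hiso, ← dist_eq_norm]
      exact hk
  generator f g := by
    constructor
    · intro hfg
      have hf := (h.graph_iff f g).1 hfg
      have h1 := h.hasDerivAt_evolved (g + (lam : ℂ) • f)
      rw [hf] at h1
      simp only [← h.group_apply, hf, add_sub_cancel_right] at h1
      exact h1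
    · intro hd
      -- For the converse, R applied to the orbit of f is `evolved R lam t f`, whose derivative is
      -- known for every f. Comparing the two derivatives gives R g = f - lam R f, the resolvent
      -- form of Af = g.
      have h1 : HasDerivAt (fun t => R (group R lam t f)) (R (-Complex.I • g)) 0 :=
        (R.restrictScalars ℝ).hasFDerivAt.comp_hasDerivAt 0 hd
      simp only [h.group_commute] at h1
      have h2 := h1.unique (h.hasDerivAt_evolved f)
      rw [map_smul] at h2
      have h3 := smul_right_injective E (neg_ne_zero.2 Complex.I_ne_zero) h2
      rw [h.graph_iff, map_add, h3, map_smul]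
      abel

end IsRealResolvent

end UnitaryGroup

/-! ### Laplace transform of the unitary group; eigenvectors -/

section GroupProperties

open Filter Topology Set

variable {E : Type*} [NormedAddCommGroup E] [InnerProductSpace ℂ E]

namespace IsSchrodingerGroup

variable {A : E →ₗ.[ℂ] E} {U : ℝ → E →L[ℂ] E}

theorem hasDerivAt (h : IsSchrodingerGroup A U) {f g : E} (hfg : (f, g) ∈ A.graph) (t : ℝ) :
    HasDerivAt (fun t => U t f) (U t (-Complex.I • g)) t := by
  have h1 := (h.generator f g).1 hfg
  have h2 : HasDerivAt (fun s => U t (U s f)) (U t (-Complex.I • g)) 0 :=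
    ((U t).restrictScalars ℝ).hasFDerivAt.comp_hasDerivAt 0 h1
  have h3 : HasDerivAt (fun s => U t (U (s - t) f)) (U t (-Complex.I • g)) t := by
    have h2' : HasDerivAt (fun s => U t (U s f)) (U t (-Complex.I • g)) (t - t) := by
      rwa [sub_self]
    exact HasDerivAt.comp_sub_const t t h2'
  refine h3.congr_of_eventuallyEq (Eventually.of_forall fun s => ?_)
  beta_reduce
  rw [← mul_apply_eq_comp, ← h.add, add_sub_cancel]

/-- The orbit of an eigenvector. -/
theorem apply_eigenvector (h : IsSchrodingerGroup A U) {e : E} {s : ℝ}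
    (he : (e, (s : ℂ) • e) ∈ A.graph) (t : ℝ) :
    U t e = Complex.exp (-Complex.I * s * t) • e := by
  have hd : ∀ t : ℝ, HasDerivAt (fun t : ℝ => Complex.exp (Complex.I * s * t) • U t e) 0 t := by
    intro t
    have h1 : HasDerivAt (fun t : ℝ => Complex.exp (Complex.I * s * t))
        (Complex.exp (Complex.I * s * t) * (Complex.I * s)) t := by
      have := ((Complex.ofRealCLM.hasDerivAt (x := t)).const_mul (Complex.I * s)).cexp
      simpa using this
    have h2 := h1.smul (h.hasDerivAt he t)
    refine h2.congr_deriv ?_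
    rw [map_smul, map_smul, smul_smul, smul_smul, ← add_smul]
    ring_nf; simp
  have hc := is_const_of_deriv_eq_zero (fun t => (hd t).differentiableAt) (fun t => (hd t).deriv) t 0
  simp only [h.zero, one_apply_eq_self, Complex.ofReal_zero, mul_zero, Complex.exp_zero,
    one_smul] at hc
  conv_rhs => rw [← hc, smul_smul, ← Complex.exp_add]
  ring_nf; simp

theorem integrableOn_exp_smul (h : IsSchrodingerGroup A U) {z : ℂ} (hz : 0 < z.im) (f : E) :
    IntegrableOn (fun t : ℝ => Complex.exp (Complex.I * z * t) • U t f) (Ioi 0) := by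
  have hi : IntegrableOn (fun t : ℝ => Real.exp (-z.im * t) * ‖f‖) (Ioi 0) :=
    (integrableOn_exp_mul_Ioi (by linarith) 0).mul_const _
  refine hi.mono' (Continuous.aestronglyMeasurable ?_) (ae_of_all _ fun t => ?_)
  · exact Continuous.smul (by fun_prop) (h.continuous f)
  · rw [norm_smul, h.isometry, Complex.norm_exp]
    simp

/-- The resolvent is the Laplace transform of the group. -/
theorem integral_exp_smul [CompleteSpace E] (h : IsSchrodingerGroup A U) {z : ℂ} (hz : 0 < z.im)
    {f g : E} (hg : (g, f + z • g) ∈ A.graph) :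
    ∫ t : ℝ in Ioi 0, Complex.exp (Complex.I * z * t) • U t f = -Complex.I • g := by
  -- As Ag = f + zg, the factor e^{izt} cancels the z-part, so e^{izt}U_t g is a primitive of the
  -- integrand up to the constant -i.
  have hd : ∀ t : ℝ, HasDerivAt (fun t : ℝ => Complex.exp (Complex.I * z * t) • U t g)
      (-Complex.I • (Complex.exp (Complex.I * z * t) • U t f)) t := by
    intro t
    have h1 : HasDerivAt (fun t : ℝ => Complex.exp (Complex.I * z * t))
        (Complex.exp (Complex.I * z * t) * (Complex.I * z)) t := by
      have := ((Complex.ofRealCLM.hasDerivAt (x := t)).const_mul (Complex.I * z)).cexp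
      simpa using this
    have h2 := h1.smul (h.hasDerivAt hg t)
    refine h2.congr_deriv ?_
    simp only [map_smul, map_add, smul_add, smul_smul]
    rw [add_assoc, ← add_smul]
    ring_nf; simp
  have ht : Tendsto (fun t : ℝ => Complex.exp (Complex.I * z * t) • U t g) atTop (𝓝 0) := by
    rw [tendsto_zero_iff_norm_tendsto_zero]
    have e : ∀ t : ℝ, ‖Complex.exp (Complex.I * z * t) • U t g‖ = Real.exp (-(z.im * t)) * ‖g‖ := by
      intro t
      rw [norm_smul, h.isometry, Complex.norm_exp]; simp
    simp only [e]
    have := (Real.tendsto_exp_neg_atTop_nhds_zero.comp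
      (tendsto_id.const_mul_atTop hz)).mul_const ‖g‖
    simpa using this
  have := integral_Ioi_of_hasDerivAt_of_tendsto' (a := 0) (fun t _ => hd t)
    ((h.integrableOn_exp_smul hz f).smul _) ht
  rw [integral_smul] at this
  simp only [h.zero, one_apply_eq_self, Complex.ofReal_zero, mul_zero, Complex.exp_zero,
    one_smul, zero_sub] at this
  have h3 := congrArg (fun x => Complex.I • x) this
  simp only [smul_smul] at h3
  simpa using h3

theorem inner_apply_right (h : IsSchrodingerGroup A U) (t : ℝ) (f g : E) :
    inner ℂ f (U t g) = inner ℂ (U (-t) f) g := by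
  have h1 : U t (U (-t) f) = f := by
    rw [← mul_apply_eq_comp, ← h.add, add_neg_cancel, h.zero, one_apply_eq_self]
  have h2 := LinearMap.norm_map_iff_inner_map_map (𝕜 := ℂ) (U t)
  conv_lhs => rw [← h1]
  exact (h2.1 (h.isometry t)) _ _

end IsSchrodingerGroup

/-- A vector with absolutely continuous spectral measure is orthogonal to every eigenvector. -/
theorem inner_eigenvector_eq_zero {A : E →ₗ.[ℂ] E}
    (hA : ∀ p q : E × E, p ∈ A.graph → q ∈ A.graph → inner ℂ p.1 q.2 = inner ℂ p.2 q.1)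
    {f e : E} {s : ℝ} (he : (e, (s : ℂ) • e) ∈ A.graph) {μ : Measure ℝ}
    (hμ : IsSpectralMeasure A f μ) (hac : μ ≪ volume) : inner ℂ e f = 0 := by
  obtain ⟨hfin, hμ⟩ := hμ
  -- With g = (A - s - iε)⁻¹f, symmetry of A gives ⟨e, f⟩ = -iε⟨e, g⟩ and ε‖g‖² ≤ |⟨f, g⟩|. So |⟨e,
  -- f⟩|² is at most ‖e‖² |∫ ε/(x - s - iε) dμ|, and the integral tends to zero in absolute value
  -- when μ has no atom at s.
  have key : ∀ ε : ℝ, 0 < ε → ‖inner ℂ e f‖ ^ 2 ≤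
      ‖e‖ ^ 2 * ‖∫ x : ℝ, (ε : ℂ) * ((x : ℂ) - (s + ε * Complex.I))⁻¹ ∂μ‖ := by
    intro ε hε
    obtain ⟨g, hg, hi⟩ := hμ (s + ε * Complex.I) (by simpa using hε.ne')
    have hgr : ((g : E), f + (s + ε * Complex.I : ℂ) • (g : E)) ∈ A.graph := by
      rw [← hg, sub_add_cancel]; exact LinearPMap.mem_graph A g
    rw [integral_const_mul, ← hi]
    have h1 := hA _ _ he hgr
    simp only [inner_add_right, inner_smul_right, inner_smul_left, Complex.conj_ofReal] at h1
    have h2 : inner ℂ e f = -(ε * Complex.I) * inner ℂ e (g : E) := by linear_combination h1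
    have h3 := hA _ _ hgr hgr
    simp only [inner_add_right, inner_add_left, inner_smul_right, inner_smul_left,
      map_add, map_mul, Complex.conj_ofReal, Complex.conj_I] at h3
    have h4 : inner ℂ f (g : E) - inner ℂ (g : E) f = 2 * (ε * Complex.I) * inner ℂ (g : E) g := by
      linear_combination -h3
    have h5 : 2 * ε * ‖(g : E)‖ ^ 2 ≤ 2 * ‖inner ℂ f (g : E)‖ := by
      have := congrArg norm h4
      rw [norm_mul, norm_mul, norm_mul, inner_self_eq_norm_sq_to_K] at this
      simp only [Complex.norm_real, Complex.norm_I, mul_one, Complex.norm_ofNat,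
        Real.norm_eq_abs, abs_of_pos hε, Complex.coe_algebraMap, norm_pow] at this
      calc 2 * ε * ‖(g : E)‖ ^ 2 = ‖inner ℂ f (g : E) - inner ℂ (g : E) f‖ := by
            rw [this, abs_norm]
        _ ≤ ‖inner ℂ f (g : E)‖ + ‖inner ℂ (g : E) f‖ := norm_sub_le _ _
        _ = _ := by rw [norm_inner_symm]; ring
    rw [h2, norm_mul, norm_neg, norm_mul, norm_mul, Complex.norm_I, mul_one, Complex.norm_real,
      Real.norm_eq_abs, abs_of_pos hε]
    calc (ε * ‖inner ℂ e (g : E)‖) ^ 2 ≤ (ε * (‖e‖ * ‖(g : E)‖)) ^ 2 := by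
          gcongr; exact norm_inner_le_norm _ _
      _ = ‖e‖ ^ 2 * (ε * (ε * ‖(g : E)‖ ^ 2)) := by ring
      _ ≤ ‖e‖ ^ 2 * (ε * ‖inner ℂ f (g : E)‖) := by gcongr; linarith
  have hlim : Tendsto (fun ε : ℝ => ∫ x : ℝ, (ε : ℂ) * ((x : ℂ) - (s + ε * Complex.I))⁻¹ ∂μ)
      (𝓝[>] 0) (𝓝 (∫ _ : ℝ, (0 : ℂ) ∂μ)) := by
    refine tendsto_integral_filter_of_dominated_convergence (fun _ => 1) ?_ ?_
      (integrable_const _) ?_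
    · exact Eventually.of_forall fun ε => Measurable.aestronglyMeasurable (by fun_prop)
    · filter_upwards [self_mem_nhdsWithin] with ε hε
      refine ae_of_all _ fun x => ?_
      have hε : 0 < ε := hε
      rw [norm_mul, norm_inv, Complex.norm_real, Real.norm_eq_abs, abs_of_pos hε,
        ← div_eq_mul_inv]
      have : ε ≤ ‖(x : ℂ) - (s + ε * Complex.I)‖ := by
        have := Complex.abs_im_le_norm ((x : ℂ) - (s + ε * Complex.I))
        simpa [abs_of_pos hε] using this
      exact div_le_one_of_le₀ this (norm_nonneg _)
    -- The only use of absolute continuity: the point s is μ-null.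
    · have : ∀ᵐ x : ℝ ∂μ, x ≠ s := hac.ae_le (by
        simp [mem_ae_iff])
      filter_upwards [this] with x hx
      have hx' : (x : ℂ) - (s + (0 : ℝ) * Complex.I) ≠ 0 := by
        simp only [Complex.ofReal_zero, zero_mul, add_zero]
        rw [sub_ne_zero]; exact_mod_cast hx
      have : ContinuousAt (fun ε : ℝ => (ε : ℂ) * ((x : ℂ) - (s + ε * Complex.I))⁻¹) 0 :=
        ContinuousAt.mul (by fun_prop) (ContinuousAt.inv₀ (by fun_prop) hx')
      have := this.tendsto.mono_left (nhdsWithin_le_nhds (s := Ioi 0))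
      simpa using this
  have hlim2 := (hlim.norm.const_mul (‖e‖ ^ 2))
  simp only [integral_zero, norm_zero, mul_zero] at hlim2
  have := ge_of_tendsto hlim2 (by filter_upwards [self_mem_nhdsWithin] with ε hε using key ε hε)
  have h0 : ‖inner ℂ e f‖ = 0 := by nlinarith [norm_nonneg (inner ℂ e f)]
  exact norm_eq_zero.1 h0

end GroupProperties

/-! ### Uniqueness of Laplace transforms -/

section LaplaceUniqueness

open Set FourierTransform

/-- A bounded continuous function is determined on `(0, ∞)` by its Laplace transform. -/
theorem eq_of_laplace_eq {b₁ b₂ : ℝ → ℂ} (hb₁ : Continuous b₁) (hb₂ : Continuous b₂) {B : ℝ}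
    (hB₁ : ∀ t, ‖b₁ t‖ ≤ B) (hB₂ : ∀ t, ‖b₂ t‖ ≤ B)
    (h : ∀ z : ℂ, 0 < z.im → ∫ t : ℝ in Ioi 0, Complex.exp (Complex.I * z * t) * b₁ t =
      ∫ t : ℝ in Ioi 0, Complex.exp (Complex.I * z * t) * b₂ t) {t : ℝ} (ht : 0 < t) :
    b₁ t = b₂ t := by
  -- On the line z = i - 2πw the Laplace transform of b₁ - b₂ is the Fourier transform of φ(t) =
  -- 1_{t>0} e^{-t}(b₁ - b₂). It vanishes, and Fourier inversion applies at every point of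
  -- continuity.
  set φ : ℝ → ℂ := (Ioi 0).indicator fun t => Complex.exp (Complex.I * Complex.I * t) *
    (b₁ t - b₂ t) with hφ
  have hint : ∀ z : ℂ, 0 < z.im → ∀ b : ℝ → ℂ, Continuous b → (∀ t, ‖b t‖ ≤ B) →
      IntegrableOn (fun t : ℝ => Complex.exp (Complex.I * z * t) * b t) (Ioi 0) := by
    intro z hz b hb hB
    have hi : IntegrableOn (fun t : ℝ => Real.exp (-z.im * t) * B) (Ioi 0) :=
      (integrableOn_exp_mul_Ioi (by linarith) 0).mul_const _
    refine hi.mono' (Continuous.aestronglyMeasurable (by fun_prop)) (ae_of_all _ fun t => ?_)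
    rw [norm_mul, Complex.norm_exp]
    have : (Complex.I * z * t).re = -z.im * t := by simp
    rw [this]
    gcongr
    exact hB t
  have hφi : Integrable φ := by
    rw [hφ, integrable_indicator_iff measurableSet_Ioi]
    simp only [mul_sub]
    exact (hint Complex.I (by simp) b₁ hb₁ hB₁).sub (hint Complex.I (by simp) b₂ hb₂ hB₂)
  have hF : 𝓕 φ = 0 := by
    funext w
    rw [Real.fourier_eq']
    have hz : 0 < (Complex.I + ((-2 * Real.pi * w : ℝ) : ℂ)).im := by simp
    have h1 := h _ hz
    rw [← sub_eq_zero, ← integral_sub (hint _ hz b₁ hb₁ hB₁) (hint _ hz b₂ hb₂ hB₂)] at h1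
    rw [Pi.zero_apply, ← h1, ← integral_indicator measurableSet_Ioi]
    congr 1
    funext s
    rw [hφ]
    by_cases hs : s ∈ Ioi (0 : ℝ)
    · rw [indicator_of_mem hs, indicator_of_mem hs, smul_eq_mul, ← mul_sub, ← mul_assoc,
        ← Complex.exp_add]
      congr 2
      simp only [RCLike.inner_apply, conj_trivial]
      push_cast
      ring
    · rw [indicator_of_notMem hs, indicator_of_notMem hs, smul_zero]
  have hc : ContinuousAt φ t := by
    have h1 : ContinuousAt (fun t : ℝ => Complex.exp (Complex.I * Complex.I * t) *
      (b₁ t - b₂ t)) t := by fun_prop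
    refine h1.congr ?_
    filter_upwards [Ioi_mem_nhds ht] with s hs
    rw [hφ, indicator_of_mem hs]
  have h2 := hφi.fourierInv_fourier_eq (by rw [hF]; exact integrable_zero _ _ _) hc
  rw [hF, Real.fourierInv_eq'] at h2
  simp only [Pi.zero_apply, smul_zero, integral_zero] at h2
  rw [hφ, indicator_of_mem (show t ∈ Ioi (0 : ℝ) from ht)] at h2
  have h3 := (mul_eq_zero.1 h2.symm).resolve_left (Complex.exp_ne_zero _)
  exact sub_eq_zero.1 h3

end LaplaceUniqueness

/-! ### The free exponential kernel as an element of H¹ -/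

section ExpKernel

open Filter Topology Set

theorem integrable_exp_neg_mul_abs_sub {v : ℝ} (hv : 0 < v) (c : ℝ) :
    Integrable fun x : ℝ => Real.exp (-(v * |x - c|)) := by
  have h0 : Integrable fun x : ℝ => Real.exp (-(v * |x|)) := by
    rw [← integrableOn_univ, ← Iic_union_Ioi (a := (0 : ℝ))]
    refine IntegrableOn.union ?_ ?_
    · refine (integrableOn_exp_mul_Iic hv 0).congr_fun (fun x hx => ?_) measurableSet_Iic
      simp only [abs_of_nonpos (show x ≤ 0 from hx)]; ring_nf
    · refine (integrableOn_exp_mul_Ioi (neg_lt_zero.2 hv) 0).congr_fun (fun x hx => ?_)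
        measurableSet_Ioi
      simp only [abs_of_pos (show 0 < x from hx)]; ring_nf
  exact h0.comp_sub_right c

theorem integral_exp_neg_mul_abs_sub {v : ℝ} (hv : 0 < v) (c : ℝ) :
    ∫ x : ℝ, Real.exp (-(v * |x - c|)) = 2 / v := by
  rw [integral_sub_right_eq_self (fun x : ℝ => Real.exp (-(v * |x|))) c,
    integral_comp_abs (f := fun x => Real.exp (-(v * x)))]
  simp only [← neg_mul]
  rw [integral_exp_mul_Ioi (neg_lt_zero.2 hv)]
  simp; ring

theorem Integrable.memLp_two_of_bound {f : ℝ → ℂ} (hf : Integrable f) {B : ℝ}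
    (hB : ∀ x, ‖f x‖ ≤ B) : MemLp f 2 := by
  rw [memLp_two_iff_integrable_sq_norm hf.aestronglyMeasurable]
  refine (hf.norm.const_mul B).mono' (hf.aestronglyMeasurable.norm.pow 2) (ae_of_all _ fun x => ?_)
  rw [Real.norm_of_nonneg (by positivity), sq]
  gcongr
  exact hB x

/-- `e^{iκ|x - c|}`. -/
def expKernel (κ : ℂ) (c x : ℝ) : ℂ := Complex.exp (Complex.I * κ * (|x - c| : ℝ))

/-- The derivative of `e^{iκ|x - c|}` in `x`. -/
def expKernelDeriv (κ : ℂ) (c x : ℝ) : ℂ :=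
  (if c < x then Complex.I * κ else -(Complex.I * κ)) * expKernel κ c x

theorem expKernel_comm (κ : ℂ) (c x : ℝ) : expKernel κ c x = expKernel κ x c := by
  rw [expKernel, expKernel, abs_sub_comm]

theorem norm_expKernel (κ : ℂ) (c x : ℝ) :
    ‖expKernel κ c x‖ = Real.exp (-(κ.im * |x - c|)) := by
  rw [expKernel, Complex.norm_exp]
  simp

theorem norm_expKernel_le_one {κ : ℂ} (hκ : 0 ≤ κ.im) (c x : ℝ) : ‖expKernel κ c x‖ ≤ 1 := by
  rw [norm_expKernel, Real.exp_le_one_iff]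
  have := mul_nonneg hκ (abs_nonneg (x - c))
  linarith

theorem norm_expKernelDeriv (κ : ℂ) (c x : ℝ) :
    ‖expKernelDeriv κ c x‖ = ‖κ‖ * Real.exp (-(κ.im * |x - c|)) := by
  rw [expKernelDeriv, norm_mul, norm_expKernel]
  split_ifs <;> simp

theorem continuous_expKernel (κ : ℂ) : Continuous fun p : ℝ × ℝ => expKernel κ p.2 p.1 := by
  unfold expKernel; fun_prop

theorem measurable_expKernelDeriv (κ : ℂ) :
    Measurable fun p : ℝ × ℝ => expKernelDeriv κ p.2 p.1 := by
  unfold expKernelDeriv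
  refine Measurable.mul (Measurable.ite (measurableSet_lt measurable_snd measurable_fst)
    measurable_const measurable_const) (continuous_expKernel κ).measurable

theorem integrable_expKernel {κ : ℂ} (hκ : 0 < κ.im) (c : ℝ) : Integrable (expKernel κ c) := by
  refine (integrable_exp_neg_mul_abs_sub hκ c).mono'
    (Continuous.aestronglyMeasurable (by unfold expKernel; fun_prop)) (ae_of_all _ fun x => ?_)
  rw [norm_expKernel]

theorem integrable_expKernelDeriv {κ : ℂ} (hκ : 0 < κ.im) (c : ℝ) :
    Integrable (expKernelDeriv κ c) := by
  refine ((integrable_exp_neg_mul_abs_sub hκ c).const_mul ‖κ‖).mono'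
    ((measurable_expKernelDeriv κ).comp measurable_prodMk_right).aestronglyMeasurable
    (ae_of_all _ fun x => ?_)
  exact (norm_expKernelDeriv κ c x).le

theorem norm_expKernelDeriv_le {κ : ℂ} (hκ : 0 ≤ κ.im) (c x : ℝ) :
    ‖expKernelDeriv κ c x‖ ≤ ‖κ‖ := by
  rw [norm_expKernelDeriv, ← norm_expKernel]
  exact mul_le_of_le_one_right (norm_nonneg _) (norm_expKernel_le_one hκ c x)

theorem isH1_expKernel {κ : ℂ} (hκ : 0 < κ.im) (c : ℝ) :
    IsH1 (expKernel κ c) (expKernelDeriv κ c) where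
  memLp := Integrable.memLp_two_of_bound (integrable_expKernel hκ c)
    (norm_expKernel_le_one hκ.le c)
  memLp_deriv := Integrable.memLp_two_of_bound (integrable_expKernelDeriv hκ c)
    (norm_expKernelDeriv_le hκ.le c)
  sub_eq_integral x y := by
    refine (integral_eq_of_hasDerivAt_off_countable (expKernel κ c) (expKernelDeriv κ c)
      (countable_singleton c) (Continuous.continuousOn (by unfold expKernel; fun_prop))
      (fun u hu => ?_) (integrable_expKernelDeriv hκ c).intervalIntegrable).symm
    have huc : u ≠ c := fun h => hu.2 h
    rcases lt_or_gt_of_ne huc with h | h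
    · have h1 : HasDerivAt (fun x : ℝ => Complex.exp (Complex.I * κ * ((c - x : ℝ) : ℂ)))
          (expKernelDeriv κ c u) u := by
        have h2 : HasDerivAt (fun x : ℝ => ((c - x : ℝ) : ℂ)) (-1 : ℂ) u := by
          have := ((hasDerivAt_id u).const_sub c).ofReal_comp
          simpa using this
        refine ((h2.const_mul (Complex.I * κ)).cexp).congr_deriv ?_
        rw [expKernelDeriv, if_neg (not_lt.2 h.le), expKernel, abs_of_neg (by linarith), neg_sub]
        ring
      refine h1.congr_of_eventuallyEq ?_
      filter_upwards [Iio_mem_nhds h] with x hx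
      have hx : x < c := hx
      rw [expKernel, abs_of_neg (by linarith), neg_sub]
    · have h1 : HasDerivAt (fun x : ℝ => Complex.exp (Complex.I * κ * ((x - c : ℝ) : ℂ)))
          (expKernelDeriv κ c u) u := by
        have h2 : HasDerivAt (fun x : ℝ => ((x - c : ℝ) : ℂ)) (1 : ℂ) u := by
          have := ((hasDerivAt_id u).sub_const c).ofReal_comp
          simpa using this
        refine ((h2.const_mul (Complex.I * κ)).cexp).congr_deriv ?_
        rw [expKernelDeriv, if_pos h, expKernel, abs_of_pos (by linarith)]
        ring
      refine h1.congr_of_eventuallyEq ?_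
      filter_upwards [Ioi_mem_nhds h] with x hx
      have hx : c < x := hx
      rw [expKernel, abs_of_pos (by linarith)]

end ExpKernel

/-! ### The fundamental solution in weak form -/

section IntegrationByParts

open Filter Topology Set

theorem MemLp.integrable_mul_two {f g : ℝ → ℂ} (hf : MemLp f 2) (hg : MemLp g 2) :
    Integrable fun x => f x * g x :=
  hf.integrable_mul hg

namespace IsH1

variable {f f' g g' : ℝ → ℂ}

theorem conj_comp (hf : IsH1 f f') : IsH1 (fun x => conj (f x)) (fun x => conj (f' x)) where
  memLp := hf.memLp.star
  memLp_deriv := hf.memLp_deriv.star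
  sub_eq_integral x y := by
    rw [← map_sub, hf.sub_eq_integral, intervalIntegral.intervalIntegral_eq_integral_uIoc,
      intervalIntegral.intervalIntegral_eq_integral_uIoc, integral_conj]
    split_ifs <;> simp

theorem comp_const_add (hf : IsH1 f f') (c : ℝ) :
    IsH1 (fun x => f (c + x)) (fun x => f' (c + x)) where
  memLp := hf.memLp.comp_measurePreserving (measurePreserving_add_left volume c)
  memLp_deriv := hf.memLp_deriv.comp_measurePreserving (measurePreserving_add_left volume c)
  sub_eq_integral x y := by
    rw [hf.sub_eq_integral, intervalIntegral.integral_comp_add_left]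

theorem comp_const_sub (hf : IsH1 f f') (c : ℝ) :
    IsH1 (fun x => f (c - x)) (fun x => -f' (c - x)) where
  memLp := hf.memLp.comp_measurePreserving (Measure.measurePreserving_sub_left volume c)
  memLp_deriv := (hf.memLp_deriv.comp_measurePreserving (Measure.measurePreserving_sub_left volume c)).neg
  sub_eq_integral x y := by
    rw [hf.sub_eq_integral, intervalIntegral.integral_neg, intervalIntegral.integral_comp_sub_left,
      intervalIntegral.integral_symm]

/-- Integration by parts against `e^{iκs}` on the half-line. -/
theorem integral_Ioi_deriv_mul_exp (hf : IsH1 f f') {κ : ℂ} (hκ : 0 < κ.im) :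
    ∫ s : ℝ in Ioi 0, f' s * Complex.exp (Complex.I * κ * s) =
      -f 0 - Complex.I * κ * ∫ s : ℝ in Ioi 0, f s * Complex.exp (Complex.I * κ * s) := by
  have hκ0 : κ ≠ 0 := fun h => by simp [h] at hκ
  have hre : (Complex.I * κ).re < 0 := by simpa using hκ
  have hexp2 : MemLp (fun s : ℝ => Complex.exp (Complex.I * κ * s)) 2 (volume.restrict (Ioi 0)) := by
    have h1 := ((isH1_expKernel hκ 0).memLp).restrict (Ioi 0)
    refine (memLp_congr_ae ?_).1 h1
    filter_upwards [ae_restrict_mem measurableSet_Ioi] with s hs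
    have hs : 0 < s := hs
    rw [expKernel, sub_zero, abs_of_pos hs]
  have hfi : IntegrableOn (fun s : ℝ => f s * Complex.exp (Complex.I * κ * s)) (Ioi 0) :=
    (hf.memLp.restrict _).integrable_mul hexp2
  -- Fubini for f'(x)e^{iκs} on the triangle x < s replaces boundary terms: integrating in s first
  -- gives the left-hand side up to a factor, integrating in x first gives f(s) - f(0).
  set F : ℝ → ℝ → ℂ := fun x s => (Ioi x).indicator
    (fun s => f' x * Complex.exp (Complex.I * κ * s)) s with hF
  have hFi : Integrable (Function.uncurry F)
      ((volume.restrict (Ioi 0)).prod (volume.restrict (Ioi 0))) := by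
    -- For s > x half of the decay in s is handed to x: e^{-vs} ≤ e^{-vx/2}e^{-vs/2}, v = Im κ.
    have hd1 : Integrable (fun x : ℝ => ‖f' x‖ * Real.exp (-(κ.im / 2) * x))
        (volume.restrict (Ioi 0)) := by
      have h1 : MemLp (fun s : ℝ => Complex.exp (Complex.I * (κ / 2) * s)) 2
          (volume.restrict (Ioi 0)) := by
        have hκ2 : 0 < (κ / 2).im := by simpa using hκ
        have h1 := ((isH1_expKernel hκ2 0).memLp).restrict (Ioi 0)
        refine (memLp_congr_ae ?_).1 h1
        filter_upwards [ae_restrict_mem measurableSet_Ioi] with s hs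
        have hs : 0 < s := hs
        rw [expKernel, sub_zero, abs_of_pos hs]
      have h2 := ((hf.memLp_deriv.restrict (Ioi 0)).integrable_mul h1).norm
      refine h2.congr (ae_of_all _ fun s => ?_)
      simp [Complex.norm_exp]
    have hd2 : Integrable (fun x : ℝ => Real.exp (-(κ.im / 2) * x)) (volume.restrict (Ioi 0)) :=
      integrableOn_exp_mul_Ioi (by linarith) 0
    refine (hd1.mul_prod hd2).mono' ?_ ?_
    · have h1 : AEStronglyMeasurable (fun p : ℝ × ℝ => f' p.1 * Complex.exp (Complex.I * κ * p.2))
          ((volume.restrict (Ioi 0)).prod (volume.restrict (Ioi 0))) :=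
        ((hf.memLp_deriv.aestronglyMeasurable.restrict).comp_fst).mul
          (Continuous.aestronglyMeasurable (by fun_prop))
      refine (h1.indicator (measurableSet_lt measurable_fst measurable_snd)).congr
        (ae_of_all _ fun p => ?_)
      simp only [Function.uncurry, hF, indicator, mem_ofPred_eq, mem_Ioi]
    · refine ae_of_all _ fun p => ?_
      simp only [Function.uncurry, hF, indicator, mem_Ioi]
      split_ifs with h
      · rw [norm_mul, Complex.norm_exp, mul_assoc ‖f' p.1‖, ← Real.exp_add]
        gcongr
        simp
        nlinarith
      · simp; positivity
  have hswap := integral_integral_swap hFi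
  have hL : ∀ x ∈ Ioi (0 : ℝ), ∫ s in Ioi 0, F x s =
      -(Complex.I * κ)⁻¹ * (f' x * Complex.exp (Complex.I * κ * x)) := by
    intro x hx
    have hx : 0 < x := hx
    simp only [hF]
    rw [integral_indicator measurableSet_Ioi, Measure.restrict_restrict measurableSet_Ioi,
      Ioi_inter_Ioi, sup_of_le_left hx.le, integral_const_mul,
      integral_exp_mul_complex_Ioi hre]
    field_simp
  have hR : ∀ s ∈ Ioi (0 : ℝ), ∫ x in Ioi 0, F x s =
      (f s - f 0) * Complex.exp (Complex.I * κ * s) := by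
    intro s hs
    have hs : 0 < s := hs
    have e : ∀ x, F x s = (Iio s).indicator
        (fun x => f' x * Complex.exp (Complex.I * κ * s)) x := fun x => by
      simp only [hF, indicator, mem_Ioi, mem_Iio]
    simp only [e]
    rw [integral_indicator measurableSet_Iio, Measure.restrict_restrict measurableSet_Iio,
      inter_comm, Ioi_inter_Iio, integral_mul_const, ← integral_Ioc_eq_integral_Ioo,
      ← intervalIntegral.integral_of_le hs.le, hf.sub_eq_integral]
  rw [setIntegral_congr_fun measurableSet_Ioi hL, setIntegral_congr_fun measurableSet_Ioi hR,
    integral_const_mul] at hswap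
  simp only [sub_mul] at hswap
  rw [integral_sub hfi ((integrableOn_exp_mul_complex_Ioi hre 0).const_mul _), integral_const_mul,
    integral_exp_mul_complex_Ioi hre] at hswap
  have hI : Complex.I * κ ≠ 0 := mul_ne_zero Complex.I_ne_zero hκ0
  simp only [Complex.ofReal_zero, mul_zero, Complex.exp_zero] at hswap
  have h3 := congrArg (fun x => -(Complex.I * κ) * x) hswap
  simp only [neg_mul_neg, ← mul_assoc, mul_inv_cancel₀ hI, one_mul] at h3
  rw [h3]
  field_simp
  ring

theorem integral_eq_integral_Ioi_add {F : ℝ → ℂ} (hF : Integrable F) (c : ℝ) :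
    ∫ x, F x = (∫ s in Ioi 0, F (c + s)) + ∫ s in Ioi 0, F (c - s) := by
  rw [← integral_add_left_eq_self F c, ← intervalIntegral.integral_Iic_add_Ioi (b := 0)
    ((hF.comp_add_left c).integrableOn) ((hF.comp_add_left c).integrableOn), add_comm]
  congr 1
  have := integral_comp_neg_Ioi (c := (0 : ℝ)) (f := fun x => F (c + x))
  rw [neg_zero] at this
  rw [← this]
  simp only [← sub_eq_add_neg]

/-- `e^{iκ|x - c|}` is a fundamental solution of `-d²/dx² - κ²`, up to the factor `-2iκ`. -/
theorem integral_deriv_mul_expKernelDeriv (hf : IsH1 f f') {κ : ℂ} (hκ : 0 < κ.im) (c : ℝ) :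
    (∫ x, f' x * expKernelDeriv κ c x) - κ ^ 2 * ∫ x, f x * expKernel κ c x =
      -2 * Complex.I * κ * f c := by
  have hK := isH1_expKernel hκ c
  rw [integral_eq_integral_Ioi_add (MemLp.integrable_mul_two hf.memLp_deriv hK.memLp_deriv) c,
    integral_eq_integral_Ioi_add (MemLp.integrable_mul_two hf.memLp hK.memLp) c]
  have e1 : ∀ s ∈ Ioi (0 : ℝ), f' (c + s) * expKernelDeriv κ c (c + s) =
      (Complex.I * κ) * (f' (c + s) * Complex.exp (Complex.I * κ * s)) := fun s hs => by
    have hs : 0 < s := hs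
    rw [expKernelDeriv, if_pos (by linarith), expKernel, add_sub_cancel_left, abs_of_pos hs]
    ring
  have e2 : ∀ s ∈ Ioi (0 : ℝ), f' (c - s) * expKernelDeriv κ c (c - s) =
      (Complex.I * κ) * (-f' (c - s) * Complex.exp (Complex.I * κ * s)) := fun s hs => by
    have hs : 0 < s := hs
    rw [expKernelDeriv, if_neg (by linarith), expKernel, sub_sub_cancel_left, abs_neg,
      abs_of_pos hs]
    ring
  have e3 : ∀ s ∈ Ioi (0 : ℝ), f (c + s) * expKernel κ c (c + s) =
      f (c + s) * Complex.exp (Complex.I * κ * s) := fun s hs => by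
    have hs : 0 < s := hs
    rw [expKernel, add_sub_cancel_left, abs_of_pos hs]
  have e4 : ∀ s ∈ Ioi (0 : ℝ), f (c - s) * expKernel κ c (c - s) =
      f (c - s) * Complex.exp (Complex.I * κ * s) := fun s hs => by
    have hs : 0 < s := hs
    rw [expKernel, sub_sub_cancel_left, abs_neg, abs_of_pos hs]
  rw [setIntegral_congr_fun measurableSet_Ioi e1, setIntegral_congr_fun measurableSet_Ioi e2,
    setIntegral_congr_fun measurableSet_Ioi e3, setIntegral_congr_fun measurableSet_Ioi e4,
    integral_const_mul, integral_const_mul, (hf.comp_const_add c).integral_Ioi_deriv_mul_exp hκ,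
    (hf.comp_const_sub c).integral_Ioi_deriv_mul_exp hκ]
  simp only [add_zero, sub_zero]
  linear_combination (-κ ^ 2 * ((∫ (s : ℝ) in Ioi 0, f (c + s) * Complex.exp (Complex.I * κ * ↑s)) +
    ∫ (s : ℝ) in Ioi 0, f (c - s) * Complex.exp (Complex.I * κ * ↑s))) * Complex.I_sq

end IsH1

end IntegrationByParts

/-! ### Potentials of integrable functions -/

section Potential

open Filter Topology Set

/-- A kernel decaying exponentially off the diagonal. -/
structure IsExpDecaying (L : ℝ × ℝ → ℂ) (B v : ℝ) : Prop where
  measurable : Measurable L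
  pos : 0 < v
  bound : ∀ p, ‖L p‖ ≤ B * Real.exp (-(v * |p.1 - p.2|))

namespace IsExpDecaying

variable {L : ℝ × ℝ → ℂ} {B v : ℝ} {f : ℝ → ℂ}

theorem nonneg (hL : IsExpDecaying L B v) : 0 ≤ B := by
  have := (norm_nonneg _).trans (hL.bound (0, 0))
  simpa using this

theorem integrable_prod (hL : IsExpDecaying L B v) (hf : Integrable f) :
    Integrable (fun p : ℝ × ℝ => L p * f p.2) (volume.prod volume) := by
  have h1 : Integrable (fun x : ℝ => Real.exp (-(v * |x|))) := by
    simpa using integrable_exp_neg_mul_abs_sub hL.pos 0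
  have h2 := (hf.norm.convolution_integrand (ContinuousLinearMap.mul ℝ ℝ) h1).const_mul B
  refine h2.mono' (hL.measurable.aestronglyMeasurable.mul hf.aestronglyMeasurable.comp_snd)
    (ae_of_all _ fun p => ?_)
  rw [norm_mul, ContinuousLinearMap.mul_apply']
  calc ‖L p‖ * ‖f p.2‖ ≤ B * Real.exp (-(v * |p.1 - p.2|)) * ‖f p.2‖ := by
        gcongr; exact hL.bound p
    _ = _ := by ring

theorem norm_le (hL : IsExpDecaying L B v) (p : ℝ × ℝ) : ‖L p‖ ≤ B := by
  refine (hL.bound p).trans (mul_le_of_le_one_right hL.nonneg ?_)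
  rw [Real.exp_le_one_iff]
  have := mul_nonneg hL.pos.le (abs_nonneg (p.1 - p.2))
  linarith

theorem integrable_right (hL : IsExpDecaying L B v) (hf : Integrable f) (x : ℝ) :
    Integrable fun y => L (x, y) * f y :=
  hf.bdd_mul (hL.measurable.comp measurable_prodMk_left).aestronglyMeasurable
    (ae_of_all _ fun y => hL.norm_le (x, y))

/-- The potential is integrable by Fubini and bounded by B‖f‖₁, hence square integrable. -/
theorem memLp_two (hL : IsExpDecaying L B v) (hf : Integrable f) :
    MemLp (fun x => ∫ y, L (x, y) * f y) 2 := by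
  refine Integrable.memLp_two_of_bound (B := B * ∫ y, ‖f y‖)
    (hL.integrable_prod hf).integral_prod_left fun x => ?_
  rw [← integral_const_mul]
  refine norm_integral_le_of_norm_le (hf.norm.const_mul B) (ae_of_all _ fun y => ?_)
  rw [norm_mul]
  gcongr
  exact hL.norm_le _

/-- From |hL| ≤ (|h|² + |L|²)/2, the x-integral of |h(x)L(x,y)| is bounded uniformly in y, and f is
integrable. This justifies Fubini when an H¹ function is tested against a potential. -/
theorem integrable_prod_mul (hL : IsExpDecaying L B v) (hf : Integrable f) {h : ℝ → ℂ}
    (hh : MemLp h 2) :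
    Integrable (fun p : ℝ × ℝ => h p.1 * (L p * f p.2)) (volume.prod volume) := by
  have hm : AEStronglyMeasurable (fun p : ℝ × ℝ => h p.1 * (L p * f p.2))
      (volume.prod volume) :=
    hh.aestronglyMeasurable.comp_fst.mul
      (hL.measurable.aestronglyMeasurable.mul hf.aestronglyMeasurable.comp_snd)
  have hv2 : 0 < 2 * v := by linarith [hL.pos]
  have hh2 := hh.integrable_norm_pow (by norm_num)
  simp only at hh2
  set C := ∫ x, ‖h x‖ ^ 2 with hC
  have hdom : ∀ y : ℝ, Integrable fun x : ℝ =>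
      (‖h x‖ ^ 2 + B ^ 2 * Real.exp (-(2 * v * |x - y|))) / 2 * ‖f y‖ := fun y =>
    ((hh2.add ((integrable_exp_neg_mul_abs_sub hv2 y).const_mul _)).div_const 2).mul_const _
  have hle : ∀ x y : ℝ, ‖h x * (L (x, y) * f y)‖ ≤
      (‖h x‖ ^ 2 + B ^ 2 * Real.exp (-(2 * v * |x - y|))) / 2 * ‖f y‖ := by
    intro x y
    rw [norm_mul, norm_mul, ← mul_assoc]
    gcongr
    have h1 := hL.bound (x, y)
    have h2 : B ^ 2 * Real.exp (-(2 * v * |x - y|)) = (B * Real.exp (-(v * |x - y|))) ^ 2 := by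
      rw [mul_pow, sq (Real.exp _), ← Real.exp_add]; ring_nf
    rw [h2]
    have h3 : ‖L (x, y)‖ ^ 2 ≤ (B * Real.exp (-(v * |x - y|))) ^ 2 := by gcongr
    nlinarith [sq_nonneg (‖h x‖ - ‖L (x, y)‖)]
  rw [integrable_prod_iff' hm]
  refine ⟨?_, ?_⟩
  · have hm2 := hm.prod_swap.prodMk_left
    filter_upwards [hm2] with y hy
    exact (hdom y).mono' hy (ae_of_all _ fun x => hle x y)
  · refine (hf.norm.const_mul ((C + B ^ 2 * (2 / (2 * v))) / 2)).mono'
      hm.prod_swap.norm.integral_prod_right' (ae_of_all _ fun y => ?_)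
    rw [Real.norm_of_nonneg (integral_nonneg fun _ => norm_nonneg _)]
    refine (integral_mono_of_nonneg (ae_of_all _ fun _ => norm_nonneg _) (hdom y)
      (ae_of_all _ fun x => hle x y)).trans (le_of_eq ?_)
    rw [integral_mul_const, integral_div, integral_add hh2
      ((integrable_exp_neg_mul_abs_sub hv2 y).const_mul _), integral_const_mul,
      integral_exp_neg_mul_abs_sub hv2]

end IsExpDecaying

/-- `∫ e^{iκ|x - y|} f(y) dy`. -/
def expPotential (κ : ℂ) (f : ℝ → ℂ) (x : ℝ) : ℂ := ∫ y, expKernel κ y x * f y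

/-- The derivative of `expPotential`. -/
def expPotentialDeriv (κ : ℂ) (f : ℝ → ℂ) (x : ℝ) : ℂ := ∫ y, expKernelDeriv κ y x * f y

theorem isExpDecaying_expKernel {κ : ℂ} (hκ : 0 < κ.im) :
    IsExpDecaying (fun p => expKernel κ p.2 p.1) 1 κ.im where
  measurable := (continuous_expKernel κ).measurable
  pos := hκ
  bound p := by rw [norm_expKernel, one_mul]

theorem isExpDecaying_expKernelDeriv {κ : ℂ} (hκ : 0 < κ.im) :
    IsExpDecaying (fun p => expKernelDeriv κ p.2 p.1) ‖κ‖ κ.im where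
  measurable := measurable_expKernelDeriv κ
  pos := hκ
  bound p := by rw [norm_expKernelDeriv]

theorem isH1_expPotential {κ : ℂ} (hκ : 0 < κ.im) {f : ℝ → ℂ} (hf : Integrable f) :
    IsH1 (expPotential κ f) (expPotentialDeriv κ f) where
  memLp := (isExpDecaying_expKernel hκ).memLp_two hf
  memLp_deriv := (isExpDecaying_expKernelDeriv hκ).memLp_two hf
  sub_eq_integral x y := by
    have hi := (isExpDecaying_expKernel hκ).integrable_right hf
    simp only at hi
    rw [expPotential, expPotential, ← integral_sub (hi y) (hi x)]
    simp only [expPotentialDeriv]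
    rw [intervalIntegral_integral_swap]
    · refine integral_congr_ae (ae_of_all _ fun c => ?_)
      beta_reduce
      rw [intervalIntegral.integral_mul_const, ← (isH1_expKernel hκ c).sub_eq_integral]
      ring
    · have := (isExpDecaying_expKernelDeriv hκ).integrable_prod hf
      refine this.mono_measure ?_
      exact Measure.prod_mono Measure.restrict_le_self le_rfl

/-- The potential inverts `-d²/dx² - κ²`, up to the factor `-2iκ`. -/
theorem IsH1.integral_deriv_mul_expPotentialDeriv {h h' : ℝ → ℂ} (hh : IsH1 h h') {κ : ℂ}
    (hκ : 0 < κ.im) {f : ℝ → ℂ} (hf : Integrable f) :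
    (∫ x, h' x * expPotentialDeriv κ f x) - κ ^ 2 * ∫ x, h x * expPotential κ f x =
      -2 * Complex.I * κ * ∫ x, h x * f x := by
  have h1 := (isExpDecaying_expKernelDeriv hκ).integrable_prod_mul hf hh.memLp_deriv
  have h2 := (isExpDecaying_expKernel hκ).integrable_prod_mul hf hh.memLp
  have e1 : ∫ x, h' x * expPotentialDeriv κ f x =
      ∫ y, (∫ x, h' x * expKernelDeriv κ y x) * f y := by
    simp only [expPotentialDeriv, ← integral_const_mul]
    rw [integral_integral_swap h1]
    refine integral_congr_ae (ae_of_all _ fun y => ?_)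
    simp only [← integral_mul_const, mul_assoc]
  have e2 : ∫ x, h x * expPotential κ f x =
      ∫ y, (∫ x, h x * expKernel κ y x) * f y := by
    simp only [expPotential, ← integral_const_mul]
    rw [integral_integral_swap h2]
    refine integral_congr_ae (ae_of_all _ fun y => ?_)
    simp only [← integral_mul_const, mul_assoc]
  have i1 : Integrable fun y => (∫ x, h' x * expKernelDeriv κ y x) * f y := by
    refine h1.integral_prod_right.congr (ae_of_all _ fun y => ?_)
    simp only [← integral_mul_const, mul_assoc]
  have i2 : Integrable fun y => (∫ x, h x * expKernel κ y x) * f y := by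
    refine h2.integral_prod_right.congr (ae_of_all _ fun y => ?_)
    simp only [← integral_mul_const, mul_assoc]
  rw [e1, e2, ← integral_const_mul, ← integral_const_mul, ← integral_sub i1 (i2.const_mul _)]
  refine integral_congr_ae (ae_of_all _ fun y => ?_)
  beta_reduce
  rw [← mul_assoc, ← sub_mul, hh.integral_deriv_mul_expKernelDeriv hκ y]
  ring

end Potential

/-! ### The explicit resolvent -/

section Resolvent

/-- `e^{iκ|x-a|} + σ e^{iκ|x+a|}`; the parity is `σ = ±1`. -/
def parityWave (a σ : ℝ) (κ : ℂ) (x : ℝ) : ℂ := expKernel κ a x + σ * expKernel κ (-a) x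

/-- The derivative of `parityWave`. -/
def parityWaveDeriv (a σ : ℝ) (κ : ℂ) (x : ℝ) : ℂ :=
  expKernelDeriv κ a x + σ * expKernelDeriv κ (-a) x

/-- The function `2κ + iα (1 + σ e^{2iκa})`, whose zeros in the upper half-plane are the square
roots of the eigenvalues of parity `σ`. -/
def parityDenom (a α σ : ℝ) (κ : ℂ) : ℂ :=
  2 * κ + Complex.I * α * (1 + σ * Complex.exp (2 * Complex.I * κ * a))

theorem isH1_parityWave (a σ : ℝ) {κ : ℂ} (hκ : 0 < κ.im) :
    IsH1 (parityWave a σ κ) (parityWaveDeriv a σ κ) :=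
  (isH1_expKernel hκ a).add ((isH1_expKernel hκ (-a)).smul σ)

theorem integrable_parityWave (a σ : ℝ) {κ : ℂ} (hκ : 0 < κ.im) :
    Integrable (parityWave a σ κ) :=
  (integrable_expKernel hκ a).add ((integrable_expKernel hκ (-a)).const_mul σ)

theorem continuous_parityWave (a σ : ℝ) (κ : ℂ) : Continuous (parityWave a σ κ) := by
  unfold parityWave expKernel; fun_prop

theorem expKernel_two_mul {a : ℝ} (ha : 0 < a) (κ : ℂ) :
    expKernel κ (-a) a = Complex.exp (2 * Complex.I * κ * a) := by
  rw [expKernel, sub_neg_eq_add, abs_of_pos (by linarith)]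
  push_cast; ring_nf

theorem expKernel_self (κ : ℂ) (c : ℝ) : expKernel κ c c = 1 := by simp [expKernel]

/-- Each exponential produces a point source of strength -2iκ at its centre. The delta coupling adds
α times the value of the wave there, which is 1 + σe^{2iκa} at a and σ times that at -a. The two
contributions add up to -iD_σ(κ). -/
theorem deltaForm_parityWave {a : ℝ} (ha : 0 < a) (α : ℝ) {σ : ℝ} (hσ : σ ^ 2 = 1) {κ : ℂ}
    (hκ : 0 < κ.im) {g g' : ℝ → ℂ} (hg : IsH1 g g') :
    deltaForm a α g g' (parityWave a σ κ) (parityWaveDeriv a σ κ) -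
      κ ^ 2 * ∫ x, conj (g x) * parityWave a σ κ x =
      -Complex.I * parityDenom a α σ κ * (conj (g a) + σ * conj (g (-a))) := by
  have h1 := hg.conj_comp.integral_deriv_mul_expKernelDeriv hκ a
  have h2 := hg.conj_comp.integral_deriv_mul_expKernelDeriv hκ (-a)
  have hσ' : (σ : ℂ) ^ 2 = 1 := by exact_mod_cast hσ
  have e1 : ∫ x, conj (g' x) * parityWaveDeriv a σ κ x =
      (∫ x, conj (g' x) * expKernelDeriv κ a x) +
        σ * ∫ x, conj (g' x) * expKernelDeriv κ (-a) x := by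
    rw [← integral_const_mul, ← integral_add]
    · refine integral_congr_ae (ae_of_all _ fun x => ?_)
      simp only [parityWaveDeriv]; ring
    · exact integrable_conj_mul hg.memLp_deriv (isH1_expKernel hκ a).memLp_deriv
    · exact (integrable_conj_mul hg.memLp_deriv (isH1_expKernel hκ (-a)).memLp_deriv).const_mul _
  have e2 : ∫ x, conj (g x) * parityWave a σ κ x =
      (∫ x, conj (g x) * expKernel κ a x) + σ * ∫ x, conj (g x) * expKernel κ (-a) x := by
    rw [← integral_const_mul, ← integral_add]
    · refine integral_congr_ae (ae_of_all _ fun x => ?_)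
      simp only [parityWave]; ring
    · exact integrable_conj_mul hg.memLp (isH1_expKernel hκ a).memLp
    · exact (integrable_conj_mul hg.memLp (isH1_expKernel hκ (-a)).memLp).const_mul _
  rw [deltaForm, e1, e2, parityDenom]
  simp only [parityWave, expKernel_self, expKernel_two_mul ha, expKernel_comm κ a (-a)]
  linear_combination h1 + σ * h2 + (α * (1 + σ * Complex.exp (2 * Complex.I * κ * a)) *
    (conj (g a) + σ * conj (g (-a)))) * Complex.I_sq +
    (-(α * conj (g (-a)) * Complex.exp (2 * Complex.I * κ * a))) * hσ'

/-- The solution of `(H_α - κ²) g = f`. -/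
def resolventFun (a α : ℝ) (κ : ℂ) (f : ℝ → ℂ) (x : ℝ) : ℂ :=
  Complex.I / (2 * κ) * expPotential κ f x +
    (α / (4 * κ * parityDenom a α 1 κ) * (∫ y, parityWave a 1 κ y * f y) * parityWave a 1 κ x +
     α / (4 * κ * parityDenom a α (-1) κ) * (∫ y, parityWave a (-1) κ y * f y) *
      parityWave a (-1) κ x)

theorem integral_parityWave_mul (a σ : ℝ) {κ : ℂ} (hκ : 0 ≤ κ.im) {f : ℝ → ℂ}
    (hf : Integrable f) : ∫ y, parityWave a σ κ y * f y =
      expPotential κ f a + σ * expPotential κ f (-a) := by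
  have hi : ∀ c, Integrable fun y => expKernel κ c y * f y := fun c =>
    hf.bdd_mul (Continuous.aestronglyMeasurable (by unfold expKernel; fun_prop))
      (ae_of_all _ fun y => norm_expKernel_le_one hκ c y)
  rw [expPotential, expPotential, ← integral_const_mul]
  simp only [expKernel_comm κ _ a, expKernel_comm κ _ (-a)]
  rw [← integral_add (hi a) ((hi (-a)).const_mul _)]
  refine integral_congr_ae (ae_of_all _ fun x => ?_)
  simp only [parityWave]; ring

/-- The free potential solves the equation except for point sources α u(±a), with u its own value.
Splitting these into even and odd parts, each is cancelled by the wave of that parity, whose source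
has strength -iD_σ; this dictates the coefficient α/(4κD_σ). -/
theorem exists_isH1_resolventFun {a : ℝ} (ha : 0 < a) (α : ℝ) {κ : ℂ} (hκ : 0 < κ.im)
    (hp : parityDenom a α 1 κ ≠ 0) (hm : parityDenom a α (-1) κ ≠ 0) {f : ℝ → ℂ}
    (hf : Integrable f) :
    ∃ u' : ℝ → ℂ, IsH1 (resolventFun a α κ f) u' ∧ ∀ g g' : ℝ → ℂ, IsH1 g g' →
      deltaForm a α g g' (resolventFun a α κ f) u' -
        κ ^ 2 * ∫ x, conj (g x) * resolventFun a α κ f x = ∫ x, conj (g x) * f x := by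
  have hκ0 : κ ≠ 0 := fun h => by simp [h] at hκ
  have hP := (isH1_expPotential hκ hf).smul (Complex.I / (2 * κ))
  have h1 := (isH1_parityWave a 1 hκ).smul
    (α / (4 * κ * parityDenom a α 1 κ) * (∫ y, parityWave a 1 κ y * f y))
  have h2 := (isH1_parityWave a (-1) hκ).smul
    (α / (4 * κ * parityDenom a α (-1) κ) * (∫ y, parityWave a (-1) κ y * f y))
  refine ⟨_, hP.add (h1.add h2), fun g g' hg => ?_⟩
  have eD := deltaForm_add a α hg hP (h1.add h2)
  rw [deltaForm_add a α hg h1 h2, deltaForm_smul, deltaForm_smul, deltaForm_smul] at eD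
  have eI : ∫ x, conj (g x) * resolventFun a α κ f x =
      Complex.I / (2 * κ) * (∫ x, conj (g x) * expPotential κ f x) +
      (α / (4 * κ * parityDenom a α 1 κ) * (∫ y, parityWave a 1 κ y * f y) *
        (∫ x, conj (g x) * parityWave a 1 κ x) +
       α / (4 * κ * parityDenom a α (-1) κ) * (∫ y, parityWave a (-1) κ y * f y) *
        (∫ x, conj (g x) * parityWave a (-1) κ x)) := by
    have iP := (integrable_conj_mul hg.memLp (isH1_expPotential hκ hf).memLp).const_mul
      (Complex.I / (2 * κ))
    have i1 := (integrable_conj_mul hg.memLp (isH1_parityWave a 1 hκ).memLp).const_mul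
      (α / (4 * κ * parityDenom a α 1 κ) * (∫ y, parityWave a 1 κ y * f y))
    have i2 := (integrable_conj_mul hg.memLp (isH1_parityWave a (-1) hκ).memLp).const_mul
      (α / (4 * κ * parityDenom a α (-1) κ) * (∫ y, parityWave a (-1) κ y * f y))
    have i12 := i1.add i2
    simp only [Pi.add_def] at i12
    rw [← integral_const_mul (Complex.I / (2 * κ)),
      ← integral_const_mul (_ * ∫ y, parityWave a 1 κ y * f y),
      ← integral_const_mul (_ * ∫ y, parityWave a (-1) κ y * f y),
      ← integral_add i1 i2, ← integral_add iP i12]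
    refine integral_congr_ae (ae_of_all _ fun x => ?_)
    simp only [resolventFun]; ring
  have eP := hg.conj_comp.integral_deriv_mul_expPotentialDeriv hκ hf
  have w1 := deltaForm_parityWave ha α (by norm_num : (1 : ℝ) ^ 2 = 1) hκ hg
  have w2 := deltaForm_parityWave ha α (by norm_num : (-1 : ℝ) ^ 2 = 1) hκ hg
  have n1 := integral_parityWave_mul a 1 hκ.le hf
  have n2 := integral_parityWave_mul a (-1) hκ.le hf
  refine (congrArg₂ (· - ·) eD (congrArg (κ ^ 2 * ·) eI)).trans ?_
  have eP' : deltaForm a α g g' (expPotential κ f) (expPotentialDeriv κ f) =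
      κ ^ 2 * (∫ x, conj (g x) * expPotential κ f x) +
      -2 * Complex.I * κ * (∫ x, conj (g x) * f x) +
      α * (conj (g a) * expPotential κ f a + conj (g (-a)) * expPotential κ f (-a)) := by
    rw [deltaForm]; linear_combination eP
  have w1' := eq_add_of_sub_eq w1
  have w2' := eq_add_of_sub_eq w2
  rw [eP', w1', w2']
  rw [n1, n2]
  push_cast
  field_simp
  ring_nf
  rw [Complex.I_sq]
  ring

end Resolvent

/-! ### Semiboundedness and self-adjointness -/

section SelfAdjoint

open Filter Topology Set

theorem inner_Lp_eq_integral (f g : Lp ℂ 2 (volume : Measure ℝ)) :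
    inner ℂ f g = ∫ x, conj (f x) * g x := by
  rw [L2.inner_def]
  refine integral_congr_ae (ae_of_all _ fun x => ?_)
  simp [RCLike.inner_apply, mul_comm]

theorem norm_Lp_sq_eq_integral (f : Lp ℂ 2 (volume : Measure ℝ)) :
    ‖f‖ ^ 2 = ∫ x, ‖f x‖ ^ 2 := by
  have h := inner_self_eq_norm_sq_to_K (𝕜 := ℂ) f
  rw [inner_Lp_eq_integral] at h
  have e : ∀ x, conj (f x) * f x = ((‖f x‖ ^ 2 : ℝ) : ℂ) := fun x => by
    rw [Complex.conj_mul']; push_cast; rfl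
  simp only [e] at h
  rw [integral_complex_ofReal] at h
  simp only [Complex.coe_algebraMap] at h
  exact_mod_cast h.symm

theorem integral_norm_sq_eq_of_ae {f : ℝ → ℂ} {u : Lp ℂ 2 (volume : Measure ℝ)}
    (h : u =ᵐ[volume] f) : ∫ x, ‖f x‖ ^ 2 = ‖u‖ ^ 2 := by
  rw [norm_Lp_sq_eq_integral]
  refine integral_congr_ae ?_
  filter_upwards [h] with x hx
  rw [hx]

theorem MemLp.norm_integral_mul_sq_le {f g : ℝ → ℂ} (hf : MemLp f 2) (hg : MemLp g 2) :
    ‖∫ x, f x * g x‖ ^ 2 ≤ (∫ x, ‖f x‖ ^ 2) * ∫ x, ‖g x‖ ^ 2 := by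
  have h1 : ∫ x, f x * g x = inner ℂ (hf.star.toLp _) (hg.toLp g) := by
    rw [inner_Lp_eq_integral]
    refine integral_congr_ae ?_
    filter_upwards [hf.star.coeFn_toLp, hg.coeFn_toLp] with x hx hx'
    rw [hx, hx']
    simp
  have h2 : ∫ x, ‖f x‖ ^ 2 = ‖hf.star.toLp _‖ ^ 2 := by
    rw [← integral_norm_sq_eq_of_ae hf.star.coeFn_toLp]
    simp
  rw [h1, h2, integral_norm_sq_eq_of_ae hg.coeFn_toLp, ← mul_pow]
  gcongr
  exact norm_inner_le_norm _ _

namespace IsH1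

variable {f f' g g' : ℝ → ℂ}

/-- At κ = iq the fundamental solution identity reads 2q f(c) = X + q²Y, and Cauchy–Schwarz applies
with squared norms q for the derivative of the kernel and 1/q for the kernel. A large q makes the
coefficient of ‖f'‖² small, so point evaluations are a small perturbation of the kinetic energy. -/
theorem norm_apply_sq_le (hf : IsH1 f f') {q : ℝ} (hq : 0 < q) (c : ℝ) :
    ‖f c‖ ^ 2 ≤ (∫ x, ‖f' x‖ ^ 2) / (2 * q) + q / 2 * ∫ x, ‖f x‖ ^ 2 := by
  have hκ : 0 < (Complex.I * q).im := by simpa using hq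
  have h := hf.integral_deriv_mul_expKernelDeriv hκ c
  have hK := isH1_expKernel hκ c
  have n1 : ∫ x, ‖expKernel (Complex.I * q) c x‖ ^ 2 = 1 / q := by
    have e : ∀ x, ‖expKernel (Complex.I * q) c x‖ ^ 2 = Real.exp (-(2 * q * |x - c|)) := fun x => by
      rw [norm_expKernel, sq, ← Real.exp_add]
      congr 1; simp; ring
    simp only [e]
    rw [integral_exp_neg_mul_abs_sub (by linarith)]
    field_simp
  have n2 : ∫ x, ‖expKernelDeriv (Complex.I * q) c x‖ ^ 2 = q := by
    have e : ∀ x, ‖expKernelDeriv (Complex.I * q) c x‖ ^ 2 =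
        q ^ 2 * ‖expKernel (Complex.I * q) c x‖ ^ 2 := fun x => by
      rw [norm_expKernelDeriv, ← norm_expKernel, mul_pow]
      simp
    simp only [e]
    rw [integral_const_mul, n1]
    field_simp
  have c1 := MemLp.norm_integral_mul_sq_le hf.memLp_deriv hK.memLp_deriv
  have c2 := MemLp.norm_integral_mul_sq_le hf.memLp hK.memLp
  rw [n2] at c1
  rw [n1] at c2
  set X := ∫ x, f' x * expKernelDeriv (Complex.I * q) c x
  set Y := ∫ x, f x * expKernel (Complex.I * q) c x
  have e : (2 * q : ℂ) * f c = X + q ^ 2 * Y := by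
    linear_combination -h + (-(q : ℂ) ^ 2 * Y + 2 * q * f c) * Complex.I_sq
  have e2 : 2 * q * ‖f c‖ ≤ ‖X‖ + q ^ 2 * ‖Y‖ := by
    have := congrArg norm e
    rw [norm_mul, norm_mul] at this
    simp only [Complex.norm_ofNat, Complex.norm_real, Real.norm_eq_abs, abs_of_pos hq] at this
    rw [this]
    refine (norm_add_le _ _).trans ?_
    rw [norm_mul, norm_pow, Complex.norm_real, Real.norm_eq_abs, sq_abs]
  have e3 : (2 * q * ‖f c‖) ^ 2 ≤ 2 * ‖X‖ ^ 2 + 2 * (q ^ 2 * ‖Y‖) ^ 2 := by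
    have : (2 * q * ‖f c‖) ^ 2 ≤ (‖X‖ + q ^ 2 * ‖Y‖) ^ 2 := by gcongr
    nlinarith [sq_nonneg (‖X‖ - q ^ 2 * ‖Y‖)]
  set A := ∫ x, ‖f' x‖ ^ 2
  set B := ∫ x, ‖f x‖ ^ 2
  have e4 : (2 * q * ‖f c‖) ^ 2 ≤ 2 * (A * q) + 2 * (q ^ 4 * (B * (1 / q))) := by
    refine e3.trans ?_
    rw [mul_pow, ← pow_mul]
    norm_num
    gcongr
    simpa using c2
  have e5 : (2 * q * ‖f c‖) ^ 2 = 4 * q ^ 2 * ‖f c‖ ^ 2 := by ring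
  have e6 : 2 * (A * q) + 2 * (q ^ 4 * (B * (1 / q))) =
      4 * q ^ 2 * (A / (2 * q) + q / 2 * B) := by field_simp; ring
  rw [e5, e6] at e4
  exact le_of_mul_le_mul_left e4 (by positivity)

theorem sub (hf : IsH1 f f') (hg : IsH1 g g') :
    IsH1 (fun x => f x - g x) (fun x => f' x - g' x) := by
  have := hf.add (hg.smul (-1))
  simpa [sub_eq_add_neg] using this

/-- `H¹(ℝ)` is complete. -/
theorem exists_of_tendsto {F F' : ℕ → ℝ → ℂ} (hF : ∀ n, IsH1 (F n) (F' n))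
    {u v : ℕ → Lp ℂ 2 (volume : Measure ℝ)} (hu : ∀ n, u n =ᵐ[volume] F n)
    (hv : ∀ n, v n =ᵐ[volume] F' n) {u₀ v₀ : Lp ℂ 2 (volume : Measure ℝ)}
    (hu₀ : Tendsto u atTop (𝓝 u₀)) (hv₀ : Tendsto v atTop (𝓝 v₀)) :
    ∃ f : ℝ → ℂ, IsH1 f v₀ ∧ u₀ =ᵐ[volume] f ∧ ∀ c, Tendsto (fun n => F n c) atTop (𝓝 (f c)) := by
  have hκ : 0 < Complex.I.im := by simp
  -- By the fundamental solution identity at κ = i, the value at c is a sum of inner products with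
  -- fixed L² functions, so it converges along the sequence.
  have hlim : ∀ c, ∃ l, Tendsto (fun n => F n c) atTop (𝓝 l) := by
    intro c
    have hK := isH1_expKernel hκ c
    set k := hK.memLp.star.toLp _
    set k' := hK.memLp_deriv.star.toLp _
    have e : ∀ n, F n c = 2⁻¹ * (inner ℂ k' (v n) + inner ℂ k (u n)) := by
      intro n
      have h := (hF n).integral_deriv_mul_expKernelDeriv hκ c
      have i1 : inner ℂ k' (v n) = ∫ x, F' n x * expKernelDeriv Complex.I c x := by
        rw [inner_Lp_eq_integral]
        refine integral_congr_ae ?_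
        filter_upwards [hK.memLp_deriv.star.coeFn_toLp, hv n] with x hx hx'
        rw [hx, hx']; simp [mul_comm]
      have i2 : inner ℂ k (u n) = ∫ x, F n x * expKernel Complex.I c x := by
        rw [inner_Lp_eq_integral]
        refine integral_congr_ae ?_
        filter_upwards [hK.memLp.star.coeFn_toLp, hu n] with x hx hx'
        rw [hx, hx']; simp [mul_comm]
      rw [i1, i2]
      linear_combination (-1 / 2 : ℂ) * h +
        (F n c - (1 / 2) * ∫ x, F n x * expKernel Complex.I c x) * Complex.I_sq
    refine ⟨2⁻¹ * (inner ℂ k' v₀ + inner ℂ k u₀), ?_⟩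
    simp only [e]
    exact ((tendsto_const_nhds.inner hv₀).add (tendsto_const_nhds.inner hu₀)).const_mul _
  choose f hf using hlim
  have hae : u₀ =ᵐ[volume] f := by
    have hm := tendstoInMeasure_of_tendsto_Lp hu₀
    obtain ⟨ns, hns, hae⟩ := hm.exists_seq_tendsto_ae
    filter_upwards [hae, ae_all_iff.2 hu] with x hx hx'
    refine tendsto_nhds_unique hx ?_
    simp only [hx']
    exact (hf x).comp hns.tendsto_atTop
  refine ⟨f, ⟨(memLp_congr_ae hae).1 (Lp.memLp u₀), Lp.memLp v₀, fun x y => ?_⟩, hae, hf⟩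
  have h1 : Tendsto (fun n => F n y - F n x) atTop (𝓝 (f y - f x)) := (hf y).sub (hf x)
  refine tendsto_nhds_unique h1 ?_
  have hfin : volume (uIoc x y) ≠ ⊤ := by simp [uIoc]
  have e : ∀ w : Lp ℂ 2 (volume : Measure ℝ), ∫ s in x..y, w s = (if x ≤ y then (1 : ℝ) else -1) •
      inner ℂ (indicatorConstLp 2 measurableSet_uIoc hfin (1 : ℂ)) w := by
    intro w
    rw [intervalIntegral.intervalIntegral_eq_integral_uIoc, L2.inner_indicatorConstLp_one]
  have e2 : ∀ n, F n y - F n x = ∫ s in x..y, v n s := by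
    intro n
    rw [(hF n).sub_eq_integral]
    refine intervalIntegral.integral_congr_ae ?_
    filter_upwards [hv n] with s hs _
    exact hs.symm
  simp only [e2, e]
  exact (tendsto_const_nhds.inner hv₀).const_smul _

theorem deltaForm_conj_symm (a α : ℝ) (f f' g g' : ℝ → ℂ) :
    (starRingEnd ℂ) (deltaForm a α g g' f f') = deltaForm a α f f' g g' := by
  rw [deltaForm, deltaForm, map_add, ← integral_conj]
  simp only [map_mul, map_add, Complex.conj_conj, Complex.conj_ofReal]
  congr 1
  · refine integral_congr_ae (ae_of_all _ fun x => ?_)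
    simp only; ring
  · ring

end IsH1

variable {a α : ℝ}

theorem deltaGraph_symmetric {p q : Lp ℂ 2 (volume : Measure ℝ) × Lp ℂ 2 (volume : Measure ℝ)}
    (hp : p ∈ deltaGraph a α) (hq : q ∈ deltaGraph a α) : inner ℂ p.1 q.2 = inner ℂ p.2 q.1 := by
  obtain ⟨f, f', hf, ef, wf⟩ := hp
  obtain ⟨g, g', hg, eg, wg⟩ := hq
  have h1 : inner ℂ p.1 q.2 = deltaForm a α f f' g g' := by
    rw [wg f f' hf, inner_Lp_eq_integral]
    refine integral_congr_ae ?_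
    filter_upwards [ef] with x hx
    rw [hx]
  have h2 : inner ℂ q.1 p.2 = deltaForm a α g g' f f' := by
    rw [wf g g' hg, inner_Lp_eq_integral]
    refine integral_congr_ae ?_
    filter_upwards [eg] with x hx
    rw [hx]
  rw [h1, ← inner_conj_symm, h2, IsH1.deltaForm_conj_symm]

/-- A bound from below for `Q`. -/
theorem deltaGraph_lower_bound {ψ η : Lp ℂ 2 (volume : Measure ℝ)} {f f' : ℝ → ℂ}
    (hf : IsH1 f f') (e : ψ =ᵐ[volume] f)
    (w : ∀ g g' : ℝ → ℂ, IsH1 g g' → deltaForm a α g g' f f' = ∫ x, conj (g x) * η x) {q : ℝ}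
    (hq : 0 < q) (hqα : 2 * |α| ≤ q) :
    (∫ x, ‖f' x‖ ^ 2) / 2 ≤ (inner ℂ ψ η).re + |α| * q * ‖ψ‖ ^ 2 := by
  have h1 : inner ℂ ψ η = deltaForm a α f f' f f' := by
    rw [w f f' hf, inner_Lp_eq_integral]
    refine integral_congr_ae ?_
    filter_upwards [e] with x hx
    rw [hx]
  have h2 : deltaForm a α f f' f f' =
      (((∫ x, ‖f' x‖ ^ 2) + α * (‖f a‖ ^ 2 + ‖f (-a)‖ ^ 2) : ℝ) : ℂ) := by
    have e1 : ∀ x, conj (f' x) * f' x = ((‖f' x‖ ^ 2 : ℝ) : ℂ) := fun x => by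
      rw [Complex.conj_mul']; push_cast; rfl
    simp only [deltaForm, e1, Complex.conj_mul']
    rw [integral_complex_ofReal]
    push_cast; rfl
  rw [h1, h2, Complex.ofReal_re, ← integral_norm_sq_eq_of_ae e]
  have b1 := hf.norm_apply_sq_le hq a
  have b2 := hf.norm_apply_sq_le hq (-a)
  set A := ∫ x, ‖f' x‖ ^ 2
  set B := ∫ x, ‖f x‖ ^ 2
  have hA : 0 ≤ A := integral_nonneg fun x => by positivity
  have b3 : |α| * (‖f a‖ ^ 2 + ‖f (-a)‖ ^ 2) ≤ |α| * (A / q + q * B) := by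
    refine mul_le_mul_of_nonneg_left ?_ (abs_nonneg α)
    have : A / q = A / (2 * q) + A / (2 * q) := by field_simp; norm_num
    rw [this]; linarith
  -- Here 2|α| ≤ q lets the kinetic term absorb the attraction while keeping half of itself.
  have b4 : |α| * (A / q) ≤ A / 2 := by
    rw [mul_div_assoc', div_le_div_iff₀ hq (by norm_num)]
    nlinarith
  have b5 : -|α| * (‖f a‖ ^ 2 + ‖f (-a)‖ ^ 2) ≤ α * (‖f a‖ ^ 2 + ‖f (-a)‖ ^ 2) := by
    gcongr; exact neg_abs_le α
  have b6 : |α| * (A / q + q * B) = |α| * (A / q) + |α| * q * B := by ring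
  linarith

/-- For integrable `f` the resolvent is given by `resolventFun`. -/
theorem resolventFun_mem_deltaGraph (ha : 0 < a) {κ : ℂ} (hκ : 0 < κ.im)
    (hp : parityDenom a α 1 κ ≠ 0) (hm : parityDenom a α (-1) κ ≠ 0)
    {f : Lp ℂ 2 (volume : Measure ℝ)} (hf : Integrable f) :
    ∃ g : Lp ℂ 2 (volume : Measure ℝ), g =ᵐ[volume] resolventFun a α κ f ∧
      (g, f + κ ^ 2 • g) ∈ deltaGraph a α := by
  obtain ⟨u', hu, w⟩ := exists_isH1_resolventFun ha α hκ hp hm hf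
  refine ⟨hu.memLp.toLp _, hu.memLp.coeFn_toLp, _, u', hu, hu.memLp.coeFn_toLp, fun g g' hg => ?_⟩
  have h := eq_add_of_sub_eq (w g g' hg)
  rw [h, ← integral_const_mul, ← integral_add (integrable_conj_mul hg.memLp (Lp.memLp f))
    ((integrable_conj_mul hg.memLp hu.memLp).const_mul _)]
  refine integral_congr_ae ?_
  filter_upwards [Lp.coeFn_add f (κ ^ 2 • hu.memLp.toLp _), Lp.coeFn_smul (κ ^ 2) (hu.memLp.toLp _),
    hu.memLp.coeFn_toLp] with x h1 h2 h3
  simp only [h1, Pi.add_apply, h2, Pi.smul_apply, h3, smul_eq_mul]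
  ring

theorem dense_integrable_Lp_two :
    Dense {f : Lp ℂ 2 (volume : Measure ℝ) | Integrable f} := by
  refine (MeasureTheory.Lp.dense_hasCompactSupport_contDiff (F := ℂ) (E := ℝ) (p := 2)
    (μ := volume) (by norm_num)).mono ?_
  rintro f ⟨g, hfg, hs, hg⟩
  exact (hg.continuous.integrable_of_hasCompactSupport hs).congr hfg.symm

/-- For Im κ ≥ 0 the exponential has modulus at most 1, so D_σ differs from 2κ by at most 2|α|. -/
theorem parityDenom_ne_zero_of_large {σ : ℝ} (hσ : |σ| ≤ 1) (ha : 0 < a) {κ : ℂ} (hκ : 0 ≤ κ.im)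
    (h : |α| < ‖κ‖) : 2 * (‖κ‖ - |α|) ≤ ‖parityDenom a α σ κ‖ ∧ parityDenom a α σ κ ≠ 0 := by
  have hexp : ‖Complex.exp (2 * Complex.I * κ * a)‖ ≤ 1 := by
    rw [Complex.norm_exp, Real.exp_le_one_iff]
    simp
    positivity
  have h1 : ‖Complex.I * α * (1 + σ * Complex.exp (2 * Complex.I * κ * a))‖ ≤ |α| * 2 := by
    rw [norm_mul, norm_mul, Complex.norm_I, one_mul, Complex.norm_real, Real.norm_eq_abs]
    gcongr
    refine (norm_add_le _ _).trans ?_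
    rw [norm_one, norm_mul, Complex.norm_real, Real.norm_eq_abs]
    nlinarith [norm_nonneg (Complex.exp (2 * Complex.I * κ * a)), abs_nonneg σ]
  have h2 : 2 * (‖κ‖ - |α|) ≤ ‖parityDenom a α σ κ‖ := by
    have := norm_sub_le_norm_add (2 * κ) (Complex.I * α *
      (1 + σ * Complex.exp (2 * Complex.I * κ * a)))
    rw [norm_mul, Complex.norm_ofNat] at this
    rw [parityDenom]
    linarith
  refine ⟨h2, fun h0 => ?_⟩
  rw [h0, norm_zero] at h2
  linarith

/-- For large lam the form is coercive, so ‖(H + lam)ψ‖ controls both ‖ψ‖ and ‖ψ'‖. The explicit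
formula solves the resolvent equation for integrable data; density and completeness of H¹ give it
for all data. A bounded everywhere defined inverse of a symmetric operator is self-adjoint. -/
theorem exists_isRealResolvent (ha : 0 < a) (α : ℝ) :
    ∃ (lam : ℝ) (R : Lp ℂ 2 (volume : Measure ℝ) →L[ℂ] Lp ℂ 2 (volume : Measure ℝ)),
      IsRealResolvent (deltaHamiltonian a α) lam R := by
  -- This q exceeds |α|, so κ = iq is a point with κ² = -lam where neither D_σ vanishes; it also
  -- meets the lower bound's condition 2|α| ≤ q.
  set q : ℝ := 2 * |α| + 1 with hq
  have hαn := abs_nonneg α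
  have hq0 : 0 < q := by positivity
  set lam : ℝ := q ^ 2 with hlam
  have hlamge : |α| * q + 1 ≤ lam := by rw [hlam]; nlinarith
  have hcoer : ∀ {ψ η : Lp ℂ 2 (volume : Measure ℝ)} {f f' : ℝ → ℂ}, IsH1 f f' → ψ =ᵐ[volume] f →
      (∀ g g' : ℝ → ℂ, IsH1 g g' → deltaForm a α g g' f f' = ∫ x, conj (g x) * η x) →
      (∫ x, ‖f' x‖ ^ 2) / 2 + ‖ψ‖ ^ 2 ≤ ‖ψ‖ * ‖η + (lam : ℂ) • ψ‖ := by
    intro ψ η f f' hf e w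
    have h1 := deltaGraph_lower_bound hf e w hq0 (by linarith)
    have h2 : (inner ℂ ψ (η + (lam : ℂ) • ψ)).re = (inner ℂ ψ η).re + lam * ‖ψ‖ ^ 2 := by
      rw [inner_add_right, inner_smul_right, inner_self_eq_norm_sq_to_K, Complex.add_re]
      congr 1
      have : (lam : ℂ) * ((‖ψ‖ : ℝ) : ℂ) ^ 2 = ((lam * ‖ψ‖ ^ 2 : ℝ) : ℂ) := by push_cast; rfl
      exact (congrArg Complex.re this).trans (Complex.ofReal_re _)
    have h3 := (Complex.re_le_norm (inner ℂ ψ (η + (lam : ℂ) • ψ))).trans (norm_inner_le_norm _ _)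
    rw [h2] at h3
    nlinarith [sq_nonneg ‖ψ‖]
  have hbound : ∀ {ψ η : Lp ℂ 2 (volume : Measure ℝ)}, (ψ, η) ∈ deltaGraph a α →
      ‖ψ‖ ≤ ‖η + (lam : ℂ) • ψ‖ := by
    rintro ψ η ⟨f, f', hf, e, w⟩
    have h1 := hcoer hf e w
    have h2 : 0 ≤ ∫ x, ‖f' x‖ ^ 2 := integral_nonneg fun x => by positivity
    by_contra! hlt
    have h3 : 0 ≤ ‖η + (lam : ℂ) • ψ‖ := norm_nonneg _
    nlinarith
  have hderiv : ∀ {ψ η : Lp ℂ 2 (volume : Measure ℝ)} {f f' : ℝ → ℂ}, IsH1 f f' → ψ =ᵐ[volume] f →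
      (∀ g g' : ℝ → ℂ, IsH1 g g' → deltaForm a α g g' f f' = ∫ x, conj (g x) * η x) →
      ∫ x, ‖f' x‖ ^ 2 ≤ 2 * ‖η + (lam : ℂ) • ψ‖ ^ 2 := by
    intro ψ η f f' hf e w
    have h1 := hcoer hf e w
    have h2 : ‖ψ‖ ≤ ‖η + (lam : ℂ) • ψ‖ := hbound ⟨f, f', hf, e, w⟩
    nlinarith [norm_nonneg ψ]
  -- The solutions for integrable approximations of w are Cauchy in H¹ by coercivity, and every term
  -- of the weak equation, including the point values, passes to the limit.
  have hsurj : ∀ w : Lp ℂ 2 (volume : Measure ℝ), ∃ ψ, (ψ, w - (lam : ℂ) • ψ) ∈ deltaGraph a α := by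
    intro w
    obtain ⟨ws, hws, hwlim⟩ := mem_closure_iff_seq_limit.1 (dense_integrable_Lp_two w)
    have hκ : 0 < (Complex.I * q).im := by simpa using hq0
    have hnκ : |α| < ‖Complex.I * (q : ℂ)‖ := by
      rw [norm_mul, Complex.norm_I, one_mul, Complex.norm_real, Real.norm_eq_abs, abs_of_pos hq0]
      linarith
    have hex : ∀ n, ∃ ψ, (ψ, ws n - (lam : ℂ) • ψ) ∈ deltaGraph a α := by
      intro n
      obtain ⟨g, -, hg⟩ := resolventFun_mem_deltaGraph (f := ws n) ha hκ
        (parityDenom_ne_zero_of_large (by simp) ha hκ.le hnκ).2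
        (parityDenom_ne_zero_of_large (by simp) ha hκ.le hnκ).2 (hws n)
      refine ⟨g, ?_⟩
      convert hg using 2
      rw [mul_pow, Complex.I_sq, hlam, sub_eq_add_neg, ← neg_smul]
      push_cast; ring_nf
    choose ψ hψ using hex
    have hψ' := hψ
    choose F F' hF hFe hFw using hψ
    have hcau : CauchySeq ws := hwlim.cauchySeq
    have hsub : ∀ m n, (ψ m - ψ n, (ws m - (lam : ℂ) • ψ m) - (ws n - (lam : ℂ) • ψ n)) ∈
        deltaGraph a α := fun m n => (deltaGraph a α).sub_mem (hψ' m) (hψ' n)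
    have hsimp : ∀ m n, (ws m - (lam : ℂ) • ψ m) - (ws n - (lam : ℂ) • ψ n) +
        (lam : ℂ) • (ψ m - ψ n) = ws m - ws n := fun m n => by
      rw [smul_sub]; abel
    have hψc : CauchySeq ψ := by
      rw [Metric.cauchySeq_iff'] at hcau ⊢
      intro ε hε
      obtain ⟨N, hN⟩ := hcau ε hε
      refine ⟨N, fun n hn => ?_⟩
      have := hbound (hsub n N)
      rw [hsimp] at this
      rw [dist_eq_norm]
      exact this.trans_lt (by rw [← dist_eq_norm]; exact hN n hn)
    set v : ℕ → Lp ℂ 2 (volume : Measure ℝ) := fun n => (hF n).memLp_deriv.toLp _ with hv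
    have hve : ∀ n, v n =ᵐ[volume] F' n := fun n => (hF n).memLp_deriv.coeFn_toLp
    have hvc : CauchySeq v := by
      rw [Metric.cauchySeq_iff'] at hcau ⊢
      intro ε hε
      obtain ⟨N, hN⟩ := hcau (ε / 2) (by positivity)
      refine ⟨N, fun n hn => ?_⟩
      have h1 : ∫ x, ‖F' n x - F' N x‖ ^ 2 ≤ 2 * ‖ws n - ws N‖ ^ 2 := by
        rw [← hsimp]
        refine hderiv ((hF n).sub (hF N)) ?_ fun g g' hg => ?_
        · filter_upwards [Lp.coeFn_sub (ψ n) (ψ N), hFe n, hFe N] with x h1 h2 h3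
          rw [h1, Pi.sub_apply, h2, h3]
        · have e1 := deltaForm_add a α hg (hF n) ((hF N).smul (-1))
          rw [deltaForm_smul, hFw n g g' hg, hFw N g g' hg] at e1
          have e2 : deltaForm a α g g' (fun x => F n x - F N x) (fun x => F' n x - F' N x) =
              (∫ x, conj (g x) * (ψ n, ws n - (lam : ℂ) • ψ n).2 x) +
              -1 * ∫ x, conj (g x) * (ψ N, ws N - (lam : ℂ) • ψ N).2 x := by
            rw [← e1]; simp [sub_eq_add_neg]
          rw [e2, neg_one_mul, ← sub_eq_add_neg,
            ← integral_sub (integrable_conj_mul hg.memLp (Lp.memLp _))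
              (integrable_conj_mul hg.memLp (Lp.memLp _))]
          refine integral_congr_ae ?_
          filter_upwards [Lp.coeFn_sub (ws n - (lam : ℂ) • ψ n) (ws N - (lam : ℂ) • ψ N)] with x h1
          rw [h1, Pi.sub_apply]
          ring
      have h2 : ‖v n - v N‖ ^ 2 ≤ 2 * ‖ws n - ws N‖ ^ 2 := by
        refine le_trans (le_of_eq ?_) h1
        refine (integral_norm_sq_eq_of_ae ?_).symm
        filter_upwards [Lp.coeFn_sub (v n) (v N), hve n, hve N] with x h1 h2 h3
        rw [h1, Pi.sub_apply, h2, h3]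
      have h3 := hN n hn
      rw [dist_eq_norm] at h3 ⊢
      by_contra! hge
      nlinarith [norm_nonneg (ws n - ws N), norm_nonneg (v n - v N)]
    obtain ⟨ψ₀, hψ₀⟩ := cauchySeq_tendsto_of_complete hψc
    obtain ⟨v₀, hv₀⟩ := cauchySeq_tendsto_of_complete hvc
    obtain ⟨f, hf, hfe, hfl⟩ := IsH1.exists_of_tendsto hF hFe hve hψ₀ hv₀
    refine ⟨ψ₀, f, v₀, hf, hfe, fun g g' hg => ?_⟩
    set γ := hg.memLp.toLp g
    set γ' := hg.memLp_deriv.toLp g'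
    have r1 : ∀ u : Lp ℂ 2 (volume : Measure ℝ), ∫ x, conj (g x) * u x = inner ℂ γ u := by
      intro u
      rw [inner_Lp_eq_integral]
      refine integral_congr_ae ?_
      filter_upwards [hg.memLp.coeFn_toLp] with x hx
      rw [hx]
    have r2 : ∀ (u : Lp ℂ 2 (volume : Measure ℝ)) (F' : ℝ → ℂ), u =ᵐ[volume] F' →
        ∫ x, conj (g' x) * F' x = inner ℂ γ' u := by
      intro u F' hu
      rw [inner_Lp_eq_integral]
      refine integral_congr_ae ?_
      filter_upwards [hg.memLp_deriv.coeFn_toLp, hu] with x hx hx'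
      rw [hx, hx']
    have l1 : Tendsto (fun n => deltaForm a α g g' (F n) (F' n)) atTop
        (𝓝 (deltaForm a α g g' f v₀)) := by
      simp only [deltaForm]
      rw [r2 v₀ v₀ ae_eq_rfl]
      simp only [fun n => r2 (v n) (F' n) (hve n)]
      exact (tendsto_const_nhds.inner hv₀).add ((((hfl a).const_mul _).add
        ((hfl (-a)).const_mul _)).const_mul _)
    refine tendsto_nhds_unique l1 ?_
    simp only [fun n => hFw n g g' hg, r1]
    exact tendsto_const_nhds.inner (hwlim.sub (hψ₀.const_smul _))
  have huniq : ∀ {w ψ ψ' : Lp ℂ 2 (volume : Measure ℝ)}, (ψ, w - (lam : ℂ) • ψ) ∈ deltaGraph a α →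
      (ψ', w - (lam : ℂ) • ψ') ∈ deltaGraph a α → ψ = ψ' := by
    intro w ψ ψ' h h'
    have := hbound ((deltaGraph a α).sub_mem h h')
    rw [← sub_eq_zero, ← norm_le_zero_iff]
    refine this.trans (le_of_eq ?_)
    rw [norm_eq_zero]
    simp only [smul_sub]
    abel
  choose r hr using hsurj
  let R₀ : Lp ℂ 2 (volume : Measure ℝ) →ₗ[ℂ] Lp ℂ 2 (volume : Measure ℝ) :=
    { toFun := r
      map_add' := fun w w' => by
        refine huniq (hr (w + w')) ?_
        have := (deltaGraph a α).add_mem (hr w) (hr w')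
        convert this using 1
        rw [Prod.mk_add_mk, smul_add]
        congr 1; abel
      map_smul' := fun c w => by
        refine huniq (hr (c • w)) ?_
        have := (deltaGraph a α).smul_mem c (hr w)
        convert this using 1
        rw [Prod.smul_mk, smul_sub, smul_comm c (lam : ℂ)]
        rfl }
  let R := R₀.mkContinuous 1 fun w => by
    have := hbound (hr w)
    rw [sub_add_cancel] at this
    rw [one_mul]; exact this
  have hRr : ∀ w, R w = r w := fun w => rfl
  refine ⟨lam, R, ?_, fun f g => ?_⟩
  · rw [ContinuousLinearMap.isSelfAdjoint_iff_isSymmetric]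
    intro w w'
    change inner ℂ (r w) w' = inner ℂ w (r w')
    have := deltaGraph_symmetric (hr w) (hr w')
    simp only [inner_sub_left, inner_sub_right, inner_smul_left, inner_smul_right,
      Complex.conj_ofReal] at this
    linear_combination this
  · rw [deltaHamiltonian_graph, hRr]
    have h1 := hr (g + (lam : ℂ) • f)
    constructor
    · intro h
      refine huniq h1 ?_
      rwa [add_sub_cancel_right]
    · intro h
      rw [h, add_sub_cancel_right] at h1
      exact h1

end SelfAdjoint

/-! ### Zeros of the denominators and bound states -/

section BoundStates

open Set

variable {a α : ℝ}

theorem norm_exp_two_mul_lt_one (ha : 0 < a) {κ : ℂ} (hκ : 0 < κ.im) :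
    ‖Complex.exp (2 * Complex.I * κ * a)‖ < 1 := by
  rw [Complex.norm_exp, Real.exp_lt_one_iff]
  simp
  positivity

theorem parityWave_self_ne_zero (ha : 0 < a) {σ : ℝ} (hσ : |σ| = 1) {κ : ℂ} (hκ : 0 < κ.im) :
    parityWave a σ κ a ≠ 0 := by
  rw [parityWave, expKernel_self, expKernel_two_mul ha]
  intro h
  have h1 : ‖(σ : ℂ) * Complex.exp (2 * Complex.I * κ * a)‖ = 1 := by
    rw [← neg_eq_of_add_eq_zero_right h]; simp
  rw [norm_mul, Complex.norm_real, Real.norm_eq_abs, hσ, one_mul] at h1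
  exact (norm_exp_two_mul_lt_one ha hκ).ne h1

/-- Zeros of the denominator in the upper half-plane give eigenvectors. -/
theorem parityWave_mem_deltaGraph (ha : 0 < a) {σ : ℝ} (hσ : σ ^ 2 = 1) {κ : ℂ} (hκ : 0 < κ.im)
    (h0 : parityDenom a α σ κ = 0) {ψ : Lp ℂ 2 (volume : Measure ℝ)}
    (hψ : ψ =ᵐ[volume] parityWave a σ κ) : (ψ, κ ^ 2 • ψ) ∈ deltaGraph a α := by
  refine ⟨_, _, isH1_parityWave a σ hκ, hψ, fun g g' hg => ?_⟩
  have h := deltaForm_parityWave ha α hσ hκ hg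
  rw [h0, mul_zero, zero_mul, sub_eq_zero] at h
  rw [h, ← integral_const_mul]
  refine integral_congr_ae ?_
  filter_upwards [Lp.coeFn_smul (κ ^ 2) ψ, hψ] with x h1 h2
  simp only [h1, Pi.smul_apply, h2, smul_eq_mul]
  ring

/-- A zero yields an eigenvector with eigenvalue κ², which is real by symmetry of the operator; as
Im κ > 0, κ must be purely imaginary. -/
theorem re_eq_zero_of_parityDenom_eq_zero (ha : 0 < a) {σ : ℝ} (hσ : |σ| = 1) {κ : ℂ}
    (hκ : 0 < κ.im) (h0 : parityDenom a α σ κ = 0) : κ.re = 0 := by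
  have hσ2 : σ ^ 2 = 1 := by rw [← sq_abs, hσ, one_pow]
  have hw := isH1_parityWave a σ hκ
  set ψ := hw.memLp.toLp _ with hψ
  have hg := parityWave_mem_deltaGraph (ψ := ψ) ha hσ2 hκ h0 hw.memLp.coeFn_toLp
  have hs := deltaGraph_symmetric hg hg
  simp only [inner_smul_left, inner_smul_right] at hs
  have hne : inner ℂ ψ ψ ≠ 0 := by
    rw [inner_self_ne_zero]
    intro h
    have h1 : parityWave a σ κ =ᵐ[volume] 0 :=
      hw.memLp.coeFn_toLp.symm.trans ((Lp.eq_zero_iff_ae_eq_zero).1 h)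
    have h2 := ((continuous_parityWave a σ κ).ae_eq_iff_eq volume continuous_const).1 h1
    exact parityWave_self_ne_zero ha hσ hκ (congrFun h2 a)
  have h1 := mul_right_cancel₀ hne hs
  have h2 : (κ ^ 2).im = 0 := Complex.conj_eq_iff_im.1 h1.symm
  rw [sq, Complex.mul_im] at h2
  have h3 : κ.re * κ.im = 0 := by linarith
  exact (mul_eq_zero.1 h3).resolve_right hκ.ne'

/-- The imaginary part is α(1 + σ cos 2ka). If it vanishes then α = 0 or cos 2ka = -σ, and the
latter forces sin 2ka = 0; in both cases the real part 2k - ασ sin 2ka equals 2k. -/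
theorem parityDenom_real_ne_zero {σ : ℝ} (hσ : |σ| = 1) {k : ℝ} (hk : k ≠ 0) :
    parityDenom a α σ k ≠ 0 := by
  intro h
  have e : Complex.exp (2 * Complex.I * k * a) =
      (Real.cos (2 * k * a) : ℂ) + (Real.sin (2 * k * a) : ℂ) * Complex.I := by
    rw [Complex.ofReal_cos, Complex.ofReal_sin, ← Complex.exp_mul_I]
    congr 1; push_cast; ring
  rw [parityDenom, e] at h
  have hs := Real.sin_sq_add_cos_sq (2 * k * a)
  generalize Real.cos (2 * k * a) = C at *
  generalize Real.sin (2 * k * a) = S at *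
  have hre := congrArg Complex.re h
  have him := congrArg Complex.im h
  simp at hre him
  rcases him with h1 | h1
  · simp [h1] at hre; exact hk hre
  · have h2 : C ^ 2 = 1 := by
      have h3 : σ * C = -1 := by linarith
      have h4 : (σ * C) ^ 2 = 1 := by rw [h3]; norm_num
      rwa [mul_pow, ← sq_abs σ, hσ, one_pow, one_mul] at h4
    have h5 : S = 0 := by
      have : S ^ 2 = 0 := by linarith
      exact pow_eq_zero_iff (by norm_num) |>.1 this
    rw [h5] at hre
    simp at hre
    exact hk hre

theorem hasDerivAt_parityDenom (a α σ : ℝ) (κ : ℂ) :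
    HasDerivAt (parityDenom a α σ)
      (2 - 2 * a * α * σ * Complex.exp (2 * Complex.I * κ * a)) κ := by
  have h1 : HasDerivAt (fun κ : ℂ => 2 * Complex.I * κ * a) (2 * Complex.I * a) κ := by
    have := ((hasDerivAt_id κ).const_mul (2 * Complex.I)).mul_const (a : ℂ)
    simpa using this
  have h2 := ((hasDerivAt_id κ).const_mul (2 : ℂ)).add
    ((((h1.cexp).const_mul (σ : ℂ)).const_add 1).const_mul (Complex.I * α))
  refine h2.congr_deriv ?_
  linear_combination (2 * α * σ * a * Complex.exp (2 * Complex.I * κ * a)) * Complex.I_sq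

theorem parityDenom_I_mul (a α σ q : ℝ) : parityDenom a α σ (Complex.I * q) =
    Complex.I * ((2 * q + α * (1 + σ * Real.exp (-(2 * q * a))) : ℝ) : ℂ) := by
  have : (2 * Complex.I * (Complex.I * q) * a : ℂ) = ((-(2 * q * a) : ℝ) : ℂ) := by
    push_cast
    linear_combination (2 * q * a : ℂ) * Complex.I_sq
  rw [parityDenom, this, ← Complex.ofReal_exp]
  push_cast
  ring

/-- The denominator has at most one zero in the upper half-plane; it is simple and lies on the
imaginary axis. -/
theorem parityDenom_zeros (ha : 0 < a) (α : ℝ) {σ : ℝ} (hσ : σ = 1 ∨ σ = -1) :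
    (∀ κ : ℂ, 0 < κ.im → parityDenom a α σ κ ≠ 0) ∨
      ∃ q : ℝ, 0 < q ∧ parityDenom a α σ (Complex.I * q) = 0 ∧
        deriv (parityDenom a α σ) (Complex.I * q) ≠ 0 ∧
        ∀ κ : ℂ, 0 < κ.im → parityDenom a α σ κ = 0 → κ = Complex.I * q := by
  have hσ1 : |σ| = 1 := by rcases hσ with h | h <;> simp [h]
  rw [or_iff_not_imp_left]
  intro hex
  push Not at hex
  obtain ⟨κ, hκ, h0⟩ := hex
  have himag : ∀ κ : ℂ, 0 < κ.im → parityDenom a α σ κ = 0 → κ = Complex.I * (κ.im : ℝ) := by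
    intro κ hκ h0
    apply Complex.ext
    · simp [re_eq_zero_of_parityDenom_eq_zero ha hσ1 hκ h0]
    · simp
  have hroot : ∀ q : ℝ, parityDenom a α σ (Complex.I * q) = 0 →
      2 * q + α * (1 + σ * Real.exp (-(2 * q * a))) = 0 := by
    intro q hq
    rw [parityDenom_I_mul] at hq
    exact_mod_cast (mul_eq_zero.1 hq).resolve_left Complex.I_ne_zero
  -- A root solves 2q = -α(1 + σe^{-2qa}) with q > 0, which forces α < 0. For σ = 1 the left side
  -- increases while the right side decreases. For σ = -1 strict convexity of exp makes (1 -
  -- e^{-2qa})/q strictly decreasing, so it takes the value -2/α at most once.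
  have huniq : ∀ q₁ q₂ : ℝ, 0 < q₁ → q₁ < q₂ →
      2 * q₁ + α * (1 + σ * Real.exp (-(2 * q₁ * a))) = 0 →
      2 * q₂ + α * (1 + σ * Real.exp (-(2 * q₂ * a))) = 0 → False := by
    intro q₁ q₂ h1 h12 r1 r2
    have hx : 0 < 2 * q₁ * a := by positivity
    have hx12 : 2 * q₁ * a < 2 * q₂ * a := by gcongr
    have e1 : Real.exp (-(2 * q₁ * a)) < 1 := by rw [Real.exp_lt_one_iff]; linarith
    have e12 : Real.exp (-(2 * q₂ * a)) < Real.exp (-(2 * q₁ * a)) := by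
      rw [Real.exp_lt_exp]; linarith
    have e2 := Real.exp_pos (-(2 * q₂ * a))
    set x₁ := Real.exp (-(2 * q₁ * a)) with hx1
    set x₂ := Real.exp (-(2 * q₂ * a)) with hx2
    rcases hσ with rfl | rfl
    · have hα : α < 0 := by
        by_contra! hα
        have : 0 ≤ α * (1 + 1 * x₁) := by positivity
        linarith
      nlinarith
    · have hcv : Real.exp ((1 - q₁ / q₂) • (0 : ℝ) + (q₁ / q₂) • -(2 * q₂ * a)) <
          (1 - q₁ / q₂) • Real.exp 0 + (q₁ / q₂) • Real.exp (-(2 * q₂ * a)) :=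
        strictConvexOn_exp.2 (mem_univ (0 : ℝ)) (mem_univ (-(2 * q₂ * a)))
        (by intro h; linarith : (0 : ℝ) ≠ -(2 * q₂ * a))
        (by rw [sub_pos, div_lt_one (by linarith)]; exact h12) (by have := h1.trans h12; positivity)
        (by ring)
      have hq2 : q₂ ≠ 0 := (h1.trans h12).ne'
      have hq2' : 0 < q₂ := h1.trans h12
      have e : (1 - q₁ / q₂) • (0 : ℝ) + (q₁ / q₂) • -(2 * q₂ * a) = -(2 * q₁ * a) := by
        simp only [smul_eq_mul]; field_simp; ring
      rw [e] at hcv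
      simp only [smul_eq_mul, Real.exp_zero] at hcv
      rw [← hx1, ← hx2] at hcv
      have hcv2 : q₂ * x₁ < q₂ - q₁ + q₁ * x₂ := by
        have := mul_lt_mul_of_pos_left hcv hq2'
        have e3 : q₂ * ((1 - q₁ / q₂) * 1 + q₁ / q₂ * x₂) = q₂ - q₁ + q₁ * x₂ := by field_simp
        linarith
      have hα : α < 0 := by
        by_contra! hα
        have : 0 ≤ α * (1 + -1 * x₁) := by
          apply mul_nonneg hα; linarith
        linarith
      have h5 : q₁ * (1 - x₂) < q₂ * (1 - x₁) := by linarith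
      have h6 : α * (q₁ * (1 - x₂)) = α * (q₂ * (1 - x₁)) := by
        linear_combination q₁ * r2 - q₂ * r1
      exact h5.ne (mul_left_cancel₀ hα.ne h6)
  have hq0 := himag κ hκ h0
  have hD : parityDenom a α σ (Complex.I * (κ.im : ℝ)) = 0 := by rw [← hq0]; exact h0
  refine ⟨κ.im, hκ, hD, ?_, fun κ' hκ' h0' => ?_⟩
  · rw [(hasDerivAt_parityDenom a α σ _).deriv]
    have he : Complex.exp (2 * Complex.I * (Complex.I * (κ.im : ℝ)) * a) =
        ((Real.exp (-(2 * κ.im * a)) : ℝ) : ℂ) := by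
      rw [Complex.ofReal_exp]
      congr 1
      push_cast
      linear_combination (2 * κ.im * a : ℂ) * Complex.I_sq
    rw [he]
    have hr := hroot _ hD
    have hx : 0 < 2 * κ.im * a := by positivity
    have e1 : Real.exp (-(2 * κ.im * a)) < 1 := by rw [Real.exp_lt_one_iff]; linarith
    have e0 := Real.exp_pos (-(2 * κ.im * a))
    have e2 : Real.exp (-(2 * κ.im * a)) * (1 + 2 * κ.im * a) < 1 := by
      have h1 := Real.add_one_lt_exp hx.ne'
      have h2 : Real.exp (-(2 * κ.im * a)) * Real.exp (2 * κ.im * a) = 1 := by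
        rw [← Real.exp_add]; simp
      nlinarith
    set e := Real.exp (-(2 * κ.im * a))
    have hne : (2 - 2 * a * α * σ * e : ℝ) ≠ 0 := by
      intro hz
      rcases hσ with rfl | rfl
      · have hα : α < 0 := by
          by_contra! hα
          have : 0 ≤ α * (1 + 1 * e) := by positivity
          linarith
        have : 0 < -α * (a * e) := mul_pos (by linarith) (by positivity)
        nlinarith
      -- In the odd case the root equation turns (1 - e) times half the derivative factor into 1 -
      -- e(1 + 2qa), which is positive because e^x > 1 + x at x = 2qa.
      · have h1 : (1 - e) * (1 + a * α * e) = 0 := by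
          have : 1 + a * α * e = 0 := by linarith
          rw [this, mul_zero]
        have h2 : (1 - e) * (1 + a * α * e) = 1 - e * (1 + 2 * κ.im * a) := by
          linear_combination (a * e) * hr
        linarith
    exact_mod_cast hne
  · have hq' := himag κ' hκ' h0'
    have hD' : parityDenom a α σ (Complex.I * (κ'.im : ℝ)) = 0 := by rw [← hq']; exact h0'
    have r1 := hroot _ hD
    have r2 := hroot _ hD'
    have : κ'.im = κ.im := by
      rcases lt_trichotomy κ'.im κ.im with h | h | h
      · exact (huniq _ _ hκ' h r2 r1).elim
      · exact h
      · exact (huniq _ _ hκ h r1 r2).elim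
    rw [hq', this]

/-- The eigenfunctions of `H_α`. -/
def boundStates (a α : ℝ) : Set (Lp ℂ 2 (volume : Measure ℝ)) :=
  {ψ | ∃ σ q : ℝ, (σ = 1 ∨ σ = -1) ∧ 0 < q ∧ parityDenom a α σ (Complex.I * q) = 0 ∧
    ψ =ᵐ[volume] parityWave a σ (Complex.I * q)}

/-- The span of the eigenfunctions. -/
def boundSpace (a α : ℝ) : Submodule ℂ (Lp ℂ 2 (volume : Measure ℝ)) :=
  Submodule.span ℂ (boundStates a α)

theorem finite_boundStates (ha : 0 < a) (α : ℝ) : (boundStates a α).Finite := by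
  have hsub : ∀ σ : ℝ, (σ = 1 ∨ σ = -1) → {ψ : Lp ℂ 2 (volume : Measure ℝ) | ∃ q : ℝ, 0 < q ∧
      parityDenom a α σ (Complex.I * q) = 0 ∧
      ψ =ᵐ[volume] parityWave a σ (Complex.I * q)}.Subsingleton := by
    rintro σ hσ ψ ⟨q, hq, h0, hψ⟩ ψ' ⟨q', hq', h0', hψ'⟩
    have him : ∀ {q : ℝ}, 0 < q → 0 < (Complex.I * q).im := fun h => by simpa using h
    rcases parityDenom_zeros ha α hσ with h | ⟨p, -, -, -, h⟩
    · exact (h _ (him hq) h0).elim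
    · have : (Complex.I * q : ℂ) = Complex.I * q' :=
        (h _ (him hq) h0).trans (h _ (him hq') h0').symm
      rw [← this] at hψ'
      exact Lp.ext (hψ.trans hψ'.symm)
  refine ((hsub 1 (Or.inl rfl)).finite.union (hsub (-1) (Or.inr rfl)).finite).subset ?_
  rintro ψ ⟨σ, q, hσ | hσ, h⟩
  · subst hσ; exact Or.inl ⟨q, h⟩
  · subst hσ; exact Or.inr ⟨q, h⟩

theorem boundStates_mem_graph (ha : 0 < a) {ψ : Lp ℂ 2 (volume : Measure ℝ)}
    (h : ψ ∈ boundStates a α) : ∃ s : ℝ, (ψ, (s : ℂ) • ψ) ∈ (deltaHamiltonian a α).graph := by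
  obtain ⟨σ, q, hσ, hq, h0, hψ⟩ := h
  refine ⟨-q ^ 2, ?_⟩
  rw [deltaHamiltonian_graph]
  have := parityWave_mem_deltaGraph (ψ := ψ) ha (by rcases hσ with rfl | rfl <;> norm_num)
    (by simpa using hq) h0 hψ
  convert this using 3
  rw [mul_pow, Complex.I_sq]
  push_cast; ring

/-- Bound states are combinations of decaying exponentials. Being in L¹ and in L^∞, they make the
projection off them bounded on L¹. -/
theorem boundSpace_bounded_integrable {ψ : Lp ℂ 2 (volume : Measure ℝ)}
    (h : ψ ∈ boundSpace a α) : Integrable ψ ∧ ∃ B : ℝ, ∀ᵐ x, ‖ψ x‖ ≤ B := by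
  refine Submodule.span_induction (p := fun (ψ : Lp ℂ 2 (volume : Measure ℝ)) _ => Integrable ψ ∧ ∃ B : ℝ, ∀ᵐ x, ‖ψ x‖ ≤ B)
    ?_ ?_ ?_ ?_ h
  · rintro ψ ⟨σ, q, hσ, hq, h0, hψ⟩
    have him : 0 < (Complex.I * q).im := by simpa using hq
    refine ⟨(integrable_parityWave a σ him).congr hψ.symm, 1 + |σ|, ?_⟩
    filter_upwards [hψ] with x hx
    rw [hx, parityWave]
    refine (norm_add_le _ _).trans (add_le_add (norm_expKernel_le_one him.le _ _) ?_)
    rw [norm_mul, Complex.norm_real, Real.norm_eq_abs]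
    exact mul_le_of_le_one_right (abs_nonneg _) (norm_expKernel_le_one him.le _ _)
  · refine ⟨(integrable_zero ℝ ℂ volume).congr (Lp.coeFn_zero _ _ _).symm, 0, ?_⟩
    filter_upwards [Lp.coeFn_zero ℂ 2 (volume : Measure ℝ)] with x hx
    rw [hx]; simp
  · rintro ψ ψ' _ _ ⟨h1, B, hB⟩ ⟨h1', B', hB'⟩
    refine ⟨(h1.add h1').congr (Lp.coeFn_add _ _).symm, B + B', ?_⟩
    filter_upwards [Lp.coeFn_add ψ ψ', hB, hB'] with x hx h2 h3
    rw [hx]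
    exact (norm_add_le _ _).trans (add_le_add h2 h3)
  · rintro c ψ _ ⟨h1, B, hB⟩
    refine ⟨(h1.smul c).congr (Lp.coeFn_smul _ _).symm, ‖c‖ * B, ?_⟩
    filter_upwards [Lp.coeFn_smul c ψ, hB] with x hx h2
    rw [hx, Pi.smul_apply, norm_smul]
    gcongr

/-- A function orthogonal to the bound states annihilates the corresponding waves. -/
theorem integral_parityWave_mul_eq_zero {f : Lp ℂ 2 (volume : Measure ℝ)}
    (hf : f ∈ (boundSpace a α)ᗮ) {σ q : ℝ} (hσ : σ = 1 ∨ σ = -1) (hq : 0 < q)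
    (h0 : parityDenom a α σ (Complex.I * q) = 0) :
    ∫ y, parityWave a σ (Complex.I * q) y * f y = 0 := by
  have him : 0 < (Complex.I * q).im := by simpa using hq
  have hw := isH1_parityWave a σ him
  have h := hf (hw.memLp.toLp _) (Submodule.subset_span
    ⟨σ, q, hσ, hq, h0, hw.memLp.coeFn_toLp⟩)
  rw [inner_Lp_eq_integral] at h
  rw [← h]
  refine integral_congr_ae ?_
  filter_upwards [hw.memLp.coeFn_toLp] with x hx
  rw [hx]
  congr 1
  -- At κ = iq the kernel is real, so the pairing without conjugate is the inner product.
  have hc : ∀ c, conj (expKernel (Complex.I * q) c x) = expKernel (Complex.I * q) c x := fun c => by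
    rw [expKernel, ← Complex.exp_conj]
    congr 1
    simp only [map_mul, Complex.conj_I, Complex.conj_ofReal]
    ring
  simp only [parityWave, map_add, map_mul, Complex.conj_ofReal, hc]

end BoundStates

/-! ### Cauchy's formula in the upper half-plane -/

section HalfPlane

open Filter Topology Set

theorem norm_sq_sub_sq_ge {w κ : ℂ} (h : 2 * ‖κ‖ ≤ ‖w‖) : ‖w‖ ^ 2 / 2 ≤ ‖w ^ 2 - κ ^ 2‖ := by
  have h1 := norm_sub_norm_le (w ^ 2) (κ ^ 2)
  rw [norm_pow, norm_pow] at h1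
  nlinarith [norm_nonneg κ, norm_nonneg w]

theorem isBigO_inv_sq_integrable {G : ℝ → ℂ} (hc : Continuous G) {C R : ℝ}
    (hG : ∀ k : ℝ, R ≤ |k| → ‖G k‖ ≤ C / k ^ 2) : Integrable G := by
  have hO : ∀ l : Filter ℝ, Tendsto (fun k : ℝ => |k|) l atTop →
      G =O[l] fun k : ℝ => (1 + k ^ 2)⁻¹ := by
    intro l hl
    refine Asymptotics.IsBigO.of_bound (2 * |C|) ?_
    filter_upwards [hl.eventually_ge_atTop R, hl.eventually_ge_atTop 1] with k h1 h2
    have hk : 1 ≤ k ^ 2 := by rw [← sq_abs]; nlinarith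
    refine (hG k h1).trans ?_
    rw [Real.norm_of_nonneg (by positivity), ← div_eq_mul_inv,
      div_le_div_iff₀ (by linarith) (by positivity)]
    nlinarith [le_abs_self C, abs_nonneg C]
  exact hc.locallyIntegrable.integrable_of_isBigO_atBot_atTop (hO _ tendsto_abs_atBot_atTop)
    (integrable_inv_one_add_sq.integrableAtFilter _) (hO _ tendsto_abs_atTop_atTop)
    (integrable_inv_one_add_sq.integrableAtFilter _)

/-- Cauchy's theorem for the upper half-plane. -/
theorem integral_eq_zero_of_differentiableOn_upperHalfPlane {G : ℂ → ℂ}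
    (hd : ∀ w : ℂ, 0 ≤ w.im → DifferentiableAt ℂ G w) {C R : ℝ}
    (hG : ∀ w : ℂ, 0 ≤ w.im → R ≤ ‖w‖ → ‖G w‖ ≤ C / ‖w‖ ^ 2) :
    Integrable (fun k : ℝ => G k) ∧ ∫ k : ℝ, G k = 0 := by
  have hcont : Continuous fun k : ℝ => G k := by
    rw [continuous_iff_continuousAt]
    intro k
    exact ContinuousAt.comp (f := fun k : ℝ => (k : ℂ)) (hd k (by simp)).continuousAt
      Complex.continuous_ofReal.continuousAt
  have hint : Integrable fun k : ℝ => G k := by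
    refine isBigO_inv_sq_integrable hcont (C := C) (R := R) fun k hk => ?_
    have := hG k (by simp) (by simpa using hk)
    simpa using this
  refine ⟨hint, ?_⟩
  have hlim := intervalIntegral_tendsto_integral hint tendsto_neg_atTop_atBot tendsto_id
  refine tendsto_nhds_unique hlim ?_
  rw [tendsto_zero_iff_norm_tendsto_zero]
  have hC : Tendsto (fun T : ℝ => 4 * |C| * T⁻¹) atTop (𝓝 0) := by
    simpa using tendsto_inv_atTop_zero.const_mul (4 * |C|)
  refine squeeze_zero' (Eventually.of_forall fun T => norm_nonneg _) ?_ hC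
  filter_upwards [eventually_ge_atTop R, eventually_gt_atTop 0] with T hT hT0
  -- Rectangle [-T, T] × [0, T]: the three sides off the real line have total length 4T and the
  -- integrand there is at most |C|/T², which gives 4|C|/T.
  have hrect := Complex.integral_boundary_rect_eq_zero_of_differentiableOn G (-T : ℝ)
    ((T : ℝ) + (T : ℝ) * Complex.I) (by
      intro w hw
      refine (hd w ?_).differentiableWithinAt
      have := hw.2
      simp [uIcc_of_le hT0.le] at this
      exact this.1)
  simp only [Complex.ofReal_re, Complex.ofReal_im, Complex.add_re, Complex.mul_re, Complex.I_re,
    mul_zero, Complex.I_im, mul_one, sub_self, add_zero, Complex.add_im, Complex.mul_im, zero_add,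
    Complex.ofReal_zero, zero_mul] at hrect
  have hb : ∀ w : ℂ, 0 ≤ w.im → T ≤ ‖w‖ → ‖G w‖ ≤ |C| / T ^ 2 := by
    intro w hw hTw
    refine (hG w hw (hT.trans hTw)).trans ?_
    gcongr
    exact le_abs_self C
  have b1 : ‖∫ x : ℝ in (-T)..T, G (x + T * Complex.I)‖ ≤ |C| / T ^ 2 * |T - -T| := by
    refine intervalIntegral.norm_integral_le_of_norm_le_const fun x _ => hb _ (by simp [hT0.le]) ?_
    have := Complex.abs_im_le_norm ((x : ℂ) + T * Complex.I)
    simpa [abs_of_pos hT0] using this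
  have b2 : ‖∫ y : ℝ in (0 : ℝ)..T, G (T + y * Complex.I)‖ ≤ |C| / T ^ 2 * |T - 0| := by
    refine intervalIntegral.norm_integral_le_of_norm_le_const fun y hy => hb _ ?_ ?_
    · rw [uIoc_of_le hT0.le] at hy; simp [hy.1.le]
    · have := Complex.abs_re_le_norm ((T : ℂ) + y * Complex.I)
      simpa [abs_of_pos hT0] using this
  have b3 : ‖∫ y : ℝ in (0 : ℝ)..T, G ((-T : ℝ) + y * Complex.I)‖ ≤ |C| / T ^ 2 * |T - 0| := by
    refine intervalIntegral.norm_integral_le_of_norm_le_const fun y hy => hb _ ?_ ?_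
    · rw [uIoc_of_le hT0.le] at hy; simp [hy.1.le]
    · have := Complex.abs_re_le_norm (((-T : ℝ) : ℂ) + y * Complex.I)
      simpa [abs_of_pos hT0] using this
  have e : ∫ x : ℝ in (-T)..T, G x = (∫ x : ℝ in (-T)..T, G (x + T * Complex.I)) -
      Complex.I • (∫ y : ℝ in (0 : ℝ)..T, G (T + y * Complex.I)) +
      Complex.I • ∫ y : ℝ in (0 : ℝ)..T, G ((-T : ℝ) + y * Complex.I) := by
    linear_combination hrect
  simp only [id]
  rw [e]
  refine (norm_add_le _ _).trans ((add_le_add (norm_sub_le _ _) le_rfl).trans ?_)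
  rw [norm_smul, norm_smul, Complex.norm_I, one_mul, one_mul]
  refine (add_le_add (add_le_add b1 b2) b3).trans (le_of_eq ?_)
  rw [sub_neg_eq_add, sub_zero, abs_of_pos hT0, abs_of_pos (by linarith : 0 < T + T)]
  field_simp
  ring

theorem integral_poisson_kernel (u : ℝ) {v : ℝ} (hv : 0 < v) :
    Integrable (fun k : ℝ => v / ((k - u) ^ 2 + v ^ 2)) ∧
      ∫ k : ℝ, v / ((k - u) ^ 2 + v ^ 2) = Real.pi := by
  have e : ∀ k : ℝ, v / ((k - u) ^ 2 + v ^ 2) = v⁻¹ * (1 + ((k - u) / v) ^ 2)⁻¹ := fun k => by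
    field_simp
    ring
  simp only [e]
  have h1 : Integrable fun k : ℝ => (1 + (k / v) ^ 2)⁻¹ := integrable_inv_one_add_sq.comp_div hv.ne'
  refine ⟨(h1.comp_sub_right u).const_mul _, ?_⟩
  rw [integral_const_mul, integral_sub_right_eq_self (fun k => (1 + (k / v) ^ 2)⁻¹) u,
    Measure.integral_comp_div (fun k => (1 + k ^ 2)⁻¹) v, integral_univ_inv_one_add_sq,
    abs_of_pos hv, smul_eq_mul, ← mul_assoc, inv_mul_cancel₀ hv.ne', one_mul]

/-- Write 1/(k² - κ²) as (2κ)⁻¹ times 2i times the Poisson kernel, whose integral is π, plus a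
multiple of 1/((k - κ̄)(k + κ)). The latter has both poles in the lower half-plane, so it integrates
to zero. -/
theorem integral_inv_sq_sub_sq {κ : ℂ} (hκ : 0 < κ.im) :
    Integrable (fun k : ℝ => ((k : ℂ) ^ 2 - κ ^ 2)⁻¹) ∧
      ∫ k : ℝ, ((k : ℂ) ^ 2 - κ ^ 2)⁻¹ = Real.pi * Complex.I / κ := by
  have hκ0 : κ ≠ 0 := fun h => by simp [h] at hκ
  have hne1 : ∀ w : ℂ, 0 ≤ w.im → w - conj κ ≠ 0 := fun w hw h => by
    have := congrArg Complex.im h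
    simp at this; linarith
  have hne2 : ∀ w : ℂ, 0 ≤ w.im → w + κ ≠ 0 := fun w hw h => by
    have := congrArg Complex.im h
    simp at this; linarith
  have hne3 : ∀ k : ℝ, (k : ℂ) - κ ≠ 0 := fun k h => by
    have := congrArg Complex.im h
    simp at this; linarith
  obtain ⟨i1, h1⟩ := integral_eq_zero_of_differentiableOn_upperHalfPlane
    (G := fun w => ((w - conj κ) * (w + κ))⁻¹) (C := 4) (R := 2 * ‖κ‖)
    (fun w hw => by
      have := mul_ne_zero (hne1 w hw) (hne2 w hw)
      exact DifferentiableAt.inv (by fun_prop) this)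
    (fun w hw hR => by
      have n1 := norm_sub_norm_le w (conj κ)
      have n2 := norm_sub_le_norm_add w κ
      rw [RCLike.norm_conj] at n1
      have hκn : 0 < ‖κ‖ := norm_pos_iff.2 hκ0
      rw [norm_inv, norm_mul, inv_eq_one_div]
      rw [div_le_div_iff₀ (mul_pos (norm_pos_iff.2 (hne1 w hw)) (norm_pos_iff.2 (hne2 w hw)))
        (by nlinarith)]
      have : ‖w‖ / 2 * (‖w‖ / 2) ≤ ‖w - conj κ‖ * ‖w + κ‖ := by
        gcongr <;> linarith
      linarith)
  obtain ⟨i2, h2⟩ := integral_poisson_kernel κ.re hκ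
  have e : ∀ k : ℝ, ((k : ℂ) ^ 2 - κ ^ 2)⁻¹ = (2 * κ)⁻¹ *
      (2 * Complex.I * ((κ.im / ((k - κ.re) ^ 2 + κ.im ^ 2) : ℝ) : ℂ) +
        (κ + conj κ) * (((k : ℂ) - conj κ) * (k + κ))⁻¹) := by
    intro k
    have hk : (0 : ℝ) ≤ (k : ℂ).im := by simp
    have c1 := hne1 k hk
    have c2 := hne2 k hk
    have c3 := hne3 k
    have c4 : (((k - κ.re) ^ 2 + κ.im ^ 2 : ℝ) : ℂ) = (k - κ) * (k - conj κ) := by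
      apply Complex.ext
      · rw [Complex.ofReal_re]; simp; ring
      · rw [Complex.ofReal_im]; simp; ring
    have c5 : 2 * Complex.I * (κ.im : ℂ) = κ - conj κ := by
      apply Complex.ext
      · simp
      · simp; ring
    have c6 : (k : ℂ) ^ 2 - κ ^ 2 = (k - κ) * (k + κ) := by ring
    rw [Complex.ofReal_div, c4, mul_div_assoc', c5, c6]
    field_simp
    ring
  have i2' : Integrable fun k : ℝ => ((κ.im / ((k - κ.re) ^ 2 + κ.im ^ 2) : ℝ) : ℂ) := i2.ofReal
  have i3 := i2'.const_mul (2 * Complex.I)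
  have i4 := i1.const_mul (κ + conj κ)
  simp only [e]
  refine ⟨(i3.add i4).const_mul _, ?_⟩
  rw [integral_const_mul, integral_add i3 i4, integral_const_mul, integral_const_mul, h1,
    integral_complex_ofReal, h2]
  field_simp
  ring

/-- Cauchy's formula for the upper half-plane. -/
theorem integral_div_sq_sub_sq {F : ℂ → ℂ} {η B : ℝ} (hη : 0 < η)
    (hd : DifferentiableOn ℂ F {w | -η < w.im}) (hB : ∀ w : ℂ, 0 ≤ w.im → ‖F w‖ ≤ B) {κ : ℂ}
    (hκ : 0 < κ.im) :
    ∫ k : ℝ, F k * ((k : ℂ) ^ 2 - κ ^ 2)⁻¹ = Real.pi * Complex.I / κ * F κ := by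
  have hopen : IsOpen {w : ℂ | -η < w.im} := isOpen_lt continuous_const Complex.continuous_im
  -- Subtracting F(κ) removes the pole at κ: the difference quotient over w + κ is holomorphic in
  -- the closed half-plane and decays like ‖w‖⁻². The constant F(κ) is handled by the explicit
  -- integral.
  have hds : DifferentiableOn ℂ (dslope F κ) {w | -η < w.im} := by
    rw [Complex.differentiableOn_dslope (hopen.mem_nhds (by simp only [mem_ofPred_eq]; linarith))]
    exact hd
  have hB0 : 0 ≤ B := (norm_nonneg _).trans (hB κ hκ.le)
  have hκn : 0 < ‖κ‖ := norm_pos_iff.2 fun h => by simp [h] at hκ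
  have hne2 : ∀ w : ℂ, 0 ≤ w.im → w + κ ≠ 0 := fun w hw h => by
    have := congrArg Complex.im h
    simp at this; linarith
  have hform : ∀ w : ℂ, w ≠ κ → w + κ ≠ 0 →
      dslope F κ w * (w + κ)⁻¹ = (F w - F κ) * (w ^ 2 - κ ^ 2)⁻¹ := by
    intro w hw hw2
    have hw' : w - κ ≠ 0 := sub_ne_zero.2 hw
    have : w ^ 2 - κ ^ 2 = (w - κ) * (w + κ) := by ring
    rw [dslope_of_ne _ hw, slope_def_field, this]
    field_simp
  obtain ⟨i1, h1⟩ := integral_eq_zero_of_differentiableOn_upperHalfPlane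
    (G := fun w => dslope F κ w * (w + κ)⁻¹) (C := 4 * B) (R := 2 * ‖κ‖)
    (fun w hw => by
      refine (hds.differentiableAt (hopen.mem_nhds (by simp only [mem_ofPred_eq]; linarith))).mul
        (DifferentiableAt.inv (by fun_prop) (hne2 w hw)))
    (fun w hw hR => by
      have hwκ : w ≠ κ := fun h => by rw [h] at hR; linarith
      rw [hform w hwκ (hne2 w hw), norm_mul, norm_inv, ← div_eq_mul_inv]
      have n1 := norm_sq_sub_sq_ge hR
      have hw0 : 0 < ‖w‖ := by linarith
      rw [div_le_div_iff₀ (by nlinarith) (by positivity)]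
      have n2 : ‖F w - F κ‖ ≤ 2 * B := (norm_sub_le _ _).trans (by linarith [hB w hw, hB κ hκ.le])
      calc ‖F w - F κ‖ * ‖w‖ ^ 2 ≤ 2 * B * ‖w‖ ^ 2 := by gcongr
        _ = 4 * B * (‖w‖ ^ 2 / 2) := by ring
        _ ≤ _ := by gcongr)
  obtain ⟨i2, h2⟩ := integral_inv_sq_sub_sq hκ
  have e : ∀ k : ℝ, F k * ((k : ℂ) ^ 2 - κ ^ 2)⁻¹ =
      dslope F κ k * ((k : ℂ) + κ)⁻¹ + F κ * ((k : ℂ) ^ 2 - κ ^ 2)⁻¹ := by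
    intro k
    have hk : (0 : ℝ) ≤ (k : ℂ).im := by simp
    rw [hform k (fun h => by have := congrArg Complex.im h; simp at this; linarith) (hne2 k hk)]
    ring
  simp only [e]
  rw [integral_add i1 (i2.const_mul _), h1, integral_const_mul, h2]
  ring

/-- Cauchy's formula for a bounded holomorphic function in terms of its boundary values. -/
theorem integral_boundary_div_sq_sub_sq {F : ℂ → ℂ} {B : ℝ}
    (hd : DifferentiableOn ℂ F {w | 0 < w.im}) (hB : ∀ w : ℂ, 0 < w.im → ‖F w‖ ≤ B)
    {m : ℝ → ℂ} (hm : ∀ᵐ k : ℝ, Tendsto (fun η : ℝ => F (k + η * Complex.I)) (𝓝[>] 0) (𝓝 (m k)))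
    {κ : ℂ} (hκ : 0 < κ.im) :
    ∫ k : ℝ, m k * ((k : ℂ) ^ 2 - κ ^ 2)⁻¹ = Real.pi * Complex.I / κ * F κ := by
  have hopen : IsOpen {w : ℂ | 0 < w.im} := isOpen_lt continuous_const Complex.continuous_im
  have hFc : ∀ η : ℝ, 0 < η → Continuous fun k : ℝ => F (k + η * Complex.I) := by
    intro η hη
    refine hd.continuousOn.comp_continuous (by fun_prop) fun k => ?_
    simpa using hη
  -- F(· + iη) is holomorphic across the real line, so the previous formula applies. The limit η → 0
  -- is dominated by B/|k² - κ²|.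
  have hshift : ∀ η : ℝ, 0 < η → ∫ k : ℝ, F (k + η * Complex.I) * ((k : ℂ) ^ 2 - κ ^ 2)⁻¹ =
      Real.pi * Complex.I / κ * F (κ + η * Complex.I) := by
    intro η hη
    refine integral_div_sq_sub_sq (F := fun w => F (w + η * Complex.I)) (B := B) hη ?_ ?_ hκ
    · refine hd.comp (by fun_prop) fun w hw => ?_
      have hw : -η < w.im := hw
      simp; linarith
    · intro w hw
      exact hB _ (by simp; linarith)
  obtain ⟨i2, -⟩ := integral_inv_sq_sub_sq hκ
  have l1 : Tendsto (fun η : ℝ => ∫ k : ℝ, F (k + η * Complex.I) * ((k : ℂ) ^ 2 - κ ^ 2)⁻¹)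
      (𝓝[>] 0) (𝓝 (∫ k : ℝ, m k * ((k : ℂ) ^ 2 - κ ^ 2)⁻¹)) := by
    refine tendsto_integral_filter_of_dominated_convergence
      (fun k => B * ‖((k : ℂ) ^ 2 - κ ^ 2)⁻¹‖) ?_ ?_ (i2.norm.const_mul B) ?_
    · filter_upwards [self_mem_nhdsWithin] with η hη
      exact (hFc η hη).aestronglyMeasurable.mul i2.aestronglyMeasurable
    · filter_upwards [self_mem_nhdsWithin] with η hη
      refine ae_of_all _ fun k => ?_
      rw [norm_mul]
      gcongr
      exact hB _ (by simpa using hη)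
    · filter_upwards [hm] with k hk
      exact hk.mul_const _
  have l2 : Tendsto (fun η : ℝ => Real.pi * Complex.I / κ * F (κ + η * Complex.I)) (𝓝[>] 0)
      (𝓝 (Real.pi * Complex.I / κ * F κ)) := by
    have h1 : ContinuousAt (fun η : ℝ => F (κ + η * Complex.I)) 0 := by
      refine ContinuousAt.comp (f := fun η : ℝ => κ + η * Complex.I) (g := F) ?_ (by fun_prop)
      refine (hd.differentiableAt (hopen.mem_nhds ?_)).continuousAt
      simpa using hκ
    have h2 := h1.tendsto.mono_left (nhdsWithin_le_nhds (s := Ioi 0))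
    simp only [Complex.ofReal_zero, zero_mul, add_zero] at h2
    exact h2.const_mul _
  refine tendsto_nhds_unique l1 (l2.congr' ?_)
  filter_upwards [self_mem_nhdsWithin] with η hη
  exact (hshift η hη).symm

end HalfPlane

/-! ### Fourier–Laplace transforms of integrable functions -/

section ExpTransform

open Filter Topology Set

variable {X : Type*} [MeasurableSpace X] {μ : Measure X} {p : X → ℝ} {F : X → ℂ}

/-- The Fourier–Laplace transform `κ ↦ ∫ F e^{iκp} dμ`. -/
def expTransform (μ : Measure X) (p : X → ℝ) (F : X → ℂ) (κ : ℂ) : ℂ :=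
  ∫ x, F x * Complex.exp (Complex.I * κ * p x) ∂μ

theorem norm_exp_I_mul_le_one {κ : ℂ} (hκ : 0 ≤ κ.im) {s : ℝ} (hs : 0 ≤ s) :
    ‖Complex.exp (Complex.I * κ * s)‖ ≤ 1 := by
  rw [Complex.norm_exp, Real.exp_le_one_iff]
  simp
  positivity

theorem aestronglyMeasurable_expTransform (hF : Integrable F μ) (hp : Measurable p) (κ : ℂ) :
    AEStronglyMeasurable (fun x => F x * Complex.exp (Complex.I * κ * p x)) μ :=
  hF.aestronglyMeasurable.mul (Measurable.aestronglyMeasurable (by fun_prop))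

theorem norm_expTransform_integrand_le {X : Type*} {p : X → ℝ} {F : X → ℂ} (hp0 : ∀ x, 0 ≤ p x)
    {κ : ℂ} (hκ : 0 ≤ κ.im) (x : X) :
    ‖F x * Complex.exp (Complex.I * κ * p x)‖ ≤ ‖F x‖ := by
  rw [norm_mul]
  exact mul_le_of_le_one_right (norm_nonneg _) (norm_exp_I_mul_le_one hκ (hp0 x))

theorem norm_expTransform_le (hF : Integrable F μ) (hp0 : ∀ x, 0 ≤ p x) {κ : ℂ} (hκ : 0 ≤ κ.im) :
    ‖expTransform μ p F κ‖ ≤ ∫ x, ‖F x‖ ∂μ :=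
  norm_integral_le_of_norm_le hF.norm (ae_of_all _ (norm_expTransform_integrand_le hp0 hκ))

theorem continuousOn_expTransform (hF : Integrable F μ) (hp : Measurable p) (hp0 : ∀ x, 0 ≤ p x) :
    ContinuousOn (expTransform μ p F) {κ | 0 ≤ κ.im} := by
  refine continuousOn_of_dominated (bound := fun x => ‖F x‖)
    (fun κ _ => aestronglyMeasurable_expTransform hF hp κ)
    (fun κ hκ => ae_of_all _ (norm_expTransform_integrand_le hp0 hκ)) hF.norm
    (ae_of_all _ fun x => ?_)
  fun_prop

theorem differentiableOn_expTransform (hF : Integrable F μ) (hp : Measurable p)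
    (hp0 : ∀ x, 0 ≤ p x) : DifferentiableOn ℂ (expTransform μ p F) {κ | 0 < κ.im} := by
  intro κ hκ
  have hκ : 0 < κ.im := hκ
  have him : ∀ w ∈ Metric.ball κ (κ.im / 2), κ.im / 2 < w.im := by
    intro w hw
    have h1 := Complex.abs_im_le_norm (w - κ)
    rw [Metric.mem_ball, dist_eq_norm] at hw
    have h2 := (abs_lt.1 (h1.trans_lt hw)).1
    simp at h2
    linarith
  -- On this ball Im w > Im κ/2, and s e^{-s} ≤ 1 bounds p e^{-p Im w} by 2/Im κ, uniformly in p.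
  have hbd : ∀ x, ∀ w ∈ Metric.ball κ (κ.im / 2),
      ‖F x * (Complex.exp (Complex.I * w * p x) * (Complex.I * p x))‖ ≤ ‖F x‖ * (2 / κ.im) := by
    intro x w hw
    rw [norm_mul]
    gcongr
    rw [norm_mul, Complex.norm_exp, norm_mul, Complex.norm_I, one_mul, Complex.norm_real,
      Real.norm_of_nonneg (hp0 x)]
    have e : (Complex.I * w * p x).re = -(w.im * p x) := by simp
    rw [e, Real.exp_neg, inv_mul_le_iff₀ (Real.exp_pos _)]
    have h1 := him w hw
    have h2 := Real.add_one_le_exp (w.im * p x)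
    have h3 : κ.im / 2 * p x ≤ w.im * p x := by
      gcongr; exact hp0 x
    have h4 : p x = κ.im / 2 * p x * (2 / κ.im) := by field_simp
    have h5 : 0 ≤ 2 / κ.im := by positivity
    nlinarith
  have := hasDerivAt_integral_of_dominated_loc_of_deriv_le (μ := μ) (𝕜 := ℂ) (x₀ := κ)
    (F := fun w x => F x * Complex.exp (Complex.I * w * p x))
    (F' := fun w x => F x * (Complex.exp (Complex.I * w * p x) * (Complex.I * p x)))
    (bound := fun x => ‖F x‖ * (2 / κ.im)) (s := Metric.ball κ (κ.im / 2))
    (Metric.ball_mem_nhds κ (by positivity))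
    (Eventually.of_forall fun w => aestronglyMeasurable_expTransform hF hp w)
    (hF.norm.mono' (aestronglyMeasurable_expTransform hF hp κ)
      (ae_of_all _ (norm_expTransform_integrand_le hp0 hκ.le)))
    (hF.aestronglyMeasurable.mul (Measurable.aestronglyMeasurable (by fun_prop)))
    (ae_of_all _ hbd) (hF.norm.mul_const _)
    (ae_of_all _ fun x w _ => by
      have h1 : HasDerivAt (fun w : ℂ => Complex.I * w * p x) (Complex.I * p x) w := by
        have := ((hasDerivAt_id w).const_mul Complex.I).mul_const (p x : ℂ)
        simpa using this
      exact (h1.cexp).const_mul _)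
  exact this.2.differentiableAt.differentiableWithinAt

end ExpTransform

/-! ### Boundedness and analytic extension of the resolvent form -/

section SpectralFunction

open Filter Topology Set

variable {a α : ℝ}

/-- `2κ` times the integral kernel of the resolvent `(H_α - κ²)⁻¹`. -/
def spectralKernel (a α : ℝ) (κ : ℂ) (p : ℝ × ℝ) : ℂ :=
  Complex.I * expKernel κ p.2 p.1 +
    (α / (2 * parityDenom a α 1 κ) * (parityWave a 1 κ p.1 * parityWave a 1 κ p.2) +
     α / (2 * parityDenom a α (-1) κ) * (parityWave a (-1) κ p.1 * parityWave a (-1) κ p.2))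

/-- The quadratic form of `spectralKernel`. -/
def spectralFun (a α : ℝ) (f : ℝ → ℂ) (κ : ℂ) : ℂ :=
  ∫ p, conj (f p.1) * f p.2 * spectralKernel a α κ p ∂(volume.prod volume)

/-- The pairing of `f` with the wave of parity `σ`. -/
def waveTransform (a σ : ℝ) (f : ℝ → ℂ) (κ : ℂ) : ℂ := ∫ y, parityWave a σ κ y * f y

theorem expPotential_eq_expTransform (κ : ℂ) (f : ℝ → ℂ) (c : ℝ) :
    expPotential κ f c = expTransform volume (fun y => |c - y|) f κ := by
  rw [expPotential, expTransform]
  refine integral_congr_ae (ae_of_all _ fun y => ?_)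
  simp only [expKernel]; ring

theorem waveTransform_eq (a σ : ℝ) {f : ℝ → ℂ} (hf : Integrable f) {κ : ℂ} (hκ : 0 ≤ κ.im) :
    waveTransform a σ f κ = expTransform volume (fun y => |a - y|) f κ +
      σ * expTransform volume (fun y => |-a - y|) f κ := by
  rw [waveTransform, integral_parityWave_mul a σ hκ hf, expPotential_eq_expTransform,
    expPotential_eq_expTransform]

theorem continuousOn_waveTransform (a σ : ℝ) {f : ℝ → ℂ} (hf : Integrable f) :
    ContinuousOn (waveTransform a σ f) {κ | 0 ≤ κ.im} := by
  have h1 := continuousOn_expTransform hf (p := fun y => |a - y|) (by fun_prop)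
    (fun _ => abs_nonneg _)
  have h2 := continuousOn_expTransform hf (p := fun y => |-a - y|) (by fun_prop)
    (fun _ => abs_nonneg _)
  exact (h1.add (h2.const_smul (σ : ℂ))).congr fun κ hκ => waveTransform_eq a σ hf hκ

theorem differentiableOn_waveTransform (a σ : ℝ) {f : ℝ → ℂ} (hf : Integrable f) :
    DifferentiableOn ℂ (waveTransform a σ f) {κ | 0 < κ.im} := by
  have h1 := differentiableOn_expTransform hf (p := fun y => |a - y|) (by fun_prop)
    (fun _ => abs_nonneg _)
  have h2 := differentiableOn_expTransform hf (p := fun y => |-a - y|) (by fun_prop)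
    (fun _ => abs_nonneg _)
  exact (h1.add (h2.const_smul (σ : ℂ))).congr fun κ hκ => waveTransform_eq a σ hf (le_of_lt hκ)

theorem norm_parityWave_le (a : ℝ) {σ : ℝ} (hσ : |σ| = 1) {κ : ℂ} (hκ : 0 ≤ κ.im) (x : ℝ) :
    ‖parityWave a σ κ x‖ ≤ 2 := by
  rw [parityWave]
  refine (norm_add_le _ _).trans ?_
  rw [norm_mul, Complex.norm_real, Real.norm_eq_abs, hσ, one_mul]
  linarith [norm_expKernel_le_one hκ a x, norm_expKernel_le_one hκ (-a) x]

theorem norm_waveTransform_le (a : ℝ) {σ : ℝ} (hσ : |σ| = 1) {f : ℝ → ℂ} (hf : Integrable f)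
    {κ : ℂ} (hκ : 0 ≤ κ.im) : ‖waveTransform a σ f κ‖ ≤ 2 * ∫ x, ‖f x‖ := by
  rw [waveTransform, ← integral_const_mul]
  refine norm_integral_le_of_norm_le (hf.norm.const_mul 2) (ae_of_all _ fun x => ?_)
  rw [norm_mul]
  gcongr
  exact norm_parityWave_le a hσ hκ x

theorem norm_exp_sub_exp_le {κ : ℂ} (hκ : 0 ≤ κ.im) {s t : ℝ} (hs : 0 ≤ s) (ht : 0 ≤ t) :
    ‖Complex.exp (Complex.I * κ * s) - Complex.exp (Complex.I * κ * t)‖ ≤ ‖κ‖ * |s - t| := by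
  have hd : ∀ x ∈ Ici (0 : ℝ), HasDerivWithinAt (fun x : ℝ => Complex.exp (Complex.I * κ * x))
      (Complex.exp (Complex.I * κ * x) * (Complex.I * κ)) (Ici 0) x := by
    intro x _
    have := ((Complex.ofRealCLM.hasDerivAt (x := x)).const_mul (Complex.I * κ)).cexp
    simp only [Complex.ofRealCLM_apply, Complex.ofReal_one, mul_one] at this
    exact this.hasDerivWithinAt
  have := (convex_Ici (0 : ℝ)).norm_image_sub_le_of_norm_hasDerivWithin_le hd (C := ‖κ‖)
    (fun x hx => by
      rw [norm_mul, norm_mul, Complex.norm_I, one_mul]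
      exact mul_le_of_le_one_left (norm_nonneg _) (norm_exp_I_mul_le_one hκ hx)) ht hs
  simpa using this

/-- The odd wave is a difference of exponentials whose arguments |x - a| and |x + a| differ by at
most 2a. Its first-order vanishing at κ = 0, uniform in x, compensates for the zero of D₋. -/
theorem norm_parityWave_odd_le (ha : 0 < a) {κ : ℂ} (hκ : 0 ≤ κ.im) (x : ℝ) :
    ‖parityWave a (-1) κ x‖ ≤ 2 * a * ‖κ‖ := by
  have e : parityWave a (-1) κ x = Complex.exp (Complex.I * κ * (|x - a| : ℝ)) -
      Complex.exp (Complex.I * κ * (|x - -a| : ℝ)) := by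
    simp only [parityWave, expKernel]; push_cast; ring
  rw [e]
  refine (norm_exp_sub_exp_le hκ (abs_nonneg _) (abs_nonneg _)).trans ?_
  have h1 := abs_abs_sub_abs_le_abs_sub (x - a) (x - -a)
  have h2 : |x - a - (x - -a)| = 2 * a := by
    rw [show x - a - (x - -a) = -(2 * a) by ring, abs_neg, abs_of_pos (by linarith)]
  rw [h2] at h1
  calc ‖κ‖ * _ ≤ ‖κ‖ * (2 * a) := by gcongr
    _ = _ := by ring

theorem norm_waveTransform_odd_le (ha : 0 < a) {f : ℝ → ℂ} (hf : Integrable f)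
    {κ : ℂ} (hκ : 0 ≤ κ.im) : ‖waveTransform a (-1) f κ‖ ≤ 2 * a * ‖κ‖ * ∫ x, ‖f x‖ := by
  rw [waveTransform, ← integral_const_mul]
  refine norm_integral_le_of_norm_le (hf.norm.const_mul _) (ae_of_all _ fun x => ?_)
  rw [norm_mul]
  gcongr
  exact norm_parityWave_odd_le ha hκ x

theorem differentiable_parityDenom (a α σ : ℝ) : Differentiable ℂ (parityDenom a α σ) :=
  fun κ => (hasDerivAt_parityDenom a α σ κ).differentiableAt

/-- The contribution of the waves of parity `σ`. -/
def parityTerm (a α σ : ℝ) (f g : ℝ → ℂ) (κ : ℂ) : ℂ :=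
  α / (2 * parityDenom a α σ κ) * (waveTransform a σ f κ * waveTransform a σ g κ)

/-- For σ = 1, D₊(0) = 2iα is nonzero unless α = 0, when the term vanishes. For σ = -1, D₋(0) = 0
with D₋'(0) = 2(1 + aα); since aα ≠ -1 the denominator is of exact order κ, while each of the two
odd transforms is O(κ). -/
theorem exists_bound_parityTerm_near_zero (ha : 0 < a) (haα : a * α ≠ -1) {σ : ℝ}
    (hσ : σ = 1 ∨ σ = -1) {f g : ℝ → ℂ} (hf : Integrable f) (hg : Integrable g) :
    ∃ r > 0, ∃ B, ∀ κ : ℂ, 0 ≤ κ.im → ‖κ‖ < r → ‖parityTerm a α σ f g κ‖ ≤ B := by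
  set Nf := ∫ x, ‖f x‖
  set Ng := ∫ x, ‖g x‖
  have hNf : 0 ≤ Nf := integral_nonneg fun _ => norm_nonneg _
  have hNg : 0 ≤ Ng := integral_nonneg fun _ => norm_nonneg _
  rcases hσ with rfl | rfl
  · by_cases hα : α = 0
    · exact ⟨1, one_pos, 0, fun κ _ _ => by simp [parityTerm, hα]⟩
    have h0 : parityDenom a α 1 0 = 2 * Complex.I * α := by
      simp [parityDenom]; ring
    have hev : ∀ᶠ κ in 𝓝 (0 : ℂ), |α| < ‖parityDenom a α 1 κ‖ := by
      have hc : ContinuousAt (fun κ => ‖parityDenom a α 1 κ‖) 0 :=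
        (differentiable_parityDenom a α 1 0).continuousAt.norm
      refine hc.eventually (lt_mem_nhds ?_)
      beta_reduce
      rw [h0]
      have := abs_pos.2 hα
      simp
      linarith
    obtain ⟨r, hr, hrb⟩ := Metric.eventually_nhds_iff.1 hev
    refine ⟨r, hr, 2 * Nf * Ng, fun κ hκ hκr => ?_⟩
    have h1 := hrb (y := κ) (by simpa using hκr)
    have hαp := abs_pos.2 hα
    rw [parityTerm, norm_mul, norm_mul, norm_div, norm_mul, Complex.norm_ofNat, Complex.norm_real,
      Real.norm_eq_abs]
    calc |α| / (2 * ‖parityDenom a α 1 κ‖) * _ ≤ |α| / (2 * |α|) * ((2 * Nf) * (2 * Ng)) := by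
          gcongr
          · exact norm_waveTransform_le a (by simp) hf hκ
          · exact norm_waveTransform_le a (by simp) hg hκ
      _ = 2 * Nf * Ng := by field_simp
  · have h0 : parityDenom a α (-1) 0 = 0 := by simp [parityDenom]
    have hd := hasDerivAt_parityDenom a α (-1) 0
    set c := |1 + a * α| with hc
    have hcp : 0 < c := abs_pos.2 fun h => haα (by linarith)
    have hd' : (2 - 2 * a * α * ((-1 : ℝ) : ℂ) * Complex.exp (2 * Complex.I * 0 * a)) =
        ((2 * (1 + a * α) : ℝ) : ℂ) := by
      push_cast
      rw [mul_zero, zero_mul, Complex.exp_zero]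
      ring
    rw [hd'] at hd
    rw [hasDerivAt_iff_isLittleO, Asymptotics.isLittleO_iff] at hd
    obtain ⟨r, hr, hrb⟩ := Metric.eventually_nhds_iff.1 (hd hcp)
    refine ⟨min r 1, by positivity, 2 * |α| * a ^ 2 * Nf * Ng / c, fun κ hκ hκr => ?_⟩
    have hκr1 := hκr.trans_le (min_le_left _ _)
    have hκ1 := hκr.trans_le (min_le_right _ _)
    have h1 := hrb (y := κ) (by simpa using hκr1)
    rw [h0, sub_zero, sub_zero, smul_eq_mul] at h1
    -- The linear part has modulus 2c‖κ‖ and the differentiability error was chosen at most c‖κ‖.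
    have h2 : c * ‖κ‖ ≤ ‖parityDenom a α (-1) κ‖ := by
      have h3 := norm_sub_norm_le (κ * ((2 * (1 + a * α) : ℝ) : ℂ)) (parityDenom a α (-1) κ)
      rw [norm_sub_rev, norm_mul, Complex.norm_real, Real.norm_eq_abs, abs_mul,
        abs_of_pos (by norm_num : (0 : ℝ) < 2), ← hc] at h3
      linarith
    by_cases hκ0 : κ = 0
    · rw [parityTerm, hκ0, h0]; simp; positivity
    have hκp : 0 < ‖κ‖ := norm_pos_iff.2 hκ0
    rw [parityTerm, norm_mul, norm_mul, norm_div, norm_mul, Complex.norm_ofNat, Complex.norm_real,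
      Real.norm_eq_abs]
    calc |α| / (2 * ‖parityDenom a α (-1) κ‖) * _ ≤
          |α| / (2 * (c * ‖κ‖)) * ((2 * a * ‖κ‖ * Nf) * (2 * a * ‖κ‖ * Ng)) := by
          gcongr
          · exact norm_waveTransform_odd_le ha hf hκ
          · exact norm_waveTransform_odd_le ha hg hκ
      _ = 2 * |α| * a ^ 2 * Nf * Ng / c * ‖κ‖ := by field_simp
      _ ≤ 2 * |α| * a ^ 2 * Nf * Ng / c := by
          refine mul_le_of_le_one_right (by positivity) hκ1.le

theorem norm_parityTerm_le_of_large (ha : 0 < a) {σ : ℝ}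
    (hσ : σ = 1 ∨ σ = -1) {f g : ℝ → ℂ} (hf : Integrable f) (hg : Integrable g) {κ : ℂ}
    (hκ : 0 ≤ κ.im) (h : |α| + 1 ≤ ‖κ‖) :
    ‖parityTerm a α σ f g κ‖ ≤ |α| * (∫ x, ‖f x‖) * ∫ x, ‖g x‖ := by
  have hσ1 : |σ| = 1 := by rcases hσ with h | h <;> simp [h]
  have h1 := (parityDenom_ne_zero_of_large hσ1.le ha hκ (by linarith : |α| < ‖κ‖)).1
  rw [parityTerm, norm_mul, norm_mul, norm_div, norm_mul, Complex.norm_ofNat, Complex.norm_real,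
    Real.norm_eq_abs]
  calc |α| / (2 * ‖parityDenom a α σ κ‖) * _ ≤
      |α| / (2 * 2) * ((2 * ∫ x, ‖f x‖) * (2 * ∫ x, ‖g x‖)) := by
        gcongr
        · linarith
        · exact norm_waveTransform_le a hσ1 hf hκ
        · exact norm_waveTransform_le a hσ1 hg hκ
    _ = _ := by ring

/-- If `g` annihilates the bound state, the singularity of `parityTerm` is removable. -/
theorem exists_extension_parityTerm (ha : 0 < a) (haα : a * α ≠ -1) {σ : ℝ}
    (hσ : σ = 1 ∨ σ = -1) {f g : ℝ → ℂ} (hf : Integrable f) (hg : Integrable g)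
    (hz : ∀ q : ℝ, 0 < q → parityDenom a α σ (Complex.I * q) = 0 →
      waveTransform a σ g (Complex.I * q) = 0) :
    ∃ T : ℂ → ℂ, DifferentiableOn ℂ T {w | 0 < w.im} ∧ (∃ B, ∀ w : ℂ, 0 < w.im → ‖T w‖ ≤ B) ∧
      ∀ w : ℂ, 0 ≤ w.im → parityDenom a α σ w ≠ 0 → T w = parityTerm a α σ f g w := by
  have hσ1 : |σ| = 1 := by rcases hσ with h | h <;> simp [h]
  have hcl : IsClosed {w : ℂ | 0 ≤ w.im} := isClosed_le continuous_const Complex.continuous_im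
  have hopen : IsOpen {w : ℂ | 0 < w.im} := isOpen_lt continuous_const Complex.continuous_im
  obtain ⟨r, hr, B₀, hB₀⟩ := exists_bound_parityTerm_near_zero ha haα hσ hf hg
  -- boundedness follows from continuity away from zero
  have hbound : ∀ T : ℂ → ℂ, ContinuousOn T ({w : ℂ | 0 ≤ w.im} \ {0}) →
      (∀ w : ℂ, 0 ≤ w.im → parityDenom a α σ w ≠ 0 → T w = parityTerm a α σ f g w) →
      (∃ r' > 0, ∀ w : ℂ, 0 < w.im → ‖w‖ < r' → parityDenom a α σ w ≠ 0) →
      ∃ B, ∀ w : ℂ, 0 < w.im → ‖T w‖ ≤ B := by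
    rintro T hT hTe ⟨r', hr', hne⟩
    set ρ := min r r' with hρ
    have hρ0 : 0 < ρ := lt_min hr hr'
    have hK : IsCompact ({w : ℂ | 0 ≤ w.im} ∩ (Metric.closedBall 0 (|α| + 1) \ Metric.ball 0 ρ)) :=
      ((isCompact_closedBall 0 _).diff Metric.isOpen_ball).inter_left hcl
    obtain ⟨B₁, hB₁⟩ := hK.exists_bound_of_continuousOn (hT.mono (by
      rintro w ⟨h1, -, h2⟩
      refine ⟨h1, fun h => h2 ?_⟩
      rw [show w = 0 from h]
      exact Metric.mem_ball_self hρ0))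
    refine ⟨max B₀ (max B₁ (|α| * (∫ x, ‖f x‖) * ∫ x, ‖g x‖)), fun w hw => ?_⟩
    by_cases h1 : ‖w‖ < ρ
    · rw [hTe w hw.le (hne w hw (h1.trans_le (min_le_right _ _)))]
      exact (hB₀ w hw.le (h1.trans_le (min_le_left _ _))).trans (le_max_left _ _)
    by_cases h2 : ‖w‖ ≤ |α| + 1
    · refine (hB₁ w ⟨hw.le, by simpa using h2, by simpa using h1⟩).trans ?_
      exact (le_max_left _ _).trans (le_max_right _ _)
    · push Not at h2
      rw [hTe w hw.le (parityDenom_ne_zero_of_large hσ1.le ha hw.le (by linarith)).2]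
      exact (norm_parityTerm_le_of_large ha hσ hf hg hw.le h2.le).trans
        ((le_max_right _ _).trans (le_max_right _ _))
  have hreal : ∀ w : ℂ, w.im = 0 → w ≠ 0 → parityDenom a α σ w ≠ 0 := by
    intro w hw hw0
    have e : w = (w.re : ℂ) := Complex.ext (by simp) (by simp [hw])
    rw [e] at hw0 ⊢
    exact parityDenom_real_ne_zero hσ1 (by exact_mod_cast hw0)
  have hDc := (differentiable_parityDenom a α σ).continuous
  rcases parityDenom_zeros ha α hσ with hno | ⟨q, hq, h0, hd0, huq⟩
  · refine ⟨parityTerm a α σ f g, ?_, ?_, fun _ _ _ => rfl⟩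
    · intro w hw
      refine DifferentiableWithinAt.mul ?_ (((differentiableOn_waveTransform a σ hf) w hw).mul
        ((differentiableOn_waveTransform a σ hg) w hw))
      refine (DifferentiableAt.div (by fun_prop)
        ((differentiable_parityDenom a α σ w).const_mul 2) ?_).differentiableWithinAt
      exact mul_ne_zero two_ne_zero (hno w hw)
    · refine hbound _ ?_ (fun _ _ _ => rfl) ⟨1, one_pos, fun w hw _ => hno w hw⟩
      refine ContinuousOn.mul ?_ (((continuousOn_waveTransform a σ hf).mono sdiff_subset).mul
        ((continuousOn_waveTransform a σ hg).mono sdiff_subset))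
      refine ContinuousOn.div (by fun_prop) (by fun_prop) ?_
      rintro w ⟨hw, hw0⟩
      refine mul_ne_zero two_ne_zero ?_
      rcases (show 0 ≤ w.im from hw).lt_or_eq with h | h
      · exact hno w h
      · exact hreal w h.symm hw0
  -- Both D_σ and the transform of g vanish at P. Dividing each by w - P through `dslope` gives T;
  -- since the zero of D_σ is simple and unique, the new denominator does not vanish in the open
  -- half-plane.
  · set P : ℂ := Complex.I * q with hP
    have hPim : 0 < P.im := by simpa [hP] using hq
    have hPn : {w : ℂ | 0 ≤ w.im} ∈ 𝓝 P :=
      mem_of_superset (hopen.mem_nhds hPim) fun w (hw : 0 < w.im) => show 0 ≤ w.im from hw.le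
    set N := waveTransform a σ g with hN
    have hN0 : N P = 0 := hz q hq h0
    have hdN : DifferentiableOn ℂ (dslope N P) {w | 0 < w.im} := by
      rw [Complex.differentiableOn_dslope (hopen.mem_nhds hPim)]
      exact differentiableOn_waveTransform a σ hg
    have hcN : ContinuousOn (dslope N P) {w | 0 ≤ w.im} := by
      rw [continuousOn_dslope hPn]
      exact ⟨continuousOn_waveTransform a σ hg,
        (differentiableOn_waveTransform a σ hg).differentiableAt (hopen.mem_nhds hPim)⟩
    have hdD : Differentiable ℂ (dslope (parityDenom a α σ) P) := by
      rw [← differentiableOn_univ, Complex.differentiableOn_dslope univ_mem, differentiableOn_univ]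
      exact differentiable_parityDenom a α σ
    have hslope : ∀ (u : ℂ → ℂ) (w : ℂ), u P = 0 → u w = (w - P) * dslope u P w := by
      intro u w hu
      have := sub_smul_dslope u P w
      rw [hu, sub_zero, smul_eq_mul] at this
      exact this.symm
    have hDne : ∀ w : ℂ, 0 ≤ w.im → w ≠ 0 → dslope (parityDenom a α σ) P w ≠ 0 := by
      intro w hw hw0
      by_cases hwP : w = P
      · rw [hwP, dslope_same]; exact hd0
      · intro h
        have h1 := hslope (parityDenom a α σ) w h0
        rw [h, mul_zero] at h1
        rcases hw.lt_or_eq with h2 | h2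
        · exact hwP (huq w h2 h1)
        · exact hreal w h2.symm hw0 h1
    set T : ℂ → ℂ := fun w => α / (2 * dslope (parityDenom a α σ) P w) *
      (waveTransform a σ f w * dslope N P w) with hT
    have hTe : ∀ w : ℂ, 0 ≤ w.im → parityDenom a α σ w ≠ 0 → T w = parityTerm a α σ f g w := by
      intro w hw hne
      have hwP : w - P ≠ 0 := fun h => hne (by rw [sub_eq_zero.1 h]; exact h0)
      have h1 := hslope (parityDenom a α σ) w h0
      have h2 := hslope N w hN0
      rw [h1] at hne
      have h3 := right_ne_zero_of_mul hne
      rw [hT, parityTerm, ← hN, h1, h2]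
      field_simp
    refine ⟨T, ?_, ?_, hTe⟩
    · intro w hw
      have hw' : 0 < w.im := hw
      refine DifferentiableWithinAt.mul ?_ (((differentiableOn_waveTransform a σ hf) w hw).mul
        (hdN w hw))
      refine (DifferentiableAt.div (by fun_prop) ((hdD w).const_mul 2) ?_).differentiableWithinAt
      exact mul_ne_zero two_ne_zero (hDne w hw'.le fun h => by simp [h] at hw')
    · refine hbound _ ?_ hTe ⟨q, hq, fun w hw hwq h => ?_⟩
      · refine ContinuousOn.mul ?_ (((continuousOn_waveTransform a σ hf).mono sdiff_subset).mul
          (hcN.mono sdiff_subset))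
        refine ContinuousOn.div (by fun_prop) (hdD.continuous.continuousOn.const_smul (2 : ℂ)) ?_
        rintro w ⟨hw, hw0⟩
        exact mul_ne_zero two_ne_zero (hDne w hw hw0)
      · rw [huq w hw h, hP, norm_mul, Complex.norm_I, one_mul, Complex.norm_real,
          Real.norm_of_nonneg hq.le] at hwq
        exact lt_irrefl _ hwq

end SpectralFunction

/-! ### Boundary values and the spectral density -/

section SpectralDensity

open Filter Topology Set

variable {a α : ℝ}

theorem continuous_spectralKernel (a α : ℝ) (κ : ℂ) : Continuous (spectralKernel a α κ) := by
  have h1 := continuous_expKernel κ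
  have h2 := continuous_parityWave a 1 κ
  have h3 := continuous_parityWave a (-1) κ
  unfold spectralKernel
  fun_prop

theorem norm_spectralKernel_le (a α : ℝ) {κ : ℂ} (hκ : 0 ≤ κ.im) (p : ℝ × ℝ) :
    ‖spectralKernel a α κ p‖ ≤ 1 + (‖α / (2 * parityDenom a α 1 κ)‖ * (2 * 2) +
      ‖α / (2 * parityDenom a α (-1) κ)‖ * (2 * 2)) := by
  refine (norm_add_le _ _).trans (add_le_add ?_ ((norm_add_le _ _).trans (add_le_add ?_ ?_)))
  · rw [norm_mul, Complex.norm_I, one_mul]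
    exact norm_expKernel_le_one hκ _ _
  · rw [norm_mul, norm_mul]
    gcongr
    · exact norm_parityWave_le a (by simp) hκ _
    · exact norm_parityWave_le a (by simp) hκ _
  · rw [norm_mul, norm_mul]
    gcongr
    · exact norm_parityWave_le a (by simp) hκ _
    · exact norm_parityWave_le a (by simp) hκ _

theorem integrable_conj_mul_prod {f : ℝ → ℂ} (hf : Integrable f) :
    Integrable (fun p : ℝ × ℝ => conj (f p.1) * f p.2) (volume.prod volume) :=
  Integrable.mul_prod (LinearIsometryEquiv.integrable_comp_iff Complex.conjLIE |>.2 hf) hf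

theorem integrable_spectralKernel (a α : ℝ) {f : ℝ → ℂ} (hf : Integrable f) {κ : ℂ}
    (hκ : 0 ≤ κ.im) :
    Integrable (fun p : ℝ × ℝ => conj (f p.1) * f p.2 * spectralKernel a α κ p)
      (volume.prod volume) :=
  (integrable_conj_mul_prod hf).mul_bdd (continuous_spectralKernel a α κ).aestronglyMeasurable
    (ae_of_all _ (norm_spectralKernel_le a α hκ))

theorem integral_parityWave_prod (a σ : ℝ) (f : ℝ → ℂ) (κ : ℂ) :
    ∫ p : ℝ × ℝ, conj (f p.1) * f p.2 * (parityWave a σ κ p.1 * parityWave a σ κ p.2)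
      ∂(volume.prod volume) = waveTransform a σ (fun x => conj (f x)) κ * waveTransform a σ f κ := by
  rw [waveTransform, waveTransform, ← integral_prod_mul]
  refine integral_congr_ae (ae_of_all _ fun p => ?_)
  simp only
  ring

/-- The waves enter the kernel as products in the two variables, so each parity contributes a
product of two transforms. This form is holomorphic off the zeros of D_σ, with singularities that
can be removed one parity at a time. -/
theorem spectralFun_eq (a α : ℝ) {f : ℝ → ℂ} (hf : Integrable f) {κ : ℂ} (hκ : 0 ≤ κ.im) :
    spectralFun a α f κ = Complex.I * expTransform (volume.prod volume)
        (fun p : ℝ × ℝ => |p.1 - p.2|) (fun p => conj (f p.1) * f p.2) κ +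
      (parityTerm a α 1 (fun x => conj (f x)) f κ +
        parityTerm a α (-1) (fun x => conj (f x)) f κ) := by
  have hw : ∀ σ : ℝ, |σ| = 1 → Integrable (fun p : ℝ × ℝ => conj (f p.1) * f p.2 *
      (parityWave a σ κ p.1 * parityWave a σ κ p.2)) (volume.prod volume) := by
    intro σ hσ
    have h2 := continuous_parityWave a σ κ
    refine (integrable_conj_mul_prod hf).mul_bdd (c := 2 * 2)
      (Continuous.aestronglyMeasurable (by fun_prop)) (ae_of_all _ fun p => ?_)
    rw [norm_mul]
    gcongr
    · exact norm_parityWave_le a hσ hκ _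
    · exact norm_parityWave_le a hσ hκ _
  have he : Integrable (fun p : ℝ × ℝ => conj (f p.1) * f p.2 * expKernel κ p.2 p.1)
      (volume.prod volume) :=
    (integrable_conj_mul_prod hf).mul_bdd (continuous_expKernel κ).aestronglyMeasurable
      (ae_of_all _ fun p => norm_expKernel_le_one hκ _ _)
  rw [parityTerm, parityTerm, ← integral_parityWave_prod, ← integral_parityWave_prod, spectralFun,
    expTransform, ← integral_const_mul, ← integral_const_mul, ← integral_const_mul,
    ← integral_add ((hw 1 (by simp)).const_mul _) ((hw (-1) (by simp)).const_mul _),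
    ← integral_add]
  · refine integral_congr_ae (ae_of_all _ fun p => ?_)
    simp only [spectralKernel, expKernel]
    ring
  · exact he.const_mul _
  · exact ((hw 1 (by simp)).const_mul _).add ((hw (-1) (by simp)).const_mul _)

theorem resolventFun_eq_integral_spectralKernel (a α : ℝ) {f : ℝ → ℂ} (hf : Integrable f) {κ : ℂ}
    (hκ : 0 < κ.im) (x : ℝ) :
    resolventFun a α κ f x = (2 * κ)⁻¹ * ∫ y, f y * spectralKernel a α κ (x, y) := by
  have hw : ∀ σ : ℝ, |σ| = 1 → Integrable (fun y => parityWave a σ κ y * f y) := fun σ hσ =>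
    hf.bdd_mul (continuous_parityWave a σ κ).aestronglyMeasurable
      (ae_of_all _ (norm_parityWave_le a hσ hκ.le))
  have he : Integrable (fun y => expKernel κ y x * f y) :=
    hf.bdd_mul ((continuous_expKernel κ).comp
      (by fun_prop : Continuous fun y : ℝ => (x, y))).aestronglyMeasurable
      (ae_of_all _ fun y => norm_expKernel_le_one hκ.le _ _)
  have hκ0 : κ ≠ 0 := fun h => by simp [h] at hκ
  have e : (fun y => f y * spectralKernel a α κ (x, y)) = fun y =>
      Complex.I * (expKernel κ y x * f y) +
      (α / (2 * parityDenom a α 1 κ) * parityWave a 1 κ x * (parityWave a 1 κ y * f y) +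
      α / (2 * parityDenom a α (-1) κ) * parityWave a (-1) κ x *
        (parityWave a (-1) κ y * f y)) := by
    funext y
    simp only [spectralKernel]
    ring
  rw [e, integral_add (he.const_mul _) (Integrable.fun_add ((hw 1 (by simp)).const_mul _)
    ((hw (-1) (by simp)).const_mul _)), integral_add ((hw 1 (by simp)).const_mul _) ((hw (-1) (by simp)).const_mul _),
    integral_const_mul, integral_const_mul, integral_const_mul, resolventFun, expPotential]
  field_simp
  ring

theorem inner_resolvent_eq (a α : ℝ) {f g : Lp ℂ 2 (volume : Measure ℝ)} (hf : Integrable f)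
    {κ : ℂ} (hκ : 0 < κ.im) (hg : g =ᵐ[volume] resolventFun a α κ f) :
    inner ℂ f g = (2 * κ)⁻¹ * spectralFun a α f κ := by
  rw [inner_Lp_eq_integral, spectralFun, integral_prod _ (integrable_spectralKernel a α hf hκ.le),
    ← integral_const_mul]
  refine integral_congr_ae ?_
  filter_upwards [hg] with x hx
  rw [hx, resolventFun_eq_integral_spectralKernel a α hf hκ]
  simp only [mul_assoc]
  rw [integral_const_mul]
  ring

theorem spectralKernel_swap (a α : ℝ) (κ : ℂ) (p : ℝ × ℝ) :
    spectralKernel a α κ p.swap = spectralKernel a α κ p := by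
  simp only [spectralKernel, Prod.fst_swap, Prod.snd_swap]
  rw [expKernel_comm]
  ring

theorem expKernel_neg (k c x : ℝ) : expKernel (-k : ℂ) c x = conj (expKernel k c x) := by
  simp only [expKernel]
  rw [← Complex.exp_conj]
  simp

theorem parityWave_neg (a σ k x : ℝ) : parityWave a σ (-k : ℂ) x = conj (parityWave a σ k x) := by
  simp [parityWave, expKernel_neg]

theorem parityDenom_neg (a α σ k : ℝ) :
    parityDenom a α σ (-k : ℂ) = -conj (parityDenom a α σ k) := by
  simp only [parityDenom, map_add, map_mul, Complex.conj_ofReal, Complex.conj_I, ← Complex.exp_conj,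
    map_one, Complex.conj_ofNat]
  rw [show 2 * Complex.I * -(k : ℂ) * a = 2 * -Complex.I * k * a by ring]
  ring

/-- As α is real, k ↦ -k conjugates the waves, while i and D_σ acquire in addition a minus sign.
With symmetry in the two variables this makes the density even, so that integrals of it over
symmetric intervals become integrals of `spectralFun`. -/
theorem spectralKernel_neg (a α k : ℝ) (p : ℝ × ℝ) :
    spectralKernel a α (-k : ℂ) p = -conj (spectralKernel a α k p) := by
  simp only [spectralKernel, parityWave_neg, parityDenom_neg, expKernel_neg, map_add, map_mul,
    map_div₀, Complex.conj_ofReal, Complex.conj_I, Complex.conj_ofNat]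
  simp only [mul_neg, div_neg]
  ring

theorem spectralFun_neg (a α : ℝ) (f : ℝ → ℂ) (k : ℝ) :
    spectralFun a α f (-k : ℂ) = -conj (spectralFun a α f k) := by
  rw [spectralFun, spectralFun, ← integral_conj, ← integral_neg, ← integral_prod_swap]
  refine integral_congr_ae (ae_of_all _ fun p => ?_)
  simp only [Prod.fst_swap, Prod.snd_swap, spectralKernel_neg, spectralKernel_swap, map_mul,
    Complex.conj_conj]
  ring

theorem continuousWithinAt_spectralFun (a α : ℝ) {f : ℝ → ℂ} (hf : Integrable f) {k : ℝ}
    (hk : k ≠ 0) : ContinuousWithinAt (spectralFun a α f) {κ | 0 ≤ κ.im} k := by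
  have hk' : (k : ℂ) ∈ {κ : ℂ | 0 ≤ κ.im} := by simp
  have hc : Integrable (fun x => conj (f x)) :=
    LinearIsometryEquiv.integrable_comp_iff Complex.conjLIE |>.2 hf
  have hT : ∀ σ : ℝ, |σ| = 1 →
      ContinuousWithinAt (parityTerm a α σ (fun x => conj (f x)) f) {κ | 0 ≤ κ.im} k := by
    intro σ hσ
    refine ContinuousWithinAt.mul ?_ ((continuousOn_waveTransform a σ hc k hk').mul
      (continuousOn_waveTransform a σ hf k hk'))
    exact (ContinuousAt.div continuousAt_const
      ((differentiable_parityDenom a α σ k).continuousAt.const_mul 2)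
      (mul_ne_zero two_ne_zero (parityDenom_real_ne_zero hσ hk))).continuousWithinAt
  have hE := continuousOn_expTransform (integrable_conj_mul_prod hf)
    (p := fun p : ℝ × ℝ => |p.1 - p.2|) (by fun_prop) (fun _ => abs_nonneg _) k hk'
  exact ((hE.const_mul Complex.I).add ((hT 1 (by simp)).add (hT (-1) (by simp)))).congr
    (fun κ hκ => spectralFun_eq a α hf hκ) (spectralFun_eq a α hf hk')

theorem tendsto_ofReal_add_mul_I (k : ℝ) :
    Tendsto (fun η : ℝ => (k : ℂ) + η * Complex.I) (𝓝[>] 0) (𝓝[{κ | 0 ≤ κ.im}] (k : ℂ)) := by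
  refine tendsto_nhdsWithin_iff.2 ⟨?_, ?_⟩
  · have : Continuous (fun η : ℝ => (k : ℂ) + η * Complex.I) := by fun_prop
    have h := this.tendsto 0
    simp only [Complex.ofReal_zero, zero_mul, add_zero] at h
    exact h.mono_left nhdsWithin_le_nhds
  · filter_upwards [self_mem_nhdsWithin] with η hη
    have : 0 < η := hη
    show 0 ≤ ((k : ℂ) + η * Complex.I).im
    simp [this.le]

/-- Orthogonality to the bound states makes the transform of f vanish at the zeros of D_σ, which
removes the poles of both parity terms. -/
theorem exists_extension_spectralFun (ha : 0 < a) (haα : a * α ≠ -1)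
    {f : Lp ℂ 2 (volume : Measure ℝ)} (hf : Integrable f) (hfb : f ∈ (boundSpace a α)ᗮ) :
    ∃ F : ℂ → ℂ, DifferentiableOn ℂ F {w | 0 < w.im} ∧ (∃ B, ∀ w : ℂ, 0 < w.im → ‖F w‖ ≤ B) ∧
      ∀ w : ℂ, 0 ≤ w.im → parityDenom a α 1 w ≠ 0 → parityDenom a α (-1) w ≠ 0 →
        F w = spectralFun a α f w := by
  have hc : Integrable (fun x => conj (f x)) :=
    LinearIsometryEquiv.integrable_comp_iff Complex.conjLIE |>.2 hf
  obtain ⟨T₁, hd₁, ⟨B₁, hB₁⟩, he₁⟩ := exists_extension_parityTerm ha haα (Or.inl rfl) hc hf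
    fun q hq h0 => integral_parityWave_mul_eq_zero hfb (Or.inl rfl) hq h0
  obtain ⟨T₂, hd₂, ⟨B₂, hB₂⟩, he₂⟩ := exists_extension_parityTerm ha haα (Or.inr rfl) hc hf
    fun q hq h0 => integral_parityWave_mul_eq_zero hfb (Or.inr rfl) hq h0
  set G := expTransform (volume.prod volume) (fun p : ℝ × ℝ => |p.1 - p.2|)
    (fun p => conj (f p.1) * f p.2) with hG
  refine ⟨fun w => Complex.I * G w + (T₁ w + T₂ w), ?_,
    ⟨(∫ p : ℝ × ℝ, ‖conj (f p.1) * f p.2‖ ∂(volume.prod volume)) + (B₁ + B₂), fun w hw => ?_⟩,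
    fun w hw h1 h2 => ?_⟩
  · exact ((differentiableOn_expTransform (integrable_conj_mul_prod hf) (by fun_prop)
      fun _ => abs_nonneg _).const_mul _).add (hd₁.add hd₂)
  · refine (norm_add_le _ _).trans (add_le_add ?_ ((norm_add_le _ _).trans
      (add_le_add (hB₁ w hw) (hB₂ w hw))))
    rw [norm_mul, Complex.norm_I, one_mul]
    exact norm_expTransform_le (integrable_conj_mul_prod hf) (fun _ => abs_nonneg _) hw.le
  · simp only [he₁ w hw h1, he₂ w hw h2]
    rw [spectralFun_eq a α hf hw]

theorem parityDenom_ne_zero_of_re_ne_zero (ha : 0 < a) {σ : ℝ} (hσ : |σ| = 1) {κ : ℂ}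
    (hκ : 0 < κ.im) (hre : κ.re ≠ 0) : parityDenom a α σ κ ≠ 0 :=
  fun h => hre (re_eq_zero_of_parityDenom_eq_zero ha hσ hκ h)

/-- The values at real k ≠ 0 are limits of the bounded extension, so they inherit its bound and
enter Cauchy's formula. Taking Re κ ≠ 0 keeps κ off the imaginary axis, where the zeros of D_σ lie.
-/
theorem exists_norm_spectralFun_le (ha : 0 < a) (haα : a * α ≠ -1)
    {f : Lp ℂ 2 (volume : Measure ℝ)} (hf : Integrable f) (hfb : f ∈ (boundSpace a α)ᗮ) :
    (∃ B, ∀ k : ℝ, k ≠ 0 → ‖spectralFun a α f k‖ ≤ B) ∧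
    ∀ κ : ℂ, 0 < κ.im → κ.re ≠ 0 → ∫ k : ℝ, spectralFun a α f k * ((k : ℂ) ^ 2 - κ ^ 2)⁻¹ =
      Real.pi * Complex.I / κ * spectralFun a α f κ := by
  obtain ⟨F, hd, ⟨B, hB⟩, he⟩ := exists_extension_spectralFun ha haα hf hfb
  have hlim : ∀ k : ℝ, k ≠ 0 → Tendsto (fun η : ℝ => F (k + η * Complex.I)) (𝓝[>] 0)
      (𝓝 (spectralFun a α f k)) := by
    intro k hk
    refine ((continuousWithinAt_spectralFun a α hf hk).tendsto.comp
      (tendsto_ofReal_add_mul_I k)).congr' ?_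
    filter_upwards [self_mem_nhdsWithin] with η hη
    have hη : 0 < η := hη
    have h1 : 0 < ((k : ℂ) + η * Complex.I).im := by simpa using hη
    have h2 : ((k : ℂ) + η * Complex.I).re ≠ 0 := by simpa using hk
    exact (he _ h1.le (parityDenom_ne_zero_of_re_ne_zero ha (by simp) h1 h2)
      (parityDenom_ne_zero_of_re_ne_zero ha (by simp) h1 h2)).symm
  refine ⟨⟨B, fun k hk => le_of_tendsto (hlim k hk).norm ?_⟩, fun κ hκ hre => ?_⟩
  · filter_upwards [self_mem_nhdsWithin] with η hη
    exact hB _ (by simpa using hη)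
  · rw [← he κ hκ.le (parityDenom_ne_zero_of_re_ne_zero ha (by simp) hκ hre)
      (parityDenom_ne_zero_of_re_ne_zero ha (by simp) hκ hre)]
    refine integral_boundary_div_sq_sub_sq hd hB ?_ hκ
    filter_upwards [compl_mem_ae_iff.2 (measure_singleton (0 : ℝ))] with k hk
    exact hlim k hk

/-- The density of the spectral measure of `f` in the momentum variable. -/
def spectralDensity (a α : ℝ) (f : ℝ → ℂ) (k : ℝ) : ℝ := (spectralFun a α f k).im / (2 * Real.pi)

theorem aestronglyMeasurable_spectralFun (a α : ℝ) {f : ℝ → ℂ} (hf : Integrable f) :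
    AEStronglyMeasurable (fun k : ℝ => spectralFun a α f k) := by
  have hc : ContinuousOn (fun k : ℝ => spectralFun a α f k) {0}ᶜ := by
    intro k hk
    have h := continuousWithinAt_spectralFun a α hf hk
    exact h.comp Complex.continuous_ofReal.continuousWithinAt fun x _ => by simp
  have := hc.aestronglyMeasurable (μ := volume) (measurableSet_singleton 0).compl
  rwa [Measure.restrict_eq_self_of_ae_mem (s := {0}ᶜ)
    (compl_mem_ae_iff.2 (measure_singleton (0 : ℝ)))] at this

theorem aestronglyMeasurable_spectralDensity (a α : ℝ) {f : ℝ → ℂ} (hf : Integrable f) :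
    AEStronglyMeasurable (spectralDensity a α f) :=
  (Complex.continuous_im.comp_aestronglyMeasurable (aestronglyMeasurable_spectralFun a α hf)).mul_const
    (2 * Real.pi)⁻¹

theorem spectralDensity_neg (a α : ℝ) (f : ℝ → ℂ) (k : ℝ) :
    spectralDensity a α f (-k) = spectralDensity a α f k := by
  rw [spectralDensity, spectralDensity, Complex.ofReal_neg, spectralFun_neg]
  simp

theorem two_pi_I_mul_spectralDensity (a α : ℝ) (f : ℝ → ℂ) (k : ℝ) :
    2 * (2 * Real.pi * Complex.I * spectralDensity a α f k) =
      spectralFun a α f k + spectralFun a α f ((-k : ℝ) : ℂ) := by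
  rw [spectralDensity, Complex.ofReal_neg, spectralFun_neg]
  have hpi : (Real.pi : ℂ) ≠ 0 := by exact_mod_cast Real.pi_ne_zero
  have h : spectralFun a α f k - conj (spectralFun a α f k) =
      2 * (spectralFun a α f k).im * Complex.I := by
    rw [Complex.sub_conj]; push_cast; ring
  rw [← sub_eq_add_neg, h]
  push_cast
  field_simp

/-- The sum of `spectralFun` at k and -k is 4πi times the density, and k² - κ² is even, so both
halves give the same Cauchy integral: (4πi)⁻¹ · 2 · πi/κ = 1/(2κ). This is the resolvent form, so
the density represents it. -/
theorem integral_spectralDensity (ha : 0 < a) (haα : a * α ≠ -1)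
    {f : Lp ℂ 2 (volume : Measure ℝ)} (hf : Integrable f) (hfb : f ∈ (boundSpace a α)ᗮ)
    {κ : ℂ} (hκ : 0 < κ.im) (hre : κ.re ≠ 0) :
    Integrable (fun k : ℝ => (spectralDensity a α f k : ℂ) * ((k : ℂ) ^ 2 - κ ^ 2)⁻¹) ∧
    ∫ k : ℝ, (spectralDensity a α f k : ℂ) * ((k : ℂ) ^ 2 - κ ^ 2)⁻¹ =
      (2 * κ)⁻¹ * spectralFun a α f κ := by
  obtain ⟨⟨B, hB⟩, h⟩ := exists_norm_spectralFun_le ha haα hf hfb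
  have hne : ∀ᵐ k : ℝ, k ≠ 0 := compl_mem_ae_iff.2 (measure_singleton (0 : ℝ))
  have hi : Integrable (fun k : ℝ => spectralFun a α f k * ((k : ℂ) ^ 2 - κ ^ 2)⁻¹) :=
    (integral_inv_sq_sub_sq hκ).1.bdd_mul (aestronglyMeasurable_spectralFun a α hf)
      (by filter_upwards [hne] with k hk using hB k hk)
  have hi' : Integrable (fun k : ℝ => spectralFun a α f ((-k : ℝ) : ℂ) *
      ((k : ℂ) ^ 2 - κ ^ 2)⁻¹) := by
    have := hi.comp_neg
    simpa using this
  have hpi : (Real.pi : ℂ) ≠ 0 := by exact_mod_cast Real.pi_ne_zero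
  have hκ0 : κ ≠ 0 := fun h => by simp [h] at hκ
  have e : (fun k : ℝ => (spectralDensity a α f k : ℂ) * ((k : ℂ) ^ 2 - κ ^ 2)⁻¹) = fun k : ℝ =>
      (4 * Real.pi * Complex.I)⁻¹ * (spectralFun a α f k * ((k : ℂ) ^ 2 - κ ^ 2)⁻¹ +
        spectralFun a α f ((-k : ℝ) : ℂ) * ((k : ℂ) ^ 2 - κ ^ 2)⁻¹) := by
    funext k
    rw [← add_mul, ← two_pi_I_mul_spectralDensity, ← mul_assoc, ← mul_assoc]
    congr 1
    field_simp
    ring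
  rw [e]
  refine ⟨(hi.add hi').const_mul _, ?_⟩
  have e' : ∫ k : ℝ, spectralFun a α f ((-k : ℝ) : ℂ) * ((k : ℂ) ^ 2 - κ ^ 2)⁻¹ =
      ∫ k : ℝ, spectralFun a α f k * ((k : ℂ) ^ 2 - κ ^ 2)⁻¹ := by
    rw [← integral_neg_eq_self]
    simp
  rw [integral_const_mul, integral_add hi hi', e', h κ hκ hre]
  field_simp
  ring

theorem exists_sq_eq_of_im_ne_zero {z : ℂ} (hz : z.im ≠ 0) :
    ∃ κ : ℂ, 0 < κ.im ∧ κ.re ≠ 0 ∧ κ ^ 2 = z := by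
  obtain ⟨w, rfl⟩ := IsAlgClosed.exists_pow_nat_eq z two_pos
  have h : (w ^ 2).im = 2 * w.re * w.im := by rw [sq, Complex.mul_im]; ring
  rw [h] at hz
  have hre : w.re ≠ 0 := fun h => hz (by simp [h])
  have him : w.im ≠ 0 := fun h => hz (by simp [h])
  rcases lt_or_gt_of_ne him with h | h
  · exact ⟨-w, by simpa using h, by simpa using hre, by ring⟩
  · exact ⟨w, h, hre, rfl⟩

theorem exists_resolvent (ha : 0 < a) {f : Lp ℂ 2 (volume : Measure ℝ)} (hf : Integrable f)
    {κ : ℂ} (hκ : 0 < κ.im) (hre : κ.re ≠ 0) :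
    ∃ g : Lp ℂ 2 (volume : Measure ℝ), (g, f + κ ^ 2 • g) ∈ (deltaHamiltonian a α).graph ∧
      inner ℂ f g = (2 * κ)⁻¹ * spectralFun a α f κ := by
  obtain ⟨g, hg, hgr⟩ := resolventFun_mem_deltaGraph ha hκ
    (parityDenom_ne_zero_of_re_ne_zero (α := α) ha (by simp) hκ hre)
    (parityDenom_ne_zero_of_re_ne_zero ha (by simp) hκ hre) hf
  exact ⟨g, by rwa [deltaHamiltonian_graph], inner_resolvent_eq a α hf hκ hg⟩

theorem im_inner_resolvent {f g : Lp ℂ 2 (volume : Measure ℝ)} {z : ℂ}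
    (hg : (g, f + z • g) ∈ (deltaHamiltonian a α).graph) :
    (inner ℂ f g : ℂ).im = z.im * ‖g‖ ^ 2 := by
  rw [deltaHamiltonian_graph] at hg
  have h := deltaGraph_symmetric hg hg
  simp only [inner_add_left, inner_add_right, inner_smul_left, inner_smul_right] at h
  rw [← inner_conj_symm g f, inner_self_eq_norm_sq_to_K] at h
  have h1 := congrArg Complex.im h
  have e : ((‖g‖ : ℂ) ^ 2) = ((‖g‖ ^ 2 : ℝ) : ℂ) := by push_cast; rfl
  simp only [Complex.coe_algebraMap] at h1
  rw [e] at h1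
  simp only [Complex.add_im, Complex.conj_im, Complex.mul_im, Complex.ofReal_re, Complex.ofReal_im,
    Complex.conj_re] at h1
  linarith

/-- For κ = k + iη with k, η > 0 the resolvent form has imaginary part Im(κ²)‖g‖² ≥ 0, and η → 0
preserves the sign. Negative k follow by evenness. -/
theorem spectralDensity_nonneg (ha : 0 < a) {f : Lp ℂ 2 (volume : Measure ℝ)} (hf : Integrable f)
    {k : ℝ} (hk : k ≠ 0) : 0 ≤ spectralDensity a α f k := by
  wlog hpos : 0 < k generalizing k
  · rw [← spectralDensity_neg]
    exact this (neg_ne_zero.2 hk) (by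
      rcases lt_or_gt_of_ne hk with h | h
      · linarith
      · exact absurd h hpos)
  have hlim : Tendsto (fun η : ℝ => ((2 * ((k : ℂ) + η * Complex.I))⁻¹ *
      spectralFun a α f (k + η * Complex.I)).im) (𝓝[>] 0)
      (𝓝 ((2 * (k : ℂ))⁻¹ * spectralFun a α f k).im) := by
    refine (Complex.continuous_im.tendsto _).comp ?_
    have h1 := (continuousWithinAt_spectralFun a α hf hk).tendsto.comp (tendsto_ofReal_add_mul_I k)
    have h2 : Tendsto (fun η : ℝ => (k : ℂ) + η * Complex.I) (𝓝[>] 0) (𝓝 (k : ℂ)) :=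
      (tendsto_ofReal_add_mul_I k).mono_right nhdsWithin_le_nhds
    exact ((h2.const_mul 2).inv₀ (mul_ne_zero two_ne_zero (by exact_mod_cast hk))).mul h1
  have h0 : 0 ≤ ((2 * (k : ℂ))⁻¹ * spectralFun a α f k).im := by
    refine ge_of_tendsto hlim ?_
    filter_upwards [self_mem_nhdsWithin] with η hη
    have hη : 0 < η := hη
    obtain ⟨g, hg, hi⟩ := exists_resolvent (α := α) ha hf (κ := k + η * Complex.I)
      (by simpa using hη) (by simpa using hk)
    rw [← hi, im_inner_resolvent hg]
    have : ((k + η * Complex.I : ℂ) ^ 2).im = 2 * k * η := by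
      simp [sq]; ring
    rw [this]
    positivity
  have e : ((2 * (k : ℂ))⁻¹ * spectralFun a α f k).im = (2 * k)⁻¹ * (spectralFun a α f k).im := by
    rw [show (2 * (k : ℂ))⁻¹ = ((2 * k)⁻¹ : ℝ) by push_cast; rfl, Complex.im_ofReal_mul]
  rw [e] at h0
  have h1 : 0 ≤ (spectralFun a α f k).im := by
    by_contra! h
    have : 0 < (2 * k)⁻¹ := by positivity
    nlinarith
  rw [spectralDensity]
  positivity

end SpectralDensity

/-! ### The spectral measure, the projector P_c and the evolution -/

section SpectralMeasure

open Filter Topology Set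

variable {a α : ℝ}

theorem ae_ne_zero_real : ∀ᵐ k : ℝ, k ≠ 0 := compl_mem_ae_iff.2 (measure_singleton (0 : ℝ))

theorem im_inv_sq_sub (k R : ℝ) :
    (((k : ℂ) ^ 2 - Complex.I * R)⁻¹).im = R / (k ^ 4 + R ^ 2) := by
  have e : (k : ℂ) ^ 2 - Complex.I * R = ((k ^ 2 : ℝ) : ℂ) - Complex.I * R := by push_cast; rfl
  rw [e, Complex.inv_im, Complex.normSq_apply, Complex.sub_re, Complex.sub_im, Complex.I_mul_re,
    Complex.I_mul_im, Complex.ofReal_re, Complex.ofReal_re, Complex.ofReal_im, Complex.ofReal_im]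
  ring_nf

/-- The density is bounded, so only large k matter. The bound Im z · Im⟨f, (H - z)⁻¹f⟩ ≤ ‖f‖² at z =
2ir² controls the mass on |k| ≤ r uniformly in r, by positivity of the density. -/
theorem integrable_spectralDensity (ha : 0 < a) (haα : a * α ≠ -1)
    {f : Lp ℂ 2 (volume : Measure ℝ)} (hf : Integrable f) (hfb : f ∈ (boundSpace a α)ᗮ) :
    Integrable (spectralDensity a α f) := by
  obtain ⟨⟨B, hB⟩, -⟩ := exists_norm_spectralFun_le ha haα hf hfb
  have hm := aestronglyMeasurable_spectralDensity a α hf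
  have hb : ∀ᵐ k : ℝ, ‖spectralDensity a α f k‖ ≤ B / (2 * Real.pi) := by
    filter_upwards [ae_ne_zero_real] with k hk
    rw [spectralDensity, norm_div, Real.norm_of_nonneg (by positivity : 0 ≤ 2 * Real.pi)]
    gcongr
    exact (Complex.abs_im_le_norm _).trans (hB k hk)
  refine integrable_of_intervalIntegral_norm_bounded (l := atTop) (a := fun r : ℝ => -r)
    (b := fun r => r) (5 / 4 * ‖f‖ ^ 2) (fun r => ?_) tendsto_neg_atTop_atBot tendsto_id ?_
  · exact Measure.integrableOn_of_bounded measure_Ioc_lt_top.ne hm (ae_restrict_of_ae hb)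
  filter_upwards [eventually_gt_atTop 0] with r hr
  -- Chosen so that κ² = 2ir² is purely imaginary while Re κ ≠ 0.
  set κ : ℂ := r * (1 + Complex.I) with hκ
  have hκim : 0 < κ.im := by simpa [hκ] using hr
  have hκre : κ.re ≠ 0 := by simpa [hκ] using hr.ne'
  have hκ2 : κ ^ 2 = Complex.I * ((2 * r ^ 2 : ℝ) : ℂ) := by
    rw [hκ, mul_pow]
    push_cast
    linear_combination (r : ℂ) ^ 2 * Complex.I_sq
  obtain ⟨g, hg, hi⟩ := exists_resolvent (α := α) ha hf hκim hκre
  obtain ⟨hint, heq⟩ := integral_spectralDensity ha haα hf hfb hκim hκre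
  have him := im_inner_resolvent hg
  have hR : (κ ^ 2).im = 2 * r ^ 2 := by rw [hκ2, Complex.I_mul_im, Complex.ofReal_re]
  rw [hR] at him
  have hle : (inner ℂ f g : ℂ).im ≤ ‖f‖ * ‖g‖ :=
    (le_abs_self _).trans ((Complex.abs_im_le_norm _).trans (norm_inner_le_norm f g))
  have hgn : 2 * r ^ 2 * ‖g‖ ≤ ‖f‖ := by
    rcases (norm_nonneg g).eq_or_lt with h | h
    · rw [← h]; simp
    · rw [him] at hle
      nlinarith
  have hmain : 2 * r ^ 2 * (inner ℂ f g : ℂ).im ≤ ‖f‖ ^ 2 := by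
    calc 2 * r ^ 2 * (inner ℂ f g : ℂ).im ≤ 2 * r ^ 2 * (‖f‖ * ‖g‖) := by gcongr
      _ = ‖f‖ * (2 * r ^ 2 * ‖g‖) := by ring
      _ ≤ ‖f‖ * ‖f‖ := by gcongr
      _ = _ := by ring
  have hIm : (inner ℂ f g : ℂ).im =
      ∫ k : ℝ, spectralDensity a α f k * (2 * r ^ 2 / (k ^ 4 + (2 * r ^ 2) ^ 2)) := by
    have h1 := integral_im hint
    rw [hi, ← heq]
    refine h1.symm.trans (integral_congr_ae (ae_of_all _ fun k => ?_))
    show ((spectralDensity a α f k : ℂ) * ((k : ℂ) ^ 2 - κ ^ 2)⁻¹).im = _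
    rw [Complex.im_ofReal_mul, hκ2, im_inv_sq_sub]
  have hint' : Integrable
      (fun k : ℝ => spectralDensity a α f k * (2 * r ^ 2 / (k ^ 4 + (2 * r ^ 2) ^ 2))) := by
    refine hint.im.congr (ae_of_all _ fun k => ?_)
    show ((spectralDensity a α f k : ℂ) * ((k : ℂ) ^ 2 - κ ^ 2)⁻¹).im = _
    rw [Complex.im_ofReal_mul, hκ2, im_inv_sq_sub]
  have hnn : ∀ᵐ k : ℝ, 0 ≤ spectralDensity a α f k := by
    filter_upwards [ae_ne_zero_real] with k hk using spectralDensity_nonneg ha hf hk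
  rw [intervalIntegral.integral_of_le (by linarith)]
  have hpt : ∀ᵐ k ∂(volume.restrict (Ioc (-r) r)), ‖spectralDensity a α f k‖ ≤
      5 / 2 * r ^ 2 * (spectralDensity a α f k * (2 * r ^ 2 / (k ^ 4 + (2 * r ^ 2) ^ 2))) := by
    filter_upwards [ae_restrict_of_ae hnn, ae_restrict_mem measurableSet_Ioc] with k h0 hk
    rw [Real.norm_of_nonneg h0]
    have h1 : k ^ 2 ≤ r ^ 2 := sq_le_sq' hk.1.le hk.2
    -- For |k| ≤ r the denominator k⁴ + 4r⁴ is at most 5r⁴, which fixes the factor 5/2.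
    have h2 : 1 ≤ 5 / 2 * r ^ 2 * (2 * r ^ 2 / (k ^ 4 + (2 * r ^ 2) ^ 2)) := by
      rw [← mul_div_assoc, one_le_div (by positivity)]
      nlinarith [sq_nonneg k]
    calc spectralDensity a α f k = spectralDensity a α f k * 1 := by ring
      _ ≤ spectralDensity a α f k * (5 / 2 * r ^ 2 * (2 * r ^ 2 / (k ^ 4 + (2 * r ^ 2) ^ 2))) := by
        gcongr
      _ = _ := by ring
  calc ∫ k in Ioc (-r) r, ‖spectralDensity a α f k‖
      ≤ ∫ k in Ioc (-r) r, 5 / 2 * r ^ 2 *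
        (spectralDensity a α f k * (2 * r ^ 2 / (k ^ 4 + (2 * r ^ 2) ^ 2))) :=
        integral_mono_of_nonneg (ae_of_all _ fun _ => norm_nonneg _)
          (hint'.const_mul _).integrableOn hpt
    _ ≤ ∫ k, 5 / 2 * r ^ 2 *
        (spectralDensity a α f k * (2 * r ^ 2 / (k ^ 4 + (2 * r ^ 2) ^ 2))) := by
        refine setIntegral_le_integral (hint'.const_mul _) ?_
        filter_upwards [hnn] with k hk
        show (0 : ℝ) ≤ _
        positivity
    _ = 5 / 4 * (2 * r ^ 2 * (inner ℂ f g : ℂ).im) := by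
        rw [integral_const_mul, ← hIm]; ring
    _ ≤ _ := by gcongr

/-- Apart from 0, the preimage of a null set under squaring lies in its images under ±√, which is
differentiable on (0, ∞) and so preserves null sets. -/
theorem map_sq_absolutelyContinuous :
    Measure.map (fun k : ℝ => k ^ 2) volume ≪ (volume : Measure ℝ) := by
  refine Measure.AbsolutelyContinuous.mk fun s hs h0 => ?_
  rw [Measure.map_apply (by fun_prop) hs]
  have h1 : volume (s ∩ Ioi 0) = 0 := measure_mono_null inter_subset_left h0
  have hd : DifferentiableOn ℝ Real.sqrt (s ∩ Ioi 0) := fun x hx =>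
    (Real.hasDerivAt_sqrt (ne_of_gt hx.2)).differentiableAt.differentiableWithinAt
  have h2 := addHaar_image_eq_zero_of_differentiableOn_of_addHaar_eq_zero volume hd h1
  have h3 := addHaar_image_eq_zero_of_differentiableOn_of_addHaar_eq_zero volume hd.neg h1
  refine measure_mono_null ?_ (measure_union_null (measure_singleton (0 : ℝ))
    (measure_union_null h2 h3))
  intro k hk
  have hk : k ^ 2 ∈ s := hk
  rcases lt_trichotomy k 0 with h | h | h
  · refine Or.inr (Or.inr ⟨k ^ 2, ⟨hk, show 0 < k ^ 2 from sq_pos_of_neg h⟩, ?_⟩)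
    simp [Real.sqrt_sq_eq_abs, abs_of_neg h]
  · exact Or.inl h
  · exact Or.inr (Or.inl ⟨k ^ 2, ⟨hk, show 0 < k ^ 2 by positivity⟩, Real.sqrt_sq h.le⟩)

/-- The spectral measure of an integrable function orthogonal to the bound states. -/
theorem exists_isSpectralMeasure (ha : 0 < a) (haα : a * α ≠ -1)
    {f : Lp ℂ 2 (volume : Measure ℝ)} (hf : Integrable f) (hfb : f ∈ (boundSpace a α)ᗮ) :
    ∃ μ : Measure ℝ, IsSpectralMeasure (deltaHamiltonian a α) f μ ∧ μ ≪ volume := by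
  have hρ := integrable_spectralDensity ha haα hf hfb
  set ν := volume.withDensity fun k => ENNReal.ofReal (spectralDensity a α f k) with hν
  have hfin : IsFiniteMeasure ν := isFiniteMeasure_withDensity_ofReal hρ.2
  refine ⟨ν.map fun k => k ^ 2, ⟨inferInstance, fun z hz => ?_⟩,
    ((withDensity_absolutelyContinuous _ _).map (by fun_prop)).trans map_sq_absolutelyContinuous⟩
  obtain ⟨κ, hκ, hre, rfl⟩ := exists_sq_eq_of_im_ne_zero hz
  obtain ⟨g, hg, hi⟩ := exists_resolvent (α := α) ha hf hκ hre
  obtain ⟨y, hy, hAy⟩ := (LinearPMap.mem_graph_iff _).1 hg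
  refine ⟨y, ?_, ?_⟩
  · rw [hAy, hy]; simp
  · rw [hy]
    show inner ℂ f g = _
    rw [hi, ← (integral_spectralDensity ha haα hf hfb hκ hre).2, integral_map (by fun_prop)
      (Measurable.aestronglyMeasurable (by fun_prop)), hν,
      integral_withDensity_eq_integral_toReal_smul₀ hρ.1.aemeasurable.ennreal_ofReal
        (ae_of_all _ fun _ => ENNReal.ofReal_lt_top)]
    refine integral_congr_ae ?_
    filter_upwards [ae_ne_zero_real] with k hk
    rw [ENNReal.toReal_ofReal (spectralDensity_nonneg ha hf hk), Complex.real_smul]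
    push_cast
    rfl

theorem finiteDimensional_boundSpace (ha : 0 < a) (α : ℝ) :
    FiniteDimensional ℂ (boundSpace a α) :=
  FiniteDimensional.span_of_finite ℂ (finite_boundStates ha α)

theorem deltaHamiltonian_symmetric (a α : ℝ)
    (p q : Lp ℂ 2 (volume : Measure ℝ) × Lp ℂ 2 (volume : Measure ℝ))
    (hp : p ∈ (deltaHamiltonian a α).graph) (hq : q ∈ (deltaHamiltonian a α).graph) :
    inner ℂ p.1 q.2 = inner ℂ p.2 q.1 := by
  rw [deltaHamiltonian_graph] at hp hq
  exact deltaGraph_symmetric hp hq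

/-- One inclusion holds because absolutely continuous measures have no atoms at eigenvalues. For the
other, projecting a dense set of integrable functions off the bound states keeps them integrable,
and the projected vectors have absolutely continuous spectral measures. -/
theorem acSubspace_eq (ha : 0 < a) (haα : a * α ≠ -1) :
    acSubspace (deltaHamiltonian a α) = (boundSpace a α)ᗮ := by
  have := finiteDimensional_boundSpace ha α
  apply le_antisymm
  · refine Submodule.topologicalClosure_minimal _ (Submodule.span_le.2 ?_)
      (Submodule.isClosed_orthogonal _)
    rintro f ⟨μ, hμ, hac⟩
    show f ∈ (boundSpace a α)ᗮ
    rw [boundSpace, Submodule.mem_orthogonal]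
    intro u hu
    induction hu using Submodule.span_induction with
    | mem e he =>
      obtain ⟨s, hs⟩ := boundStates_mem_graph ha he
      exact inner_eigenvector_eq_zero (deltaHamiltonian_symmetric a α) hs hμ hac
    | zero => simp
    | add x y _ _ hx hy => rw [inner_add_left, hx, hy, add_zero]
    | smul c x _ hx => rw [inner_smul_left, hx, mul_zero]
  · intro f hf
    set P := (boundSpace a α)ᗮ.starProjection with hP
    have hPf : P f = f := Submodule.starProjection_eq_self_iff.2 hf
    have hmem : f ∈ closure {f : Lp ℂ 2 (volume : Measure ℝ) | Integrable f} :=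
      dense_integrable_Lp_two f
    have h1 := map_mem_closure P.continuous hmem (t := ((Submodule.span ℂ
      {f | ∃ μ : Measure ℝ, IsSpectralMeasure (deltaHamiltonian a α) f μ ∧ μ ≪ volume} :
        Submodule ℂ (Lp ℂ 2 (volume : Measure ℝ))) : Set (Lp ℂ 2 (volume : Measure ℝ))))
      fun g hg => by
        refine Submodule.subset_span (exists_isSpectralMeasure ha haα ?_
          (Submodule.starProjection_apply_mem _ _))
        have e : P g = g - (boundSpace a α).starProjection g := by
          rw [hP, Submodule.starProjection_orthogonal_val]
        rw [e]
        have hQ := (boundSpace_bounded_integrable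
          (Submodule.starProjection_apply_mem (boundSpace a α) g)).1
        have hg : Integrable g := hg
        exact (hg.sub hQ).congr (Lp.coeFn_sub _ _).symm
    rw [hPf] at h1
    exact h1

theorem acProjection_eq (ha : 0 < a) (haα : a * α ≠ -1) :
    acProjection (deltaHamiltonian a α) = (boundSpace a α)ᗮ.starProjection := by
  rw [acProjection]
  congr 1
  exact acSubspace_eq ha haα

theorem laplace_exp_neg {z : ℂ} (hz : 0 < z.im) (s : ℝ) :
    ∫ t in Ioi (0 : ℝ), Complex.exp (Complex.I * z * t) * Complex.exp (-Complex.I * t * s) =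
      -Complex.I * ((s : ℂ) - z)⁻¹ := by
  have hre : (Complex.I * (z - s)).re < 0 := by simpa using hz
  have h := integral_exp_mul_complex_Ioi hre 0
  have hne : z - s ≠ 0 := fun h => by simp [h] at hre
  have hne' : (s : ℂ) - z ≠ 0 := fun h => hne (by linear_combination -h)
  rw [Complex.ofReal_zero, mul_zero, Complex.exp_zero] at h
  have e : -Complex.I * ((s : ℂ) - z)⁻¹ = -1 / (Complex.I * (z - s)) := by
    rw [eq_div_iff (mul_ne_zero Complex.I_ne_zero hne)]
    field_simp
    linear_combination (s - z) * Complex.I_sq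
  rw [e, ← h]
  refine setIntegral_congr_fun measurableSet_Ioi fun t _ => ?_
  rw [← Complex.exp_add]
  congr 1
  ring

theorem IsSchrodingerGroup.integral_exp_mul_inner {E : Type*} [NormedAddCommGroup E]
    [InnerProductSpace ℂ E] [CompleteSpace E] {A : E →ₗ.[ℂ] E} {U : ℝ → E →L[ℂ] E}
    (hU : IsSchrodingerGroup A U) {z : ℂ} (hz : 0 < z.im) {f g : E} (hg : (g, f + z • g) ∈ A.graph) :
    ∫ t in Ioi (0 : ℝ), Complex.exp (Complex.I * z * t) * inner ℂ f (U t f) =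
      -Complex.I * inner ℂ f g := by
  have h := integral_inner (𝕜 := ℂ) (hU.integrableOn_exp_smul hz f) f
  rw [hU.integral_exp_smul hz hg] at h
  simpa only [inner_smul_right] using h

/-- Both sides are bounded and continuous in t, and at z = κ² both have Laplace transform -i⟨f, (H -
z)⁻¹f⟩: the left through the group, the right through the spectral density. -/
theorem IsSchrodingerGroup.inner_apply_eq_integral (ha : 0 < a) (haα : a * α ≠ -1)
    {U : ℝ → Lp ℂ 2 (volume : Measure ℝ) →L[ℂ] Lp ℂ 2 (volume : Measure ℝ)}
    (hU : IsSchrodingerGroup (deltaHamiltonian a α) U)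
    {f : Lp ℂ 2 (volume : Measure ℝ)} (hf : Integrable f) (hfb : f ∈ (boundSpace a α)ᗮ)
    {t : ℝ} (ht : 0 < t) :
    inner ℂ f (U t f) =
      ∫ k : ℝ, (spectralDensity a α f k : ℂ) * Complex.exp (-Complex.I * t * (k ^ 2 : ℝ)) := by
  have hρ := integrable_spectralDensity ha haα hf hfb
  have hρc : Integrable (fun k => (spectralDensity a α f k : ℂ)) := hρ.ofReal
  set b : ℝ → ℂ := fun t => ∫ k : ℝ, (spectralDensity a α f k : ℂ) *
    Complex.exp (-Complex.I * t * (k ^ 2 : ℝ)) with hb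
  have hn : ∀ t k : ℝ, ‖Complex.exp (-Complex.I * t * (k ^ 2 : ℝ))‖ = 1 := by
    intro t k
    rw [show -Complex.I * t * (k ^ 2 : ℝ) = ((-(t * k ^ 2) : ℝ) : ℂ) * Complex.I by push_cast; ring,
      Complex.norm_exp_ofReal_mul_I]
  have hbound : ∀ t k : ℝ, ‖(spectralDensity a α f k : ℂ) *
      Complex.exp (-Complex.I * t * (k ^ 2 : ℝ))‖ ≤ ‖(spectralDensity a α f k : ℂ)‖ := by
    intro t k
    rw [norm_mul, hn, mul_one]
  have hbc : Continuous b := by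
    refine continuous_of_dominated (bound := fun k => ‖(spectralDensity a α f k : ℂ)‖)
      (fun t => hρc.aestronglyMeasurable.mul (Continuous.aestronglyMeasurable (by fun_prop)))
      (fun t => ae_of_all _ (hbound t)) hρc.norm (ae_of_all _ fun k => by fun_prop)
  set B := max (‖f‖ * ‖f‖) (∫ k, ‖(spectralDensity a α f k : ℂ)‖)
  refine eq_of_laplace_eq (b₁ := fun t => inner ℂ f (U t f)) (b₂ := b) (B := B)
    ((continuous_const).inner (hU.continuous f)) hbc (fun t => ?_) (fun t => ?_)
    (fun z hz => ?_) ht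
  · refine (norm_inner_le_norm _ _).trans ?_
    rw [hU.isometry]
    exact le_max_left _ _
  · exact (norm_integral_le_of_norm_le hρc.norm (ae_of_all _ (hbound t))).trans (le_max_right _ _)
  obtain ⟨κ, hκ, hre, rfl⟩ := exists_sq_eq_of_im_ne_zero hz.ne'
  obtain ⟨g, hg, hi⟩ := exists_resolvent (α := α) ha hf hκ hre
  rw [hU.integral_exp_mul_inner hz hg, hi, ← (integral_spectralDensity ha haα hf hfb hκ hre).2, ← integral_const_mul]
  have h2 : ∀ k : ℝ, -Complex.I * ((spectralDensity a α f k : ℂ) * ((k : ℂ) ^ 2 - κ ^ 2)⁻¹) =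
      ∫ t in Ioi (0 : ℝ), Complex.exp (Complex.I * κ ^ 2 * t) * ((spectralDensity a α f k : ℂ) *
        Complex.exp (-Complex.I * t * (k ^ 2 : ℝ))) := by
    intro k
    have h3 := laplace_exp_neg hz (k ^ 2)
    push_cast at h3 ⊢
    rw [mul_left_comm, ← h3, ← integral_const_mul]
    congr 1
    funext t
    ring
  rw [integral_congr_ae (ae_of_all _ h2), integral_integral_swap]
  · simp only [hb, integral_const_mul]
  have h4 : Integrable (fun t : ℝ => Complex.exp (Complex.I * κ ^ 2 * t))
      (volume.restrict (Ioi 0)) := by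
    have : (Complex.I * κ ^ 2).re < 0 := by
      rw [Complex.I_mul_re]; linarith
    exact integrableOn_exp_mul_complex_Ioi this 0
  have h5 := (hρc.mul_prod h4).mul_bdd (c := 1)
    (g := fun p : ℝ × ℝ => Complex.exp (-Complex.I * p.2 * (p.1 ^ 2 : ℝ)))
    (Continuous.aestronglyMeasurable (by fun_prop)) (ae_of_all _ fun p => (hn _ _).le)
  refine h5.congr (ae_of_all _ fun p => ?_)
  simp only [Function.uncurry]
  ring

end SpectralMeasure

/-! ### Oscillatory integrals with quadratic phase -/

section Oscillatory

open Filter Topology Set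

/-- The oscillatory factor `e^{i(rk - tk²)}`. -/
def quadPhase (t r k : ℝ) : ℂ := Complex.exp (Complex.I * ((r * k - t * k ^ 2 : ℝ) : ℂ))

theorem norm_quadPhase (t r k : ℝ) : ‖quadPhase t r k‖ = 1 := by
  rw [quadPhase, mul_comm, Complex.norm_exp_ofReal_mul_I]

theorem continuous_quadPhase (t : ℝ) : Continuous fun p : ℝ × ℝ => quadPhase t p.1 p.2 := by
  unfold quadPhase
  fun_prop

theorem continuous_quadPhase_right (t r : ℝ) : Continuous (quadPhase t r) := by
  unfold quadPhase
  fun_prop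

theorem hasDerivAt_quadPhase (t r k : ℝ) :
    HasDerivAt (quadPhase t r) (quadPhase t r k * (Complex.I * ((r - 2 * t * k : ℝ) : ℂ))) k := by
  have h : HasDerivAt (fun k : ℝ => r * k - t * k ^ 2) (r - 2 * t * k) k := by
    have := ((hasDerivAt_id k).const_mul r).sub ((hasDerivAt_pow 2 k).const_mul t)
    refine this.congr_deriv ?_
    simp; ring
  exact (h.ofReal_comp.const_mul Complex.I).cexp

/-- A van der Corput estimate without splitting at the stationary point: an explicit W has
derivative equal to the integrand up to an error 3/(1 + q²), whose integral is at most 3π/(2b) ≤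
5/b. The end values of W contribute at most 1/(2b) each. -/
theorem norm_integral_quadPhase_sq_le {b : ℝ} (hb : 0 < b) (r : ℝ) {u v : ℝ} (huv : u ≤ v) :
    ‖∫ k in u..v, quadPhase (b ^ 2) r k‖ ≤ 6 / b := by
  -- The derivative of the phase is -bq, with q the distance to the stationary point in units where
  -- the critical width is of order one.
  set q : ℝ → ℝ := fun k => 2 * b * k - r / b with hq
  have hqd : ∀ k, HasDerivAt q (2 * b) k := fun k => by
    refine (((hasDerivAt_id k).const_mul (2 * b)).sub_const (r / b)).congr_deriv ?_
    simp
  have hqc : Continuous q := by fun_prop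
  have hpos : ∀ k, 0 < 1 + q k ^ 2 := fun k => by positivity
  set A : ℝ → ℝ := fun k => b⁻¹ * (q k / (1 + q k ^ 2)) with hA
  set A' : ℝ → ℝ := fun k => 2 * (1 - q k ^ 2) / (1 + q k ^ 2) ^ 2 with hA'
  have hAd : ∀ k, HasDerivAt A (A' k) k := fun k => by
    have h1 := ((hqd k).div (((hqd k).pow 2).const_add 1) (hpos k).ne').const_mul b⁻¹
    refine h1.congr_deriv ?_
    simp only [hA', Pi.pow_apply]
    have := (hpos k).ne'
    field_simp
    ring
  -- The naive primitive e^{iφ}/(iφ') is (i/(bq))e^{iφ}; replacing 1/q by q/(1 + q²) removes its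
  -- pole at the stationary point.
  set W : ℝ → ℂ := fun k => Complex.I * A k * quadPhase (b ^ 2) r k with hW
  set W' : ℝ → ℂ := fun k => (Complex.I * A' k + ((q k ^ 2 / (1 + q k ^ 2) : ℝ) : ℂ)) *
    quadPhase (b ^ 2) r k with hW'
  have hWd : ∀ k, HasDerivAt W (W' k) k := fun k => by
    have h1 := ((hAd k).ofReal_comp.const_mul Complex.I).mul (hasDerivAt_quadPhase (b ^ 2) r k)
    refine h1.congr_deriv ?_
    have e : r - 2 * b ^ 2 * k = -(b * q k) := by
      simp only [hq]; field_simp; ring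
    have e2 : ((q k ^ 2 / (1 + q k ^ 2) : ℝ) : ℂ) = -(Complex.I ^ 2 * A k * (b * q k : ℝ)) := by
      rw [Complex.I_sq, neg_mul, neg_mul, neg_neg, one_mul, ← Complex.ofReal_mul]
      congr 1
      simp only [hA]
      field_simp
    rw [e, hW']
    simp only
    rw [e2]
    push_cast
    ring
  have hWc : Continuous W' := by
    have h1 := continuous_quadPhase_right (b ^ 2) r
    have h2 : Continuous A' := by
      simp only [hA']
      exact Continuous.div (by fun_prop) (by fun_prop) fun k => (pow_pos (hpos k) 2).ne'
    have h3 : Continuous fun k => q k ^ 2 / (1 + q k ^ 2) :=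
      Continuous.div (by fun_prop) (by fun_prop) fun k => (hpos k).ne'
    simp only [hW']
    fun_prop
  have hFTC := intervalIntegral.integral_eq_sub_of_hasDerivAt (a := u) (b := v)
    (fun k _ => hWd k) (hWc.intervalIntegrable _ _)
  have hWn : ∀ k, ‖W k‖ ≤ 1 / (2 * b) := fun k => by
    rw [hW]
    simp only [norm_mul, Complex.norm_I, one_mul, norm_quadPhase, mul_one, Complex.norm_real]
    rw [hA]
    simp only [norm_mul, norm_div, Real.norm_eq_abs, abs_inv, abs_of_pos hb, abs_of_pos (hpos k)]
    rw [one_div, mul_inv, mul_comm]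
    gcongr
    rw [div_le_iff₀ (hpos k), ← sq_abs (q k)]
    nlinarith [sq_nonneg (|q k| - 1)]
  have hrem : ∀ k, ‖quadPhase (b ^ 2) r k - W' k‖ ≤ 3 / (1 + q k ^ 2) := fun k => by
    have e : quadPhase (b ^ 2) r k - W' k =
        (((1 / (1 + q k ^ 2) : ℝ) : ℂ) - Complex.I * A' k) * quadPhase (b ^ 2) r k := by
      have : (1 : ℂ) - ((q k ^ 2 / (1 + q k ^ 2) : ℝ) : ℂ) = ((1 / (1 + q k ^ 2) : ℝ) : ℂ) := by
        rw [← Complex.ofReal_one, ← Complex.ofReal_sub]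
        congr 1
        have := (hpos k).ne'
        field_simp
        ring
      rw [← this, hW']
      ring
    rw [e, norm_mul, norm_quadPhase, mul_one]
    refine (norm_sub_le _ _).trans ?_
    rw [norm_mul, Complex.norm_I, one_mul, Complex.norm_real, Complex.norm_real,
      Real.norm_of_nonneg (by have := hpos k; positivity)]
    have h2 : ‖A' k‖ ≤ 2 / (1 + q k ^ 2) := by
      rw [hA']
      simp only [norm_div, norm_mul, norm_pow, Real.norm_eq_abs, abs_of_pos (hpos k)]
      rw [div_le_div_iff₀ (pow_pos (hpos k) 2) (hpos k), abs_of_pos (by norm_num : (0 : ℝ) < 2)]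
      have h3 : |1 - q k ^ 2| ≤ 1 + q k ^ 2 := by
        rw [abs_le]; constructor <;> nlinarith [sq_nonneg (q k)]
      have := hpos k
      calc 2 * |1 - q k ^ 2| * (1 + q k ^ 2) ≤ 2 * (1 + q k ^ 2) * (1 + q k ^ 2) := by gcongr
        _ = _ := by ring
    calc 1 / (1 + q k ^ 2) + ‖A' k‖ ≤ 1 / (1 + q k ^ 2) + 2 / (1 + q k ^ 2) := by gcongr
      _ = _ := by rw [← add_div]; norm_num
  have hc3 : Continuous fun k => 3 / (1 + q k ^ 2) :=
    Continuous.div (by fun_prop) (by fun_prop) fun k => (hpos k).ne'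
  have hat : ∫ k in u..v, 3 / (1 + q k ^ 2) =
      3 / (2 * b) * Real.arctan (q v) - 3 / (2 * b) * Real.arctan (q u) := by
    refine intervalIntegral.integral_eq_sub_of_hasDerivAt
      (f := fun k => 3 / (2 * b) * Real.arctan (q k)) (fun k _ => ?_)
      (hc3.intervalIntegrable _ _)
    refine ((hqd k).arctan.const_mul (3 / (2 * b))).congr_deriv ?_
    have := (hpos k).ne'
    field_simp
  have hr := intervalIntegral.norm_integral_le_of_norm_le huv (ae_of_all volume fun k _ => hrem k)
    (hc3.intervalIntegrable _ _)
  rw [intervalIntegral.integral_sub ((continuous_quadPhase_right _ _).intervalIntegrable _ _)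
    (hWc.intervalIntegrable _ _), hFTC, hat] at hr
  have h1 := Real.arctan_lt_pi_div_two (q v)
  have h2 := Real.neg_pi_div_two_lt_arctan (q u)
  have hpi := Real.pi_lt_d2
  have h3 : 3 / (2 * b) * Real.arctan (q v) - 3 / (2 * b) * Real.arctan (q u) ≤ 5 / b := by
    rw [← mul_sub]
    calc 3 / (2 * b) * (Real.arctan (q v) - Real.arctan (q u)) ≤ 3 / (2 * b) * (10 / 3) := by
          gcongr; linarith
      _ = 5 / b := by field_simp; norm_num
  have h4 := norm_le_norm_add_norm_sub' (∫ k in u..v, quadPhase (b ^ 2) r k) (W v - W u)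
  have h5 := norm_sub_le (W v) (W u)
  have h6 : 6 / b = 5 / b + (1 / (2 * b) + 1 / (2 * b)) := by field_simp; norm_num
  linarith [hWn u, hWn v]

theorem norm_integral_quadPhase_le {t : ℝ} (ht : 0 < t) (r : ℝ) {u v : ℝ} (huv : u ≤ v) :
    ‖∫ k in u..v, quadPhase t r k‖ ≤ 6 / √t := by
  have := norm_integral_quadPhase_sq_le (Real.sqrt_pos.2 ht) r huv
  rwa [Real.sq_sqrt ht.le] at this

/-- The oscillatory integrals with weight `m` over `[u, v]` are bounded by `C / √t`. -/
def OscBound (m : ℝ → ℂ) (u v C : ℝ) : Prop :=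
  ∀ t : ℝ, 0 < t → ∀ r : ℝ, ‖∫ k in u..v, m k * quadPhase t r k‖ ≤ C / √t

/-- Integration by parts against the primitive of the phase, which is bounded by 6/√t. The weight (1
+ k²)⁻¹ has integral at most π < 4, so the constant does not depend on the interval. -/
theorem oscBound_of_deriv {m m' : ℝ → ℂ} {u v M M' : ℝ} (huv : u ≤ v)
    (hm : ∀ k ∈ Icc u v, HasDerivAt m (m' k) k) (hc : ContinuousOn m' (Icc u v))
    (hM : ∀ k ∈ Icc u v, ‖m k‖ ≤ M) (hM' : ∀ k ∈ Icc u v, ‖m' k‖ ≤ M' * (1 + k ^ 2)⁻¹) :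
    OscBound m u v (6 * (M + 4 * M')) := by
  intro t ht r
  set G : ℝ → ℂ := fun k => ∫ s in u..k, quadPhase t r s with hG
  have hqc := continuous_quadPhase_right t r
  have hGd : ∀ k, HasDerivAt G (quadPhase t r k) k := fun k =>
    intervalIntegral.integral_hasDerivAt_right (hqc.intervalIntegrable _ _)
      (hqc.stronglyMeasurableAtFilter _ _) hqc.continuousAt
  have hGn : ∀ k ∈ Icc u v, ‖G k‖ ≤ 6 / √t := fun k hk => norm_integral_quadPhase_le ht r hk.1
  have hIBP := intervalIntegral.integral_mul_deriv_eq_deriv_mul (u := m) (v := G) (a := u) (b := v)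
    (u' := m') (v' := quadPhase t r) (by rwa [uIcc_of_le huv]) (fun k _ => hGd k)
    (ContinuousOn.intervalIntegrable (by rwa [uIcc_of_le huv])) (hqc.intervalIntegrable _ _)
  have hGu : G u = 0 := by simp [hG]
  have hst := Real.sqrt_pos.2 ht
  have hM0 : 0 ≤ M' := by
    have h1 := (norm_nonneg _).trans (hM' u ⟨le_rfl, huv⟩)
    have h2 : 0 < (1 + u ^ 2)⁻¹ := by positivity
    exact nonneg_of_mul_nonneg_left h1 h2
  have hint : ‖∫ k in u..v, m' k * G k‖ ≤ ∫ k in u..v, M' * (6 / √t) * (1 + k ^ 2)⁻¹ := by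
    refine intervalIntegral.norm_integral_le_of_norm_le huv (ae_of_all _ fun k hk => ?_)
      ((integrable_inv_one_add_sq.const_mul _).intervalIntegrable)
    have hk' : k ∈ Icc u v := ⟨hk.1.le, hk.2⟩
    rw [norm_mul]
    calc ‖m' k‖ * ‖G k‖ ≤ M' * (1 + k ^ 2)⁻¹ * (6 / √t) := by
          gcongr
          · exact hM' k hk'
          · exact hGn k hk'
      _ = _ := by ring
  rw [intervalIntegral.integral_const_mul, integral_inv_one_add_sq] at hint
  have h1 := Real.arctan_lt_pi_div_two v
  have h2 := Real.neg_pi_div_two_lt_arctan u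
  have hpi := Real.pi_lt_d2
  rw [hIBP, hGu, mul_zero, sub_zero]
  refine (norm_sub_le _ _).trans ?_
  have h3 : ‖m v * G v‖ ≤ M * (6 / √t) := by
    rw [norm_mul]
    have h4 := hM v ⟨huv, le_rfl⟩
    have h5 := hGn v ⟨huv, le_rfl⟩
    have h6 := (norm_nonneg _).trans h4
    gcongr
  have h7 : M' * (6 / √t) * (Real.arctan v - Real.arctan u) ≤ M' * (6 / √t) * 4 := by
    gcongr; linarith
  calc _ ≤ M * (6 / √t) + M' * (6 / √t) * 4 := add_le_add h3 (hint.trans h7)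
    _ = _ := by ring

theorem hasDerivAt_const_div_comp_ofReal {d : ℂ → ℂ} (hd : Differentiable ℂ d) (c : ℂ) {k : ℝ}
    (hk : d k ≠ 0) : HasDerivAt (fun k : ℝ => c / d k) (-(c * deriv d k) / d k ^ 2) k := by
  have h1 := ((hasDerivAt_const (k : ℂ) c).div (hd k).hasDerivAt hk).comp_ofReal
  refine h1.congr_deriv ?_
  ring

theorem continuous_deriv_of_differentiable {d : ℂ → ℂ} (hd : Differentiable ℂ d) :
    Continuous (deriv d) :=
  (hd.contDiff (n := 1)).continuous_deriv le_rfl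

theorem exists_oscBound_of_ne_zero {d : ℂ → ℂ} (hd : Differentiable ℂ d) (c : ℂ) {u v : ℝ}
    (huv : u ≤ v) (hne : ∀ k ∈ Icc u v, d (k : ℝ) ≠ 0) :
    ∃ C, OscBound (fun k => c / d k) u v C := by
  have hdc : Continuous fun k : ℝ => d k := hd.continuous.comp Complex.continuous_ofReal
  have hdc' : Continuous fun k : ℝ => deriv d k :=
    (continuous_deriv_of_differentiable hd).comp Complex.continuous_ofReal
  have hc : ContinuousOn (fun k : ℝ => c / d k) (Icc u v) :=
    continuousOn_const.div hdc.continuousOn hne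
  have hc' : ContinuousOn (fun k : ℝ => -(c * deriv d k) / d k ^ 2) (Icc u v) :=
    (continuous_const.mul hdc').neg.continuousOn.div (hdc.pow 2).continuousOn
      fun k hk => pow_ne_zero 2 (hne k hk)
  obtain ⟨M, hM⟩ := isCompact_Icc.exists_bound_of_continuousOn hc
  obtain ⟨M', hM'⟩ := isCompact_Icc.exists_bound_of_continuousOn
    (hc'.mul (g := fun k : ℝ => ((1 + k ^ 2 : ℝ) : ℂ)) (by fun_prop))
  refine ⟨_, oscBound_of_deriv huv (fun k hk => hasDerivAt_const_div_comp_ofReal hd c (hne k hk))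
    hc' hM (M' := M') fun k hk => ?_⟩
  have h := hM' k hk
  rw [Pi.mul_apply, norm_mul, Complex.norm_real, Real.norm_of_nonneg (by positivity)] at h
  rwa [← div_eq_mul_inv, le_div_iff₀ (by positivity)]

end Oscillatory

/-! ### Uniform bounds for the truncated evolution kernel -/

section KernelBound

open Filter Topology Set

variable {a α : ℝ}

/-- Compactness for bounded k away from 0, and |D_σ(k)| ≥ 2(|k| - |α|) ≥ |k| for |k| > 2|α| + 1. -/
theorem exists_bound_div_parityDenom (ha : 0 < a) (α : ℝ) {σ : ℝ} (hσ : |σ| = 1) :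
    ∃ B, ∀ k : ℝ, 1 ≤ |k| → ‖(k : ℂ) / parityDenom a α σ k‖ ≤ B := by
  set R := 2 * |α| + 1 with hR
  have hcomp : IsCompact (Icc (-R) R \ Ioo (-1) 1) := isCompact_Icc.diff isOpen_Ioo
  have hc : ContinuousOn (fun k : ℝ => (k : ℂ) / parityDenom a α σ k) (Icc (-R) R \ Ioo (-1) 1) := by
    refine Complex.continuous_ofReal.continuousOn.div
      ((differentiable_parityDenom a α σ).continuous.comp Complex.continuous_ofReal).continuousOn ?_
    rintro k ⟨-, hk⟩
    refine parityDenom_real_ne_zero hσ fun h => hk ?_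
    simp [h]
  obtain ⟨B, hB⟩ := hcomp.exists_bound_of_continuousOn hc
  refine ⟨max B 1, fun k hk => ?_⟩
  by_cases h : |k| ≤ R
  · refine (hB k ⟨abs_le.1 h, fun h' => ?_⟩).trans (le_max_left _ _)
    exact absurd (abs_lt.2 h') (not_lt.2 hk)
  · push Not at h
    have hkn : ‖(k : ℂ)‖ = |k| := by simp
    have hα := abs_nonneg α
    obtain ⟨h1, h2⟩ := parityDenom_ne_zero_of_large (κ := (k : ℂ)) (α := α) hσ.le ha (by simp)
      (by rw [hkn]; linarith)
    refine le_trans ?_ (le_max_right _ _)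
    rw [norm_div, div_le_one (norm_pos_iff.2 h2)]
    rw [hkn] at h1 ⊢
    linarith

theorem norm_deriv_parityDenom_le (ha : 0 < a) (α : ℝ) {σ : ℝ} (hσ : |σ| = 1) (k : ℝ) :
    ‖deriv (parityDenom a α σ) k‖ ≤ 2 + 2 * a * |α| := by
  rw [(hasDerivAt_parityDenom a α σ k).deriv]
  refine (norm_sub_le _ _).trans ?_
  have e : Complex.exp (2 * Complex.I * k * a) = Complex.exp (((2 * k * a : ℝ) : ℂ) * Complex.I) := by
    congr 1; push_cast; ring
  rw [e, norm_mul, Complex.norm_exp_ofReal_mul_I, mul_one, norm_mul, norm_mul, norm_mul,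
    Complex.norm_ofNat, Complex.norm_real, Complex.norm_real, Complex.norm_real,
    Real.norm_of_nonneg ha.le, Real.norm_eq_abs, Real.norm_eq_abs, hσ, mul_one]

/-- For |k| ≥ 1, 1/D_σ is O(1/|k|) and D_σ' is bounded, so the derivative of α/(2D_σ) is O(1/k²).
This gives one constant for all intervals there. -/
theorem exists_oscBound_high (ha : 0 < a) (α : ℝ) {σ : ℝ} (hσ : |σ| = 1) :
    ∃ C, ∀ u v : ℝ, u ≤ v → 1 ≤ u ∨ v ≤ -1 →
      OscBound (fun k => α / (2 * parityDenom a α σ k)) u v C := by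
  obtain ⟨B, hB⟩ := exists_bound_div_parityDenom ha α hσ
  set D' := 2 + 2 * a * |α| with hD'
  have hD'0 : 0 ≤ D' := by positivity
  refine ⟨6 * (|α| / 2 * B + 4 * (|α| * D' * B ^ 2)), fun u v huv h => ?_⟩
  have hk1 : ∀ k ∈ Icc u v, 1 ≤ |k| := by
    rintro k ⟨h1, h2⟩
    rcases h with h | h
    · exact (h.trans h1).trans (le_abs_self k)
    · exact le_abs.2 (Or.inr (by linarith))
  have hne : ∀ k ∈ Icc u v, parityDenom a α σ (k : ℝ) ≠ 0 := fun k hk =>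
    parityDenom_real_ne_zero hσ fun h0 => by
      have := hk1 k hk
      rw [h0, abs_zero] at this
      linarith
  have hd : Differentiable ℂ fun κ => 2 * parityDenom a α σ κ :=
    (differentiable_parityDenom a α σ).const_mul 2
  have hderiv : ∀ κ, deriv (fun κ => 2 * parityDenom a α σ κ) κ =
      2 * deriv (parityDenom a α σ) κ := fun κ =>
    deriv_const_mul 2 (differentiable_parityDenom a α σ κ)
  have hinv : ∀ k ∈ Icc u v, ‖parityDenom a α σ (k : ℝ)‖⁻¹ ≤ B * |k|⁻¹ := by
    intro k hk
    have h1 := hB k (hk1 k hk)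
    have h2 : 0 < |k| := by linarith [hk1 k hk]
    rw [norm_div, Complex.norm_real, Real.norm_eq_abs, div_eq_mul_inv, mul_comm] at h1
    rwa [← div_eq_mul_inv, le_div_iff₀ h2]
  have hB0 : 0 ≤ B := (norm_nonneg _).trans (hB 1 (by simp))
  have hdc : Continuous fun k : ℝ => 2 * parityDenom a α σ k :=
    hd.continuous.comp Complex.continuous_ofReal
  have hdc' : Continuous fun k : ℝ => deriv (fun κ => 2 * parityDenom a α σ κ) k :=
    (continuous_deriv_of_differentiable hd).comp Complex.continuous_ofReal
  refine oscBound_of_deriv huv (m' := fun k : ℝ =>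
      -(α * deriv (fun κ => 2 * parityDenom a α σ κ) k) / (2 * parityDenom a α σ k) ^ 2)
    (fun k hk => hasDerivAt_const_div_comp_ofReal hd α (mul_ne_zero two_ne_zero (hne k hk)))
    ((continuous_const.mul hdc').neg.continuousOn.div (hdc.pow 2).continuousOn
      fun k hk => pow_ne_zero 2 (mul_ne_zero two_ne_zero (hne k hk)))
    (fun k hk => ?_) (fun k hk => ?_)
  · rw [norm_div, norm_mul, Complex.norm_ofNat, Complex.norm_real, Real.norm_eq_abs, ← div_div,
      div_eq_mul_inv (|α| / 2)]
    gcongr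
    refine (hinv k hk).trans (mul_le_of_le_one_right hB0 (inv_le_one_of_one_le₀ (hk1 k hk)))
  · have h1 := hk1 k hk
    have h2 : 0 < |k| := by linarith
    rw [hderiv]
    calc ‖-(α * (2 * deriv (parityDenom a α σ) k)) / (2 * parityDenom a α σ k) ^ 2‖
        = |α| / 2 * ‖deriv (parityDenom a α σ) k‖ * (‖parityDenom a α σ k‖⁻¹) ^ 2 := by
          rw [norm_div, norm_neg, norm_pow, norm_mul, norm_mul, norm_mul, Complex.norm_ofNat,
            Complex.norm_real, Real.norm_eq_abs, inv_pow]
          ring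
      _ ≤ |α| / 2 * D' * (B * |k|⁻¹) ^ 2 := by
          gcongr
          · exact norm_deriv_parityDenom_le ha α hσ k
          · exact hinv k hk
      _ = |α| * D' * B ^ 2 * (2 * k ^ 2)⁻¹ := by
          rw [← sq_abs k]; ring
      _ ≤ |α| * D' * B ^ 2 * (1 + k ^ 2)⁻¹ := by
          gcongr
          rw [← sq_abs k]
          nlinarith

/-- The contribution of the waves of parity `σ` to `spectralKernel`. -/
def parityKernel (a α σ : ℝ) (κ : ℂ) (p : ℝ × ℝ) : ℂ :=
  α / (2 * parityDenom a α σ κ) * (parityWave a σ κ p.1 * parityWave a σ κ p.2)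

theorem spectralKernel_eq_add (a α : ℝ) (κ : ℂ) (p : ℝ × ℝ) :
    spectralKernel a α κ p = Complex.I * expKernel κ p.2 p.1 +
      (parityKernel a α 1 κ p + parityKernel a α (-1) κ p) := rfl

theorem measurable_parityKernel (a α σ : ℝ) :
    Measurable fun q : ℝ × ℝ × ℝ => parityKernel a α σ (q.1 : ℂ) q.2 := by
  unfold parityKernel parityWave parityDenom expKernel
  fun_prop

theorem measurable_spectralKernel (a α : ℝ) :
    Measurable fun q : ℝ × ℝ × ℝ => spectralKernel a α (q.1 : ℂ) q.2 := by
  have h1 := measurable_parityKernel a α 1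
  have h2 := measurable_parityKernel a α (-1)
  have h3 : Measurable fun q : ℝ × ℝ × ℝ => expKernel (q.1 : ℂ) q.2.2 q.2.1 := by
    unfold expKernel
    fun_prop
  simp only [spectralKernel_eq_add]
  fun_prop

theorem parityDenom_one_ne_zero (hα : α ≠ 0) (k : ℝ) : parityDenom a α 1 (k : ℂ) ≠ 0 := by
  by_cases hk : k = 0
  · simp [hk, parityDenom, hα]
  · exact parityDenom_real_ne_zero (by simp) hk

/-- The entire function `D₋(κ) / κ`. -/
def oddSlope (a α : ℝ) : ℂ → ℂ := dslope (parityDenom a α (-1)) 0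

theorem differentiable_oddSlope (a α : ℝ) : Differentiable ℂ (oddSlope a α) := by
  rw [oddSlope, ← differentiableOn_univ, Complex.differentiableOn_dslope univ_mem,
    differentiableOn_univ]
  exact differentiable_parityDenom a α (-1)

theorem mul_oddSlope (a α : ℝ) (κ : ℂ) : κ * oddSlope a α κ = parityDenom a α (-1) κ := by
  have h := sub_smul_dslope (parityDenom a α (-1)) 0 κ
  have h0 : parityDenom a α (-1) 0 = 0 := by simp [parityDenom]
  rwa [sub_zero, h0, sub_zero, smul_eq_mul] at h

/-- Off zero this is the absence of real zeros of D₋; at zero the value is D₋'(0) = 2(1 + aα), where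
aα ≠ -1 is decisive. -/
theorem oddSlope_ne_zero (haα : a * α ≠ -1) (k : ℝ) : oddSlope a α k ≠ 0 := by
  by_cases hk : k = 0
  · rw [hk, oddSlope, Complex.ofReal_zero, dslope_same, (hasDerivAt_parityDenom a α (-1) 0).deriv,
      mul_zero, zero_mul, Complex.exp_zero]
    intro h
    apply haα
    have h1 : (2 + 2 * (a * α) : ℂ) = 0 := by
      push_cast at h
      linear_combination h
    have h2 : 2 + 2 * (a * α) = 0 := by exact_mod_cast h1
    linarith
  · intro h
    have h1 := mul_oddSlope a α k
    rw [h, mul_zero] at h1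
    exact parityDenom_real_ne_zero (by simp) hk h1.symm

/-- In the odd case one of the two waves supplies a factor |k|, enough to bound k/D₋(k). The even
denominator has no real zero when α ≠ 0. -/
theorem exists_norm_parityKernel_le (ha : 0 < a) (haα : a * α ≠ -1) {σ : ℝ}
    (hσ : σ = 1 ∨ σ = -1) :
    ∃ B, ∀ k : ℝ, k ≠ 0 → ∀ p : ℝ × ℝ, ‖parityKernel a α σ k p‖ ≤ B := by
  have hσ1 : |σ| = 1 := by rcases hσ with h | h <;> simp [h]
  obtain ⟨B, hB⟩ := exists_bound_div_parityDenom ha α hσ1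
  have hw : ∀ (k : ℝ) x, ‖parityWave a σ k x‖ ≤ 2 := fun k x =>
    norm_parityWave_le a hσ1 (by simp) x
  rcases hσ with rfl | rfl
  · by_cases hα : α = 0
    · exact ⟨0, fun k _ p => by simp [parityKernel, hα]⟩
    have hc : Continuous fun k : ℝ => (parityDenom a α 1 k)⁻¹ :=
      ((differentiable_parityDenom a α 1).continuous.comp Complex.continuous_ofReal).inv₀
        (parityDenom_one_ne_zero hα)
    obtain ⟨B', hB'⟩ := (isCompact_Icc (a := (-1 : ℝ)) (b := 1)).exists_bound_of_continuousOn
      hc.continuousOn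
    refine ⟨|α| / 2 * max B B' * (2 * 2), fun k _ p => ?_⟩
    have h1 : ‖(parityDenom a α 1 k)⁻¹‖ ≤ max B B' := by
      by_cases hk : |k| ≤ 1
      · exact (hB' k (abs_le.1 hk)).trans (le_max_right _ _)
      · push Not at hk
        refine le_trans ?_ ((hB k hk.le).trans (le_max_left _ _))
        rw [div_eq_mul_inv, norm_mul, Complex.norm_real, Real.norm_eq_abs]
        exact le_mul_of_one_le_left (norm_nonneg _) hk.le
    rw [parityKernel, ← div_div, div_eq_mul_inv _ (parityDenom a α 1 k), norm_mul, norm_mul,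
      norm_mul, norm_div, Complex.norm_real, Complex.norm_ofNat, Real.norm_eq_abs]
    have := (norm_nonneg _).trans h1
    gcongr
    · exact hw k _
    · exact hw k _
  · have hc : Continuous fun k : ℝ => (oddSlope a α k)⁻¹ :=
      ((differentiable_oddSlope a α).continuous.comp Complex.continuous_ofReal).inv₀
        (oddSlope_ne_zero haα)
    obtain ⟨B', hB'⟩ := (isCompact_Icc (a := (-1 : ℝ)) (b := 1)).exists_bound_of_continuousOn
      hc.continuousOn
    refine ⟨|α| / 2 * max B B' * (2 * a * 2), fun k hk0 p => ?_⟩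
    have hk0' : (k : ℂ) ≠ 0 := by exact_mod_cast hk0
    have h1 : ‖(k : ℂ) / parityDenom a α (-1) k‖ ≤ max B B' := by
      by_cases hk : |k| ≤ 1
      · refine le_trans (le_of_eq ?_) ((hB' k (abs_le.1 hk)).trans (le_max_right _ _))
        rw [← mul_oddSlope, div_mul_cancel_left₀ hk0']
      · push Not at hk
        exact (hB k hk.le).trans (le_max_left _ _)
    have h2 : ‖parityWave a (-1) k p.1‖ ≤ 2 * a * |k| := by
      have := norm_parityWave_odd_le ha (κ := (k : ℂ)) (by simp) p.1
      simpa using this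
    have h3 : ‖(k : ℂ) / parityDenom a α (-1) k‖ = |k| * ‖parityDenom a α (-1) k‖⁻¹ := by
      rw [norm_div, Complex.norm_real, Real.norm_eq_abs, div_eq_mul_inv]
    rw [h3] at h1
    rw [parityKernel, ← div_div, div_eq_mul_inv _ (parityDenom a α (-1) k), norm_mul, norm_mul,
      norm_mul, norm_div, Complex.norm_real, Complex.norm_ofNat, Real.norm_eq_abs, norm_inv]
    calc |α| / 2 * ‖parityDenom a α (-1) k‖⁻¹ *
          (‖parityWave a (-1) k p.1‖ * ‖parityWave a (-1) k p.2‖)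
        ≤ |α| / 2 * ‖parityDenom a α (-1) k‖⁻¹ * ((2 * a * |k|) * 2) := by
          gcongr
          exact hw k _
      _ = |α| / 2 * (|k| * ‖parityDenom a α (-1) k‖⁻¹) * (2 * a * 2) := by ring
      _ ≤ _ := by gcongr

theorem exists_norm_spectralKernel_le (ha : 0 < a) (haα : a * α ≠ -1) :
    ∃ B, ∀ k : ℝ, k ≠ 0 → ∀ p : ℝ × ℝ, ‖spectralKernel a α k p‖ ≤ B := by
  obtain ⟨B₁, h₁⟩ := exists_norm_parityKernel_le ha haα (Or.inl rfl)
  obtain ⟨B₂, h₂⟩ := exists_norm_parityKernel_le ha haα (Or.inr rfl)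
  refine ⟨1 + (B₁ + B₂), fun k hk p => ?_⟩
  rw [spectralKernel_eq_add]
  refine (norm_add_le _ _).trans (add_le_add ?_ ((norm_add_le _ _).trans
    (add_le_add (h₁ k hk p) (h₂ k hk p))))
  rw [norm_mul, Complex.norm_I, one_mul]
  exact norm_expKernel_le_one (by simp) _ _

theorem intervalIntegrable_of_measurable_of_bound {F : ℝ → ℂ} (hF : Measurable F) {B : ℝ}
    (hB : ∀ k, k ≠ 0 → ‖F k‖ ≤ B) (u v : ℝ) : IntervalIntegrable F volume u v := by
  rw [intervalIntegrable_iff]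
  refine Measure.integrableOn_of_bounded (M := B) (by simp [uIoc])
    hF.aestronglyMeasurable (ae_restrict_of_ae ?_)
  filter_upwards [ae_ne_zero_real] with k hk using hB k hk

theorem intervalIntegrable_parityKernel_mul (ha : 0 < a) (haα : a * α ≠ -1) {σ : ℝ}
    (hσ : σ = 1 ∨ σ = -1) (t : ℝ) (p : ℝ × ℝ) (u v : ℝ) :
    IntervalIntegrable (fun k : ℝ => parityKernel a α σ k p * quadPhase t 0 k) volume u v := by
  obtain ⟨B, hB⟩ := exists_norm_parityKernel_le ha haα hσ
  have h1 : Measurable fun k : ℝ => parityKernel a α σ k p := by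
    unfold parityKernel parityWave parityDenom expKernel
    fun_prop
  refine intervalIntegrable_of_measurable_of_bound (B := B)
    (h1.mul (continuous_quadPhase_right t 0).measurable) (fun k hk => ?_) u v
  rw [Pi.mul_apply, norm_mul, norm_quadPhase, mul_one]
  exact hB k hk p

theorem expKernel_mul_quadPhase (c x t r k : ℝ) :
    expKernel (k : ℂ) c x * quadPhase t r k = quadPhase t (|x - c| + r) k := by
  rw [expKernel, quadPhase, quadPhase, ← Complex.exp_add]
  congr 1
  push_cast
  ring

/-- The product of two waves is a sum of four exponentials e^{ikr}. Each merges with the linear part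
of the phase, and `OscBound` is uniform in r. -/
theorem norm_integral_mul_parityWave_le {m : ℝ → ℂ} {u v C : ℝ} (hm : OscBound m u v C)
    (hi : IntervalIntegrable m volume u v) {σ : ℝ} (hσ : |σ| = 1) {t : ℝ} (ht : 0 < t)
    (p : ℝ × ℝ) :
    ‖∫ k in u..v, m k * (parityWave a σ k p.1 * parityWave a σ k p.2) * quadPhase t 0 k‖ ≤
      4 * C / √t := by
  have hq : ∀ r, IntervalIntegrable (fun k => m k * quadPhase t r k) volume u v := fun r =>
    hi.mul_continuousOn (continuous_quadPhase_right t r).continuousOn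
  set r₁ := |p.1 - a| + (|p.2 - a| + 0)
  set r₂ := |p.1 - a| + (|p.2 - -a| + 0)
  set r₃ := |p.1 - -a| + (|p.2 - a| + 0)
  set r₄ := |p.1 - -a| + (|p.2 - -a| + 0)
  have e : ∀ k : ℝ, m k * (parityWave a σ k p.1 * parityWave a σ k p.2) * quadPhase t 0 k =
      (m k * quadPhase t r₁ k + σ * (m k * quadPhase t r₂ k)) +
      (σ * (m k * quadPhase t r₃ k) + σ ^ 2 * (m k * quadPhase t r₄ k)) := by
    intro k
    simp only [parityWave, r₁, r₂, r₃, r₄, ← expKernel_mul_quadPhase]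
    ring
  rw [intervalIntegral.integral_congr fun k _ => e k, intervalIntegral.integral_add
    ((hq _).add ((hq _).const_mul _)) (((hq _).const_mul _).add ((hq _).const_mul _)),
    intervalIntegral.integral_add (hq _) ((hq _).const_mul _),
    intervalIntegral.integral_add ((hq _).const_mul _) ((hq _).const_mul _),
    intervalIntegral.integral_const_mul, intervalIntegral.integral_const_mul,
    intervalIntegral.integral_const_mul]
  have hs : ‖(σ : ℂ)‖ = 1 := by simpa using hσ
  refine (norm_add_le _ _).trans ((add_le_add (norm_add_le _ _) (norm_add_le _ _)).trans ?_)
  rw [norm_mul, norm_mul, norm_mul, norm_pow, hs, one_pow, one_mul, one_mul, one_mul]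
  have := hm t ht
  calc _ ≤ (C / √t + C / √t) + (C / √t + C / √t) :=
        add_le_add (add_le_add (this _) (this _)) (add_le_add (this _) (this _))
    _ = _ := by ring

/-- Extracts the factor k that cancels the zero of D₋, at the price of an average over an interval
of length at most 2a. -/
theorem parityWave_odd_eq_integral {k : ℝ} (hk : k ≠ 0) (x : ℝ) :
    parityWave a (-1) k x =
      k * (Complex.I * ∫ s in |x - -a|..|x - a|, Complex.exp (Complex.I * k * s)) := by
  have hk' : Complex.I * (k : ℂ) ≠ 0 := mul_ne_zero Complex.I_ne_zero (by exact_mod_cast hk)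
  rw [integral_exp_mul_complex hk', parityWave, expKernel, expKernel]
  have hk0 : (k : ℂ) ≠ 0 := by exact_mod_cast hk
  field_simp
  push_cast
  ring

/-- The weight α/(2D₋) is singular at 0 and cannot be treated alone. Writing one wave as k times an
integral of e^{iks} leaves the smooth weight (iα/2)/(D₋(k)/k). Exchanging the integrals, each s
costs 2C/√t and s ranges over length at most 2a. -/
theorem exists_integral_odd_low (ha : 0 < a) (haα : a * α ≠ -1) :
    ∃ C, ∀ t : ℝ, 0 < t → ∀ p : ℝ × ℝ,
      ‖∫ k in (-1)..1, parityKernel a α (-1) k p * quadPhase t 0 k‖ ≤ C / √t := by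
  have hd := differentiable_oddSlope a α
  set M : ℝ → ℂ := fun k => (Complex.I * α / 2) / oddSlope a α k with hM
  have hMc : Continuous M := continuous_const.div
    (hd.continuous.comp Complex.continuous_ofReal) (oddSlope_ne_zero haα)
  obtain ⟨C, hC⟩ := exists_oscBound_of_ne_zero hd (Complex.I * α / 2) (u := -1) (v := 1)
    (by norm_num) fun k _ => oddSlope_ne_zero haα k
  refine ⟨2 * C * (2 * a), fun t ht p => ?_⟩
  set s₁ := |p.1 - -a|
  set s₂ := |p.1 - a|
  set F : ℝ → ℝ → ℂ := fun k s => M k * quadPhase t (s + |p.2 - a|) k -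
    M k * quadPhase t (s + |p.2 - -a|) k with hF
  have hFc : Continuous F.uncurry := by
    have h1 := (continuous_quadPhase t).comp
      (by fun_prop : Continuous fun q : ℝ × ℝ => (q.2 + |p.2 - a|, q.1))
    have h2 := (continuous_quadPhase t).comp
      (by fun_prop : Continuous fun q : ℝ × ℝ => (q.2 + |p.2 - -a|, q.1))
    exact ((hMc.comp continuous_fst).mul h1).sub ((hMc.comp continuous_fst).mul h2)
  have e : ∀ k : ℝ, k ≠ 0 → parityKernel a α (-1) k p * quadPhase t 0 k =
      ∫ s in s₁..s₂, F k s := by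
    intro k hk
    have hk' : (k : ℂ) ≠ 0 := by exact_mod_cast hk
    have e1 : ∀ s : ℝ, F k s = M k * (parityWave a (-1) k p.2 * quadPhase t 0 k) *
        Complex.exp (Complex.I * k * s) := by
      intro s
      have e2 : ∀ r, quadPhase t (s + r) k =
          Complex.exp (Complex.I * k * s) * quadPhase t (r + 0) k := by
        intro r
        rw [quadPhase, quadPhase, ← Complex.exp_add]
        congr 1
        push_cast
        ring
      simp only [hF, e2, ← expKernel_mul_quadPhase, parityWave]
      push_cast
      ring
    simp only [e1]
    rw [intervalIntegral.integral_const_mul, parityKernel, parityWave_odd_eq_integral hk p.1,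
      ← mul_oddSlope, hM]
    have := oddSlope_ne_zero haα k
    field_simp
    ring
  have e' : ∫ k in (-1)..1, parityKernel a α (-1) k p * quadPhase t 0 k =
      ∫ k in (-1)..1, ∫ s in s₁..s₂, F k s := by
    refine intervalIntegral.integral_congr_ae ?_
    filter_upwards [ae_ne_zero_real] with k hk _ using e k hk
  rw [e', intervalIntegral_intervalIntegral_swap]
  · have hb : ∀ s, ‖∫ k in (-1)..1, F k s‖ ≤ 2 * C / √t := by
      intro s
      have hi : ∀ r, IntervalIntegrable (fun k => M k * quadPhase t r k) volume (-1) 1 := fun r =>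
        (hMc.mul (continuous_quadPhase_right t r)).intervalIntegrable _ _
      simp only [hF]
      rw [intervalIntegral.integral_sub (hi _) (hi _)]
      refine (norm_sub_le _ _).trans ((add_le_add (hC t ht _) (hC t ht _)).trans (le_of_eq ?_))
      ring
    have h1 := intervalIntegral.norm_integral_le_of_norm_le_const (a := s₁) (b := s₂)
      fun s _ => hb s
    refine h1.trans ?_
    have h2 : |s₂ - s₁| ≤ 2 * a := by
      have h3 := abs_abs_sub_abs_le_abs_sub (p.1 - a) (p.1 - -a)
      rwa [show p.1 - a - (p.1 - -a) = -(2 * a) by ring, abs_neg,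
        abs_of_pos (by linarith : 0 < 2 * a)] at h3
    have h4 := (norm_nonneg _).trans (hb 0)
    calc 2 * C / √t * |s₂ - s₁| ≤ 2 * C / √t * (2 * a) := by gcongr
      _ = _ := by ring
  · exact (hFc.continuousOn.integrableOn_compact (isCompact_uIcc.prod isCompact_uIcc)).mono_set
      (prod_mono uIoc_subset_uIcc uIoc_subset_uIcc)

theorem exists_integral_even_low (a α : ℝ) :
    ∃ C, ∀ t : ℝ, 0 < t → ∀ p : ℝ × ℝ,
      ‖∫ k in (-1)..1, parityKernel a α 1 k p * quadPhase t 0 k‖ ≤ C / √t := by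
  by_cases hα : α = 0
  · exact ⟨0, fun t _ p => by simp [parityKernel, hα]⟩
  have hne : ∀ k : ℝ, 2 * parityDenom a α 1 k ≠ 0 := fun k =>
    mul_ne_zero two_ne_zero (parityDenom_one_ne_zero hα k)
  have hd : Differentiable ℂ fun κ => 2 * parityDenom a α 1 κ :=
    (differentiable_parityDenom a α 1).const_mul 2
  obtain ⟨C, hC⟩ := exists_oscBound_of_ne_zero hd α (u := -1) (v := 1) (by norm_num)
    fun k _ => hne k
  exact ⟨4 * C, fun t ht p => norm_integral_mul_parityWave_le hC
    ((continuous_const.div (hd.continuous.comp Complex.continuous_ofReal) hne).intervalIntegrable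
      _ _) (by simp) ht p⟩

theorem exists_integral_parityKernel_le (ha : 0 < a) (haα : a * α ≠ -1) {σ : ℝ}
    (hσ : σ = 1 ∨ σ = -1) :
    ∃ C, ∀ t : ℝ, 0 < t → ∀ K : ℝ, 1 ≤ K → ∀ p : ℝ × ℝ,
      ‖∫ k in (-K)..K, parityKernel a α σ k p * quadPhase t 0 k‖ ≤ C / √t := by
  have hσ1 : |σ| = 1 := by rcases hσ with h | h <;> simp [h]
  obtain ⟨C₀, h₀⟩ : ∃ C, ∀ t : ℝ, 0 < t → ∀ p : ℝ × ℝ,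
      ‖∫ k in (-1)..1, parityKernel a α σ k p * quadPhase t 0 k‖ ≤ C / √t := by
    rcases hσ with rfl | rfl
    · exact exists_integral_even_low a α
    · exact exists_integral_odd_low ha haα
  obtain ⟨C, hC⟩ := exists_oscBound_high ha α hσ1
  refine ⟨4 * C + C₀ + 4 * C, fun t ht K hK p => ?_⟩
  have hi : ∀ u v, IntervalIntegrable (fun k : ℝ => parityKernel a α σ k p * quadPhase t 0 k)
      volume u v :=
    intervalIntegrable_parityKernel_mul ha haα hσ t p
  have hm : ∀ u v : ℝ, u ≤ v → 1 ≤ u ∨ v ≤ -1 →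
      ‖∫ k in u..v, parityKernel a α σ k p * quadPhase t 0 k‖ ≤ 4 * C / √t := by
    intro u v huv h
    refine norm_integral_mul_parityWave_le (hC u v huv h) ?_ hσ1 ht p
    refine ContinuousOn.intervalIntegrable ?_
    rw [uIcc_of_le huv]
    refine continuousOn_const.div (((differentiable_parityDenom a α σ).continuous.comp
      Complex.continuous_ofReal).const_smul (2 : ℂ)).continuousOn fun k hk => ?_
    refine mul_ne_zero two_ne_zero (parityDenom_real_ne_zero hσ1 ?_)
    rintro rfl
    rcases h with h | h
    · linarith [hk.1]
    · linarith [hk.2]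
  rw [← intervalIntegral.integral_add_adjacent_intervals (hi (-K) 1) (hi 1 K),
    ← intervalIntegral.integral_add_adjacent_intervals (hi (-K) (-1)) (hi (-1) 1)]
  refine (norm_add_le _ _).trans ((add_le_add_left (norm_add_le _ _) _).trans ?_)
  rw [add_div, add_div]
  exact add_le_add (add_le_add (hm _ _ (by linarith) (Or.inr le_rfl)) (h₀ t ht p))
    (hm _ _ hK (Or.inl le_rfl))

/-- The truncated kernels of `e^{-itH}` are bounded by `C / √t`, uniformly in the truncation. -/
theorem exists_integral_spectralKernel_le (ha : 0 < a) (haα : a * α ≠ -1) :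
    ∃ C, ∀ t : ℝ, 0 < t → ∀ K : ℝ, 1 ≤ K → ∀ p : ℝ × ℝ,
      ‖∫ k in (-K)..K, spectralKernel a α k p * quadPhase t 0 k‖ ≤ C / √t := by
  obtain ⟨C₁, h₁⟩ := exists_integral_parityKernel_le ha haα (Or.inl rfl)
  obtain ⟨C₂, h₂⟩ := exists_integral_parityKernel_le ha haα (Or.inr rfl)
  refine ⟨6 + (C₁ + C₂), fun t ht K hK p => ?_⟩
  have hi : ∀ σ : ℝ, σ = 1 ∨ σ = -1 →
      IntervalIntegrable (fun k : ℝ => parityKernel a α σ k p * quadPhase t 0 k)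
        volume (-K) K := fun σ hσ => intervalIntegrable_parityKernel_mul ha haα hσ t p _ _
  have e : ∀ k : ℝ, spectralKernel a α k p * quadPhase t 0 k =
      Complex.I * quadPhase t (|p.1 - p.2| + 0) k + (parityKernel a α 1 k p * quadPhase t 0 k +
        parityKernel a α (-1) k p * quadPhase t 0 k) := by
    intro k
    rw [spectralKernel_eq_add, ← expKernel_mul_quadPhase]
    ring
  rw [intervalIntegral.integral_congr fun k _ => e k, intervalIntegral.integral_add
    (((continuous_quadPhase_right t _).intervalIntegrable _ _).const_mul _)
    ((hi 1 (Or.inl rfl)).add (hi (-1) (Or.inr rfl))),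
    intervalIntegral.integral_add (hi 1 (Or.inl rfl)) (hi (-1) (Or.inr rfl)),
    intervalIntegral.integral_const_mul]
  refine (norm_add_le _ _).trans ((add_le_add_right (norm_add_le _ _) _).trans ?_)
  rw [norm_mul, Complex.norm_I, one_mul, add_div, add_div]
  exact add_le_add (norm_integral_quadPhase_le ht _ (by linarith))
    (add_le_add (h₁ t ht K hK p) (h₂ t ht K hK p))

end KernelBound

/-! ### From the quadratic form to the L¹–L^∞ bound -/

section Dispersive

open Filter Topology Set

variable {a α : ℝ}

theorem intervalIntegral_spectralFun (ha : 0 < a) (haα : a * α ≠ -1) {f : ℝ → ℂ}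
    (hf : Integrable f) (t u v : ℝ) :
    ∫ k in u..v, spectralFun a α f k * quadPhase t 0 k =
      ∫ p : ℝ × ℝ, conj (f p.1) * f p.2 * ∫ k in u..v, spectralKernel a α k p * quadPhase t 0 k := by
  obtain ⟨B, hB⟩ := exists_norm_spectralKernel_le ha haα
  have hone : Integrable (fun _ : ℝ => (1 : ℂ)) (volume.restrict (uIoc u v)) :=
    integrable_const_iff.2 (Or.inr ⟨by simp [uIoc]⟩)
  have hm : Measurable fun q : ℝ × ℝ × ℝ => spectralKernel a α (q.1 : ℂ) q.2 * quadPhase t 0 q.1 :=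
    (measurable_spectralKernel a α).mul
      ((continuous_quadPhase_right t 0).measurable.comp measurable_fst)
  have hae : ∀ᵐ q : ℝ × ℝ × ℝ ∂((volume.restrict (uIoc u v)).prod (volume.prod volume)),
      q.1 ≠ 0 :=
    Measure.quasiMeasurePreserving_fst.ae (ae_restrict_of_ae ae_ne_zero_real)
  have hint := (hone.mul_prod (integrable_conj_mul_prod hf)).mul_bdd (c := B)
    hm.aestronglyMeasurable (by
      filter_upwards [hae] with q hq
      rw [norm_mul, norm_quadPhase, mul_one]
      exact hB q.1 hq q.2)
  have hswap := intervalIntegral_integral_swap (a := u) (b := v) (μ := volume.prod volume)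
    (f := fun (k : ℝ) (p : ℝ × ℝ) =>
      1 * (conj (f p.1) * f p.2) * (spectralKernel a α k p * quadPhase t 0 k)) hint
  simp only [one_mul] at hswap
  calc _ = ∫ k in u..v, ∫ p : ℝ × ℝ, conj (f p.1) * f p.2 *
        (spectralKernel a α k p * quadPhase t 0 k) ∂(volume.prod volume) := by
        refine intervalIntegral.integral_congr fun k _ => ?_
        rw [spectralFun, ← integral_mul_const]
        simp only [mul_assoc]
    _ = _ := hswap
    _ = _ := by
        simp only [intervalIntegral.integral_const_mul]
        rfl

/-- The kernel is not absolutely integrable in k, so Fubini is used on [-K, K] only, where the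
oscillatory bound is uniform in K. Integrability of the density then allows K → ∞. -/
theorem exists_norm_inner_self_le (ha : 0 < a) (haα : a * α ≠ -1) :
    ∃ C, 0 ≤ C ∧ ∀ U : ℝ → Lp ℂ 2 (volume : Measure ℝ) →L[ℂ] Lp ℂ 2 (volume : Measure ℝ),
      IsSchrodingerGroup (deltaHamiltonian a α) U → ∀ t : ℝ, 0 < t →
      ∀ f : Lp ℂ 2 (volume : Measure ℝ), Integrable f → f ∈ (boundSpace a α)ᗮ →
        ‖inner ℂ f (U t f)‖ ≤ C / √t * (∫ x, ‖f x‖) ^ 2 := by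
  obtain ⟨C, hC⟩ := exists_integral_spectralKernel_le ha haα
  have hC0 : 0 ≤ C := by
    have := (norm_nonneg _).trans (hC 1 one_pos 1 le_rfl (0, 0))
    simpa using this
  refine ⟨C, hC0, fun U hU t ht f hf hfb => ?_⟩
  obtain ⟨⟨B, hB⟩, -⟩ := exists_norm_spectralFun_le ha haα hf hfb
  have hρ : Integrable fun k => (spectralDensity a α f k : ℂ) :=
    (integrable_spectralDensity ha haα hf hfb).ofReal
  have hqe : ∀ k : ℝ, Complex.exp (-Complex.I * t * (k ^ 2 : ℝ)) = quadPhase t 0 k := fun k => by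
    rw [quadPhase]; congr 1; push_cast; ring
  have hqneg : ∀ k : ℝ, quadPhase t 0 (-k) = quadPhase t 0 k := fun k => by
    simp [quadPhase]
  have hformula := hU.inner_apply_eq_integral ha haα hf hfb ht
  simp only [hqe] at hformula
  have hρi : Integrable fun k => (spectralDensity a α f k : ℂ) * quadPhase t 0 k :=
    hρ.mul_bdd (continuous_quadPhase_right t 0).aestronglyMeasurable
      (ae_of_all _ fun k => (norm_quadPhase t 0 k).le)
  have hlim := intervalIntegral_tendsto_integral hρi (l := atTop) (a := fun K : ℝ => -K)
    (b := fun K => K) tendsto_neg_atTop_atBot tendsto_id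
  rw [← hformula] at hlim
  have hmi : ∀ u v, IntervalIntegrable (fun k : ℝ => spectralFun a α f k * quadPhase t 0 k)
      volume u v := by
    intro u v
    rw [intervalIntegrable_iff]
    refine Measure.integrableOn_of_bounded (M := B) (by simp [uIoc])
      ((aestronglyMeasurable_spectralFun a α hf).mul
        (continuous_quadPhase_right t 0).aestronglyMeasurable) (ae_restrict_of_ae ?_)
    filter_upwards [ae_ne_zero_real] with k hk
    rw [norm_mul, norm_quadPhase, mul_one]
    exact hB k hk
  refine le_of_tendsto hlim.norm ?_
  filter_upwards [eventually_ge_atTop 1] with K hK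
  have hneg : ∫ k in (-K)..K, spectralFun a α f ((-k : ℝ) : ℂ) * quadPhase t 0 k =
      ∫ k in (-K)..K, spectralFun a α f k * quadPhase t 0 k := by
    have h := intervalIntegral.integral_comp_neg (a := -K) (b := K)
      (fun k : ℝ => spectralFun a α f k * quadPhase t 0 k)
    simpa only [hqneg, neg_neg] using h
  have hmi' : IntervalIntegrable (fun k : ℝ => spectralFun a α f ((-k : ℝ) : ℂ) * quadPhase t 0 k)
      volume (-K) K := by
    have h := (IntervalIntegrable.iff_comp_neg enorm_ne_top).1 (hmi (-K) K)
    simp only [hqneg, neg_neg] at h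
    exact h.symm
  have hpi : (Real.pi : ℂ) ≠ 0 := by exact_mod_cast Real.pi_ne_zero
  -- The density is the even part of `spectralFun` divided by 2πi, and the phase e^{-itk²} is even,
  -- so over a symmetric interval the odd part drops out.
  have e : ∫ k in (-K)..K, (spectralDensity a α f k : ℂ) * quadPhase t 0 k =
      (2 * Real.pi * Complex.I)⁻¹ * ∫ k in (-K)..K, spectralFun a α f k * quadPhase t 0 k := by
    have e1 : ∀ k : ℝ, (spectralDensity a α f k : ℂ) * quadPhase t 0 k =
        (4 * Real.pi * Complex.I)⁻¹ * (spectralFun a α f k * quadPhase t 0 k +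
          spectralFun a α f ((-k : ℝ) : ℂ) * quadPhase t 0 k) := by
      intro k
      rw [← add_mul, ← two_pi_I_mul_spectralDensity, ← mul_assoc, ← mul_assoc]
      congr 1
      field_simp
      ring
    rw [intervalIntegral.integral_congr fun k _ => e1 k, intervalIntegral.integral_const_mul,
      intervalIntegral.integral_add (hmi _ _) hmi', hneg]
    field_simp
    ring
  rw [e, intervalIntegral_spectralFun ha haα hf, norm_mul]
  have h1 : ‖(2 * Real.pi * Complex.I : ℂ)⁻¹‖ ≤ 1 := by
    rw [norm_inv, norm_mul, norm_mul, Complex.norm_I, Complex.norm_ofNat, Complex.norm_real,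
      Real.norm_of_nonneg Real.pi_pos.le]
    exact inv_le_one_of_one_le₀ (by linarith [Real.pi_gt_three])
  have hfn : Integrable fun p : ℝ × ℝ => ‖f p.1‖ * ‖f p.2‖ * (C / √t) :=
    (hf.norm.mul_prod hf.norm).mul_const _
  have h2 : ‖∫ p : ℝ × ℝ, conj (f p.1) * f p.2 *
      ∫ k in (-K)..K, spectralKernel a α k p * quadPhase t 0 k‖ ≤ C / √t * (∫ x, ‖f x‖) ^ 2 := by
    refine (norm_integral_le_of_norm_le hfn (ae_of_all _ fun p => ?_)).trans (le_of_eq ?_)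
    · rw [norm_mul, norm_mul, RCLike.norm_conj]
      gcongr
      exact hC t ht K hK p
    · rw [integral_mul_const]
      have := integral_prod_mul (μ := volume) (ν := volume) (fun x => ‖f x‖) (fun x => ‖f x‖)
      rw [← Measure.volume_eq_prod] at this
      rw [this]
      ring
  calc _ ≤ 1 * (C / √t * (∫ x, ‖f x‖) ^ 2) := by gcongr
    _ = _ := one_mul _

theorem Lp_two_integrable_add {f g : Lp ℂ 2 (volume : Measure ℝ)} (hf : Integrable f)
    (hg : Integrable g) : Integrable (f + g : Lp ℂ 2 (volume : Measure ℝ)) ∧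
      ∫ x, ‖(f + g : Lp ℂ 2 (volume : Measure ℝ)) x‖ ≤ (∫ x, ‖f x‖) + ∫ x, ‖g x‖ := by
  refine ⟨(hf.add hg).congr (Lp.coeFn_add f g).symm, ?_⟩
  rw [← integral_add hf.norm hg.norm]
  refine integral_mono_of_nonneg (ae_of_all _ fun _ => norm_nonneg _) (hf.norm.add hg.norm) ?_
  filter_upwards [Lp.coeFn_add f g] with x hx
  rw [hx]
  exact norm_add_le _ _

theorem Lp_two_integrable_smul {f : Lp ℂ 2 (volume : Measure ℝ)} (hf : Integrable f) (c : ℂ) :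
    Integrable (c • f : Lp ℂ 2 (volume : Measure ℝ)) ∧
      ∫ x, ‖(c • f : Lp ℂ 2 (volume : Measure ℝ)) x‖ = ‖c‖ * ∫ x, ‖f x‖ := by
  refine ⟨(hf.smul c).congr (Lp.coeFn_smul c f).symm, ?_⟩
  rw [← integral_const_mul]
  refine integral_congr_ae ?_
  filter_upwards [Lp.coeFn_smul c f] with x hx
  rw [hx, Pi.smul_apply, norm_smul]

/-- Polarization after scaling both L¹ norms to 1: each of the four combinations f + cg has L¹ norm
at most 2, hence form at most 4C, and the four are divided by 4. The scaling yields the product of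
norms instead of a sum of squares. -/
theorem norm_inner_le_of_quadratic_bound {S : Submodule ℂ (Lp ℂ 2 (volume : Measure ℝ))}
    {V : Lp ℂ 2 (volume : Measure ℝ) →L[ℂ] Lp ℂ 2 (volume : Measure ℝ)} {C : ℝ} (hC : 0 ≤ C)
    (h : ∀ f ∈ S, Integrable f → ‖inner ℂ f (V f)‖ ≤ C * (∫ x, ‖f x‖) ^ 2)
    {f g : Lp ℂ 2 (volume : Measure ℝ)} (hf : Integrable f) (hfS : f ∈ S) (hg : Integrable g)
    (hgS : g ∈ S) : ‖inner ℂ f (V g)‖ ≤ 4 * C * (∫ x, ‖f x‖) * ∫ x, ‖g x‖ := by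
  have h2 : ∀ f ∈ S, ∀ g ∈ S, Integrable f → Integrable g → (∫ x, ‖f x‖) ≤ 1 →
      (∫ x, ‖g x‖) ≤ 1 → ‖inner ℂ f (V g)‖ ≤ 4 * C := by
    intro f hfS g hgS hf hg hf1 hg1
    have key : ∀ c : ℂ, ‖c‖ = 1 → ‖inner ℂ (V (f + c • g)) (f + c • g)‖ ≤ 4 * C := by
      intro c hc
      have hcg := Lp_two_integrable_smul hg c
      have ha := Lp_two_integrable_add hf hcg.1
      rw [norm_inner_symm]
      refine (h _ (S.add_mem hfS (S.smul_mem c hgS)) ha.1).trans ?_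
      have h0 : 0 ≤ ∫ x, ‖(f + c • g : Lp ℂ 2 (volume : Measure ℝ)) x‖ :=
        integral_nonneg fun _ => norm_nonneg _
      have h1 : ∫ x, ‖(f + c • g : Lp ℂ 2 (volume : Measure ℝ)) x‖ ≤ 2 := by
        refine ha.2.trans ?_
        rw [hcg.2, hc, one_mul]
        linarith
      calc C * _ ≤ C * 2 ^ 2 := by gcongr
        _ = _ := by ring
    have hpol := inner_map_polarization (V : Lp ℂ 2 (volume : Measure ℝ) →ₗ[ℂ] _) f g
    simp only [ContinuousLinearMap.coe_coe] at hpol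
    rw [norm_inner_symm, hpol, norm_div, Complex.norm_ofNat, div_le_iff₀ (by norm_num)]
    have k1 := key 1 (by simp)
    have k2 := key (-1) (by simp)
    have k3 := key Complex.I (by simp)
    have k4 := key (-Complex.I) (by simp)
    rw [one_smul] at k1
    rw [neg_smul, one_smul, ← sub_eq_add_neg] at k2
    rw [neg_smul, ← sub_eq_add_neg] at k4
    refine (norm_sub_le _ _).trans ?_
    refine (add_le_add_left ((norm_add_le _ _).trans (add_le_add_left (norm_sub_le _ _) _)) _).trans ?_
    rw [norm_mul, norm_mul, Complex.norm_I, one_mul, one_mul]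
    linarith
  have hNf : 0 ≤ ∫ x, ‖f x‖ := integral_nonneg fun _ => norm_nonneg _
  have hNg : 0 ≤ ∫ x, ‖g x‖ := integral_nonneg fun _ => norm_nonneg _
  have hzero : ∀ f : Lp ℂ 2 (volume : Measure ℝ), Integrable f → ∫ x, ‖f x‖ = 0 → f = 0 := by
    intro f hf h0
    rw [integral_eq_zero_iff_of_nonneg (fun _ => norm_nonneg _) hf.norm] at h0
    refine (Lp.eq_zero_iff_ae_eq_zero).2 ?_
    filter_upwards [h0] with x hx
    exact norm_eq_zero.1 hx
  rcases hNf.eq_or_lt with h0 | hfp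
  · rw [hzero f hf h0.symm]; simp
  rcases hNg.eq_or_lt with h0 | hgp
  · rw [hzero g hg h0.symm]; simp
  set Nf := ∫ x, ‖f x‖
  set Ng := ∫ x, ‖g x‖
  have hn : ∀ N : ℝ, 0 < N → ‖((N⁻¹ : ℝ) : ℂ)‖ = N⁻¹ := fun N hN => by
    rw [Complex.norm_real, Real.norm_of_nonneg (by positivity)]
  have h3 := h2 (((Nf⁻¹ : ℝ) : ℂ) • f) (S.smul_mem _ hfS) (((Ng⁻¹ : ℝ) : ℂ) • g)
    (S.smul_mem _ hgS) (Lp_two_integrable_smul hf _).1 (Lp_two_integrable_smul hg _).1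
    (by rw [(Lp_two_integrable_smul hf _).2, hn _ hfp, inv_mul_cancel₀ hfp.ne'])
    (by rw [(Lp_two_integrable_smul hg _).2, hn _ hgp, inv_mul_cancel₀ hgp.ne'])
  rw [map_smul, inner_smul_left, inner_smul_right, norm_mul, norm_mul, RCLike.norm_conj, hn _ hfp,
    hn _ hgp, inv_mul_le_iff₀ hfp, inv_mul_le_iff₀ hgp] at h3
  linarith

theorem norm_inner_Lp_le_of_bound {e f : Lp ℂ 2 (volume : Measure ℝ)} {B : ℝ}
    (he : ∀ᵐ x, ‖e x‖ ≤ B) (hf : Integrable f) : ‖inner ℂ e f‖ ≤ B * ∫ x, ‖f x‖ := by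
  rw [inner_Lp_eq_integral, ← integral_const_mul]
  refine norm_integral_le_of_norm_le (hf.norm.const_mul B) ?_
  filter_upwards [he] with x hx
  rw [norm_mul, RCLike.norm_conj]
  gcongr

/-- The projection is f - ∑⟨bᵢ, f⟩bᵢ over an orthonormal basis of the bound space. Each bᵢ is
bounded, so |⟨bᵢ, f⟩| ≤ Bᵢ‖f‖₁, and integrable, so each term is bounded on L¹. -/
theorem exists_integral_norm_starProjection_le (a α : ℝ)
    [FiniteDimensional ℂ (boundSpace a α)] :
    ∃ C, 0 ≤ C ∧ ∀ f : Lp ℂ 2 (volume : Measure ℝ), Integrable f →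
      Integrable ((boundSpace a α)ᗮ.starProjection f) ∧
      ∫ x, ‖((boundSpace a α)ᗮ.starProjection f) x‖ ≤ C * ∫ x, ‖f x‖ := by
  set b := stdOrthonormalBasis ℂ (boundSpace a α) with hb
  choose hbi B hB using fun i => boundSpace_bounded_integrable (b i).2
  have hB0 : ∀ i, 0 ≤ B i := fun i => by
    obtain ⟨x, hx⟩ := (hB i).exists
    exact (norm_nonneg _).trans hx
  set N : Fin (Module.finrank ℂ (boundSpace a α)) → ℝ :=
    fun i => ∫ x, ‖(b i : Lp ℂ 2 (volume : Measure ℝ)) x‖ with hN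
  have hN0 : ∀ i, 0 ≤ N i := fun i => integral_nonneg fun _ => norm_nonneg _
  refine ⟨1 + ∑ i, B i * N i, add_nonneg zero_le_one
    (Finset.sum_nonneg fun i _ => mul_nonneg (hB0 i) (hN0 i)), fun f hf => ?_⟩
  have e : (boundSpace a α)ᗮ.starProjection f =
      f + ∑ i, (-inner ℂ (b i : Lp ℂ 2 (volume : Measure ℝ)) f) •
        (b i : Lp ℂ 2 (volume : Measure ℝ)) := by
    rw [Submodule.starProjection_orthogonal_val, sub_eq_add_neg, Submodule.starProjection_apply,
      b.orthogonalProjectionOnto_apply_eq_sum]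
    simp only [neg_smul, Finset.sum_neg_distrib]
    simp
  have hsum : ∀ s : Finset (Fin (Module.finrank ℂ (boundSpace a α))),
      Integrable (∑ i ∈ s, (-inner ℂ (b i : Lp ℂ 2 (volume : Measure ℝ)) f) •
        (b i : Lp ℂ 2 (volume : Measure ℝ)) : Lp ℂ 2 (volume : Measure ℝ)) ∧
      ∫ x, ‖(∑ i ∈ s, (-inner ℂ (b i : Lp ℂ 2 (volume : Measure ℝ)) f) •
        (b i : Lp ℂ 2 (volume : Measure ℝ)) : Lp ℂ 2 (volume : Measure ℝ)) x‖ ≤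
        (∑ i ∈ s, B i * N i) * ∫ x, ‖f x‖ := by
    intro s
    induction s using Finset.induction_on with
    | empty =>
      simp only [Finset.sum_empty, zero_mul]
      have h0 := Lp.coeFn_zero ℂ 2 (volume : Measure ℝ)
      refine ⟨(integrable_zero ℝ ℂ volume).congr h0.symm, le_of_eq ?_⟩
      refine integral_eq_zero_of_ae ?_
      filter_upwards [h0] with x hx
      rw [hx]
      exact norm_zero
    | insert i s his ih =>
      rw [Finset.sum_insert his, Finset.sum_insert his]
      have h1 := Lp_two_integrable_smul (hbi i) (-inner ℂ (b i : Lp ℂ 2 (volume : Measure ℝ)) f)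
      have h2 := Lp_two_integrable_add h1.1 ih.1
      refine ⟨h2.1, h2.2.trans ?_⟩
      rw [h1.2, norm_neg, add_mul]
      refine add_le_add ?_ ih.2
      have h3 := norm_inner_Lp_le_of_bound (hB i) hf
      calc _ ≤ (B i * ∫ x, ‖f x‖) * N i := by
            have := hN0 i
            gcongr
        _ = _ := by ring
  rw [e]
  have h := Lp_two_integrable_add hf (hsum Finset.univ).1
  refine ⟨h.1, h.2.trans ?_⟩
  rw [add_mul, one_mul]
  exact add_le_add le_rfl (hsum Finset.univ).2

/-- The adjoint of U_t is U_{-t}, which multiplies each bound state by a phase. -/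
theorem IsSchrodingerGroup.apply_mem_boundSpace_orthogonal (ha : 0 < a)
    {U : ℝ → Lp ℂ 2 (volume : Measure ℝ) →L[ℂ] Lp ℂ 2 (volume : Measure ℝ)}
    (hU : IsSchrodingerGroup (deltaHamiltonian a α) U) (t : ℝ)
    {h : Lp ℂ 2 (volume : Measure ℝ)} (hh : h ∈ (boundSpace a α)ᗮ) :
    U t h ∈ (boundSpace a α)ᗮ := by
  have hh' := hh
  rw [boundSpace, Submodule.mem_orthogonal] at hh' ⊢
  intro u hu
  induction hu using Submodule.span_induction with
  | mem e he =>
    obtain ⟨s, hs⟩ := boundStates_mem_graph ha he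
    rw [hU.inner_apply_right, hU.apply_eigenvector hs, inner_smul_left,
      hh' e (Submodule.subset_span he), mul_zero]
  | zero => simp
  | add x y _ _ hx hy => rw [inner_add_left, hx, hy, add_zero]
  | smul c x _ hx => rw [inner_smul_left, hx, mul_zero]

theorem ae_norm_le_of_forall_norm_inner_le {h : Lp ℂ 2 (volume : Measure ℝ)} {M : ℝ} (hM0 : 0 ≤ M)
    (hM : ∀ f : Lp ℂ 2 (volume : Measure ℝ), Integrable f → ‖inner ℂ f h‖ ≤ M * ∫ x, ‖f x‖) :
    ∀ᵐ x, ‖h x‖ ≤ M := by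
  have hloc : ∀ s : Set ℝ, volume s < ⊤ → IntegrableOn (fun x => ‖h x‖) s := fun s hs => by
    have : IsFiniteMeasure (volume.restrict s) := ⟨by simpa using hs⟩
    exact ((Lp.memLp h).restrict s).integrable (by norm_num) |>.norm
  have hM' : ∀ s : Set ℝ, volume s < ⊤ → IntegrableOn (fun _ => M) s := fun s hs =>
    integrableOn_const hs.ne
  have key := ae_nonneg_of_forall_setIntegral_nonneg_of_sigmaFinite (μ := (volume : Measure ℝ))
    (f := fun x => M - ‖h x‖) (fun s _ hs => (hM' s hs).sub (hloc s hs)) (fun s hsm hs => ?_)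
  · filter_upwards [key] with x hx
    have : 0 ≤ M - ‖h x‖ := hx
    linarith
  rw [integral_sub (hM' s hs) (hloc s hs)]
  have hfin : IsFiniteMeasure (volume.restrict s) := ⟨by simpa using hs⟩
  -- Testing against the phase of h on a set s of finite measure turns the hypothesis into ∫_s ‖h‖ ≤
  -- M|s|. Where h = 0 the quotient is 0, which does no harm.
  set w : ℝ → ℂ := s.indicator fun x => h x / ‖h x‖ with hw
  have hwn : ∀ x, ‖h x / (‖h x‖ : ℂ)‖ ≤ 1 := fun x => by
    rw [norm_div, Complex.norm_real, norm_norm]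
    exact div_self_le_one _
  have hwm : AEStronglyMeasurable (fun x => h x / (‖h x‖ : ℂ)) := by
    have h1 := (Lp.aestronglyMeasurable h).aemeasurable
    exact (h1.div (Complex.measurable_ofReal.comp_aemeasurable h1.norm)).aestronglyMeasurable
  have hmem : ∀ p : ENNReal, MemLp w p := fun p =>
    (memLp_indicator_iff_restrict hsm).2 (MemLp.of_bound hwm.restrict 1 (ae_of_all _ hwn))
  set f := (hmem 2).toLp w with hf
  have hfe : f =ᵐ[volume] w := (hmem 2).coeFn_toLp
  have hfi : Integrable f := (memLp_one_iff_integrable.1 (hmem 1)).congr hfe.symm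
  have h1 := hM f hfi
  have h2 : inner ℂ f h = ((∫ x in s, ‖h x‖ : ℝ) : ℂ) := by
    rw [inner_Lp_eq_integral, ← integral_complex_ofReal, ← integral_indicator hsm]
    refine integral_congr_ae ?_
    filter_upwards [hfe] with x hx
    rw [hx, hw]
    by_cases hxs : x ∈ s
    · simp only [indicator_of_mem hxs, map_div₀, Complex.conj_ofReal]
      rw [div_mul_eq_mul_div, Complex.conj_mul', sq]
      by_cases h0 : (‖h x‖ : ℂ) = 0
      · simp [h0]
      · rw [mul_div_assoc, div_self h0, mul_one]
    · simp [indicator_of_notMem hxs]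
  have h3 : ∫ x, ‖f x‖ ≤ ∫ _ in s, (1 : ℝ) := by
    rw [← integral_indicator hsm]
    refine integral_mono_of_nonneg (ae_of_all _ fun _ => norm_nonneg _)
      ((integrable_indicator_iff hsm).2 (integrableOn_const hs.ne)) ?_
    filter_upwards [hfe] with x hx
    rw [hx, hw]
    by_cases hxs : x ∈ s
    · simp only [indicator_of_mem hxs]; exact hwn x
    · simp [indicator_of_notMem hxs]
  have h4 : 0 ≤ ∫ x in s, ‖h x‖ := integral_nonneg fun _ => norm_nonneg _
  rw [h2, Complex.norm_real, Real.norm_of_nonneg h4] at h1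
  have h5 : ∫ _ in s, M = M * ∫ _ in s, (1 : ℝ) := by
    rw [← integral_const_mul]; simp
  rw [h5]
  linarith [mul_le_mul_of_nonneg_left h3 hM0]

end Dispersive

/-! ### Extension to L¹ and conclusion -/

section Extension

open Filter Topology Set

variable {a α : ℝ}

theorem exists_ae_norm_group_acProjection_le (ha : 0 < a) (haα : a * α ≠ -1) :
    ∃ C, 0 ≤ C ∧ ∀ U : ℝ → Lp ℂ 2 (volume : Measure ℝ) →L[ℂ] Lp ℂ 2 (volume : Measure ℝ),
      IsSchrodingerGroup (deltaHamiltonian a α) U → ∀ t : ℝ, 0 < t →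
      ∀ g : Lp ℂ 2 (volume : Measure ℝ), Integrable g →
        ∀ᵐ x, ‖(U t (acProjection (deltaHamiltonian a α) g)) x‖ ≤ C / √t * ∫ x, ‖g x‖ := by
  have := finiteDimensional_boundSpace ha α
  obtain ⟨C, hC0, hC⟩ := exists_norm_inner_self_le ha haα
  obtain ⟨D, hD0, hD⟩ := exists_integral_norm_starProjection_le a α
  refine ⟨4 * C * D * D, by positivity, fun U hU t ht g hg => ?_⟩
  rw [acProjection_eq ha haα]
  set P := (boundSpace a α)ᗮ.starProjection with hP
  have hPm : ∀ f, P f ∈ (boundSpace a α)ᗮ := Submodule.starProjection_apply_mem _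
  have hst := Real.sqrt_pos.2 ht
  have hNg : 0 ≤ ∫ x, ‖g x‖ := integral_nonneg fun _ => norm_nonneg _
  refine ae_norm_le_of_forall_norm_inner_le (by positivity) fun f hf => ?_
  have hNf : 0 ≤ ∫ x, ‖f x‖ := integral_nonneg fun _ => norm_nonneg _
  have hfix : P (U t (P g)) = U t (P g) := Submodule.starProjection_eq_self_iff.2
    (hU.apply_mem_boundSpace_orthogonal ha t (hPm g))
  -- The evolution preserves the range of P, so P may be moved onto f; polarization then takes place
  -- inside that range, and the L¹ bound for P is used once for f and once for g.
  have e : inner ℂ f (U t (P g)) = inner ℂ (P f) (U t (P g)) := by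
    rw [← hfix, ← Submodule.inner_starProjection_left_eq_right, hfix]
  rw [e]
  have h1 := norm_inner_le_of_quadratic_bound (S := (boundSpace a α)ᗮ) (V := U t) (C := C / √t)
    (by positivity) (fun f hfS hf => hC U hU t ht f hf hfS) (hD f hf).1 (hPm f) (hD g hg).1 (hPm g)
  refine h1.trans ?_
  calc 4 * (C / √t) * (∫ x, ‖(P f) x‖) * ∫ x, ‖(P g) x‖
      ≤ 4 * (C / √t) * (D * ∫ x, ‖f x‖) * (D * ∫ x, ‖g x‖) := by
        have hPg : 0 ≤ ∫ x, ‖(P g) x‖ := integral_nonneg fun _ => norm_nonneg _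
        gcongr
        · exact (hD f hf).2
        · exact (hD g hg).2
    _ = _ := by ring

/-- `L¹ ∩ L²` as a subspace of `L²`. -/
def integrableSubmodule : Submodule ℂ (Lp ℂ 2 (volume : Measure ℝ)) where
  carrier := {f | Integrable f volume}
  zero_mem' := show Integrable (0 : Lp ℂ 2 (volume : Measure ℝ)) volume from (integrable_zero ℝ ℂ volume).congr
    (Lp.coeFn_zero ℂ 2 volume).symm
  add_mem' hf hg := (Lp_two_integrable_add hf hg).1
  smul_mem' c _ hf := (Lp_two_integrable_smul hf c).1

/-- The inclusion of `L¹ ∩ L²` into `L¹`. -/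
def integrableToL1 : integrableSubmodule →ₗ[ℂ] Lp ℂ 1 (volume : Measure ℝ) where
  toFun f := MemLp.toLp (f : Lp ℂ 2 (volume : Measure ℝ))
    (memLp_one_iff_integrable.2 (show Integrable (f : Lp ℂ 2 (volume : Measure ℝ)) volume from f.2))
  map_add' f g := by
    rw [← MemLp.toLp_add]
    exact MemLp.toLp_congr _ _ (Lp.coeFn_add _ _)
  map_smul' c f := by
    rw [RingHom.id_apply, ← MemLp.toLp_const_smul]
    exact MemLp.toLp_congr _ _ (Lp.coeFn_smul _ _)

theorem coeFn_integrableToL1 (f : integrableSubmodule) :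
    integrableToL1 f =ᵐ[volume] (f : Lp ℂ 2 (volume : Measure ℝ)) :=
  MemLp.coeFn_toLp (memLp_one_iff_integrable.2 f.2)

theorem norm_integrableToL1 (f : integrableSubmodule) :
    ‖integrableToL1 f‖ = ∫ x, ‖(f : Lp ℂ 2 (volume : Measure ℝ)) x‖ := by
  rw [L1.norm_eq_integral_norm]
  refine integral_congr_ae ?_
  filter_upwards [coeFn_integrableToL1 f] with x hx
  rw [hx]

theorem denseRange_integrableToL1 : DenseRange integrableToL1 := by
  refine (Lp.dense_hasCompactSupport_contDiff (F := ℂ) (E := ℝ) (p := 1)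
    (μ := volume) (by norm_num)).mono ?_
  rintro u ⟨g, hug, hs, hg⟩
  have h2 : MemLp g 2 := hg.continuous.memLp_of_hasCompactSupport hs
  have h1 : Integrable (h2.toLp g) :=
    (hg.continuous.integrable_of_hasCompactSupport hs).congr h2.coeFn_toLp.symm
  refine ⟨⟨h2.toLp g, h1⟩, Lp.ext ?_⟩
  exact (coeFn_integrableToL1 _).trans (h2.coeFn_toLp.trans hug.symm)

/-- An operator on `L²` that is bounded from `L¹` to `L^∞` on `L¹ ∩ L²` extends to `L¹`. -/
theorem exists_extension_L1 (V : Lp ℂ 2 (volume : Measure ℝ) →L[ℂ] Lp ℂ 2 (volume : Measure ℝ))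
    {C : ℝ} (hC : 0 ≤ C) (hV : ∀ g : Lp ℂ 2 (volume : Measure ℝ), Integrable g →
      ∀ᵐ x, ‖(V g) x‖ ≤ C * ∫ x, ‖g x‖) :
    ∃ T : Lp ℂ 1 (volume : Measure ℝ) →L[ℂ] Lp ℂ ⊤ (volume : Measure ℝ),
      (∀ (u : Lp ℂ 1 (volume : Measure ℝ)) (v : Lp ℂ 2 (volume : Measure ℝ)),
        u =ᵐ[volume] v → T u =ᵐ[volume] V v) ∧ ∀ u, ‖T u‖ ≤ C * ‖u‖ := by
  have hmem : ∀ f : integrableSubmodule, MemLp (V f) ⊤ := fun f =>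
    memLp_top_of_bound (Lp.aestronglyMeasurable _) _ (hV f f.2)
  let T₀ : integrableSubmodule →ₗ[ℂ] Lp ℂ ⊤ (volume : Measure ℝ) :=
    { toFun := fun f => (hmem f).toLp _
      map_add' := fun f g => by
        rw [← MemLp.toLp_add]
        refine MemLp.toLp_congr _ _ ?_
        rw [Submodule.coe_add, map_add]
        exact Lp.coeFn_add _ _
      map_smul' := fun c f => by
        rw [RingHom.id_apply, ← MemLp.toLp_const_smul]
        refine MemLp.toLp_congr _ _ ?_
        rw [Submodule.coe_smul, map_smul]
        exact Lp.coeFn_smul _ _ }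
  have hT₀ : ∀ f, T₀ f =ᵐ[volume] V f := fun f => (hmem f).coeFn_toLp
  have hbd : ∀ f, ‖T₀ f‖ ≤ C * ‖integrableToL1 f‖ := by
    intro f
    rw [norm_integrableToL1]
    show ‖(hmem f).toLp _‖ ≤ _
    have h0 : 0 ≤ C * ∫ x, ‖(f : Lp ℂ 2 (volume : Measure ℝ)) x‖ :=
      mul_nonneg hC (integral_nonneg fun _ => norm_nonneg _)
    rw [Lp.norm_toLp, eLpNorm_exponent_top]
    exact ENNReal.toReal_le_of_le_ofReal h0 (eLpNormEssSup_le_of_ae_bound (hV f f.2))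
  refine ⟨T₀.extendOfNorm integrableToL1, fun u v huv => ?_,
    LinearMap.norm_extendOfNorm_apply_le denseRange_integrableToL1 C hbd⟩
  have hv : Integrable v := (L1.integrable_coeFn u).congr huv
  have hu : u = integrableToL1 ⟨v, hv⟩ := Lp.ext (huv.trans (coeFn_integrableToL1 ⟨v, hv⟩).symm)
  rw [hu, LinearMap.extendOfNorm_eq denseRange_integrableToL1 ⟨C, hbd⟩]
  exact hT₀ ⟨v, hv⟩

/-- `schrodingerGroup` is a choice among groups generated by -iH, so existence is all that is
needed; the estimates above hold for every such group. -/
theorem isSchrodingerGroup_schrodingerGroup (ha : 0 < a) (α : ℝ) :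
    IsSchrodingerGroup (deltaHamiltonian a α) (schrodingerGroup (deltaHamiltonian a α)) := by
  obtain ⟨lam, R, hR⟩ := exists_isRealResolvent ha α
  exact Classical.epsilon_spec ⟨_, hR.isSchrodingerGroup⟩

end Extension

end

theorem corollary3p5 (a α : ℝ) (ha : 0 < a) (haα : a * α ≠ -1) :
    -- the group `e^{-itH_α}` exists
    IsSchrodingerGroup (deltaHamiltonian a α) (schrodingerGroup (deltaHamiltonian a α)) ∧
    ∃ C : ℝ, ∀ t : ℝ, 0 < t →
      -- `T` is the continuous extension of `e^{-itH_α} P_c` from `L¹ ∩ L²` to `L¹`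
      ∃ T : Lp ℂ 1 (volume : Measure ℝ) →L[ℂ] Lp ℂ ⊤ (volume : Measure ℝ),
        (∀ (u : Lp ℂ 1 (volume : Measure ℝ)) (v : Lp ℂ 2 (volume : Measure ℝ)),
          u =ᵐ[volume] v →
            T u =ᵐ[volume] schrodingerGroup (deltaHamiltonian a α) t
              (acProjection (deltaHamiltonian a α) v)) ∧
        ∀ u : Lp ℂ 1 (volume : Measure ℝ), ‖T u‖ ≤ C * t ^ (-(1 / 2) : ℝ) * ‖u‖ := by
  have hU := isSchrodingerGroup_schrodingerGroup ha α
  refine ⟨hU, ?_⟩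
  obtain ⟨C, hC0, hC⟩ := exists_ae_norm_group_acProjection_le ha haα
  refine ⟨C, fun t ht => ?_⟩
  have ht' : t ^ (-(1 / 2) : ℝ) = (√t)⁻¹ := by
    rw [Real.rpow_neg ht.le, Real.sqrt_eq_rpow]
  have hst := Real.sqrt_pos.2 ht
  obtain ⟨T, hT, hTn⟩ := exists_extension_L1
    ((schrodingerGroup (deltaHamiltonian a α) t).comp (acProjection (deltaHamiltonian a α)))
    (C := C / √t) (by positivity) fun g hg => hC _ hU t ht g hg
  refine ⟨T, hT, fun u => ?_⟩
  rw [ht', ← div_eq_mul_inv]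
  exact hTn u
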